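/- **Conventions.** A topological operad $\mathscr C=\{\mathscr C(n)\}_{n\ge 0}$ (with $\mathscr C(0)$ a point) has continuous compositions $\gamma:\mathscr C(k)\times\mathscr C(m_1)\times\cdots\times\mathscr C(m_k)\to\mathscr C(m)$, $m=m_1+\cdots+m_k$, and a unit $1\in\mathscr C(1)$, and satisfies the usual associativity and unit axioms; an operad (in sets) is a discrete one. Products of permutations are written from the left to the right ($\sigma\sigma'$ is $\sigma$ followed by $\sigma'$), and so are products of loops. $\mathscr S=\{S_n\}$ is the operad of symmetric groups: $\gamma(\sigma;\tau_1,\dots,\tau_k)$ applies $\tau_i$ inside the $i$-th block and moves the $i$-th block to the place $\sigma(i)$. A *group operad* is an operad $\mathscr G=\{G_n\}$ of groups with a morphism of operads $\pi:\mathscr G\to\mathscr S$ consisting of homomorphisms, such that the unit is the identity of $G_1$ and $\gamma(aa';b_1b_1',\dots,b_kb_k')=\gamma(a;b_1,\dots,b_k)\,\gamma(a';b'_{a^{-1}(1)},\dots,b'_{a^{-1}(k)})$, where $a$ acts on indices through $\pi$. It is *non-crossed* if every $\pi:G_n\to S_n$ is trivial, and *crossed* otherwise. A morphism of group operads is a sequence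 of homomorphisms commuting with $\gamma$ and $\pi$. A *sub group operad* is a sequence of subgroups closed under $\gamma$; it is normal if every one of these subgroups is. A (topological) *$\mathscr G$-operad* is a (topological) operad $\mathscr C$ with left actions of $G_n$ on $\mathscr C(n)$ (by continuous maps) such that $\gamma(\sigma a;\tau_1b_1,\dots,\tau_kb_k)=\gamma(\sigma;\tau_1,\dots,\tau_k)\,\gamma(a;b_{\sigma^{-1}(1)},\dots,b_{\sigma^{-1}(k)})$. Let $\mathscr G$ be a group operad, $\mathscr H$ a non-crossed normal sub group operad, and $\mathscr C$ a topological $\mathscr G$-operad. Then $\mathscr G/\mathscr H=\{G_n/H_n\}$ is a group operad and the orbit spaces $\mathscr C/\mathscr H=\{\mathscr C(n)/H_n\}$ form a topological $\mathscr G/\mathscr H$-operad. Assume that * every $\mathscr C(n)/H_n$ is path-connected; * the action of $G_n/H_n$ on $\mathscr C(n)/H_n$ is a covering action for each $n$: every point has a neighbourhood $U$ with $gU\cap U=\emptyset$ for all $g\ne 1$; * $\mathscr C/\mathscr H$ has a good basepoint: there is a morphism $\eta:(\mathscr C_1)_0\to\mathscr C/\mathscr H$ of nonsymmetric topological operads,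 where $(\mathscr C_1)_0(n)$ is the path component of $c_n=([0,\frac1n],\dots,[\frac{n-1}n,1])$ in the space $\mathscr C_1(n)$ of the little intervals operad. Put $e_n=\eta(c_n)$. The images under $\eta$ of the straight-line paths in $(\mathscr C_1)_0(n)$ are called linear paths. Let $\mathscr C/\mathscr G=\{\mathscr C(n)/G_n\}$, with basepoints the images of the $e_n$. An element of $\pi_1(\mathscr C(n)/G_n)$ is represented by a path in $\mathscr C(n)/H_n$ from $e_n$ to $\sigma e_n$ with $\sigma\in G_n/H_n$. **Theorem.** 1. The groups $\pi_1(\mathscr C/\mathscr H)=\{\pi_1(\mathscr C(n)/H_n,e_n)\}$ form a non-crossed group operad, with $\gamma([f];[g_1],\dots,[g_k])=[\delta\cdot\gamma(f;g_1,\dots,g_k)\cdot\delta^{-1}]$, $\delta$ the linear path from $e_m$ to $\gamma(e_k;e_{m_1},\dots,e_{m_k})$. 2. The groups $\pi_1(\mathscr C/\mathscr G)=\{\pi_1(\mathscr C(n)/G_n)\}$ form a group operad. For paths $f$ from $e_k$ to $\sigma e_k$ and $g_i$ from $e_{m_i}$ to $\tau_ie_{m_i}$ in $\mathscr C/\mathscr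 H$ ($\sigma\in G_k/H_k$, $\tau_i\in G_{m_i}/H_{m_i}$), $\gamma([f];[g_1],\dots,[g_k])$ is represented by the path $\delta_1\cdot\gamma(f;g_1,\dots,g_k)\cdot\gamma(\sigma;\tau_1,\dots,\tau_k)\delta_2^{-1}$ from $e_m$ to $\gamma(\sigma;\tau_1,\dots,\tau_k)e_m$, where $\delta_1$ and $\delta_2$ are the linear paths from $e_m$ to $\gamma(e_k;e_{m_1},\dots,e_{m_k})$ and to $\gamma(e_k;e_{m_{\sigma^{-1}(1)}},\dots,e_{m_{\sigma^{-1}(k)}})$. The canonical homeomorphisms $(\mathscr C(n)/H_n)/(G_n/H_n)\cong\mathscr C(n)/G_n$ identify it, as a group operad, with $\pi_1((\mathscr C/\mathscr H)/(\mathscr G/\mathscr H))$. 3. There is a short exact sequence of group operads $$1\to\pi_1(\mathscr C/\mathscr H)\to\pi_1(\mathscr C/\mathscr G)\to\mathscr G/\mathscr H\to1,$$ in which the first map is induced by the projections $\mathscr C(n)/H_n\to\mathscr C(n)/G_n$ and the second map sends the class of a path from $e_n$ to $\sigma e_n$ to $\sigma$. 4. For $l>1$, and also for $l=1$ if $\mathscr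 G$ is non-crossed, $\pi_l(\mathscr C/\mathscr G)=\{\pi_l(\mathscr C(n)/G_n)\}$ is a $\pi_1(\mathscr C/\mathscr G)$-operad, where $\pi_1(\mathscr C(n)/G_n)$ acts on $\pi_l(\mathscr C(n)/G_n)$ in the usual way (by conjugation if $l=1$). Its composition is the one of part 2 if $l=1$; for $l>1$ it is given by $\gamma([f];[g_1],\dots,[g_k])=\delta_*[\gamma(f;g_1,\dots,g_k)]$ for $f$, $g_i$ representing elements of $\pi_l(\mathscr C(k)/H_k,e_k)$, $\pi_l(\mathscr C(m_i)/H_{m_i},e_{m_i})$, where $\pi_l(\mathscr C(n)/H_n,e_n)\cong\pi_l(\mathscr C(n)/G_n)$ by projection and $\delta_*$ is the change of basepoint along the linear path $\delta$ of part 1. -/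

import Mathlib

universe u v w

/-! ## Blocks -/

/-- The lexicographic identification of `k` consecutive blocks of sizes `m 0, …, m (k-1)` with
`{0, …, n-1}`, where `n = m 0 + ⋯ + m (k-1)`. -/
def blockIndex {k n : ℕ} (m : Fin k → ℕ) (h : ∑ i, m i = n) : (Σ i, Fin (m i)) ≃ Fin n :=
  finSigmaFinEquiv.trans (finCongr h)

theorem blockIndex_val {k n : ℕ} (m : Fin k → ℕ) (h : ∑ i, m i = n) (i : Fin k) (j : Fin (m i)) :
    (blockIndex m h ⟨i, j⟩ : ℕ) = ∑ i' ∈ Finset.univ.filter (· < i), m i' + j := by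
  simp only [blockIndex, Equiv.trans_apply, finCongr_apply, Fin.val_cast, finSigmaFinEquiv_apply]
  congr 1
  refine Finset.sum_bij (fun x _ => Fin.castLE i.2.le x) ?_ ?_ ?_ ?_
  · intro x _
    exact Finset.mem_filter.2 ⟨Finset.mem_univ _, x.2⟩
  · intro x _ y _ hxy
    simpa using hxy
  · intro b hb
    have hb' : b < i := by simpa using hb
    exact ⟨⟨b, hb'⟩, by simp, by ext; simp⟩
  · intro x _
    rfl

theorem blockIndex_lt {k n : ℕ} (m : Fin k → ℕ) (h : ∑ i, m i = n) (i i' : Fin k) (j : Fin (m i))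
    (j' : Fin (m i')) (hlt : i < i' ∨ (i = i' ∧ (j : ℕ) < j')) :
    blockIndex m h ⟨i, j⟩ < blockIndex m h ⟨i', j'⟩ := by
  rw [Fin.lt_def, blockIndex_val, blockIndex_val]
  rcases hlt with hlt | ⟨rfl, hlt⟩
  · have hsub : insert i (Finset.univ.filter (· < i)) ⊆ Finset.univ.filter (· < i') := by
      intro x hx
      simp only [Finset.mem_insert, Finset.mem_filter, Finset.mem_univ, true_and] at hx ⊢
      rcases hx with rfl | hx
      · exact hlt
      · exact hx.trans hlt
    have h1 := Finset.sum_le_sum_of_subset (f := m) hsub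
    rw [Finset.sum_insert (by simp)] at h1
    have := j.2
    omega
  · omega

theorem blockIndex_assoc {k M N : ℕ} (m : Fin k → ℕ) (hm : ∑ i, m i = M) (p : Fin M → ℕ)
    (hp : ∑ x, p x = N) (q : Fin k → ℕ) (hq : ∀ i, ∑ j, p (blockIndex m hm ⟨i, j⟩) = q i)
    (hN : ∑ i, q i = N) (i : Fin k) (j : Fin (m i)) (l : Fin (p (blockIndex m hm ⟨i, j⟩))) :
    blockIndex p hp ⟨blockIndex m hm ⟨i, j⟩, l⟩ =
      blockIndex q hN ⟨i, blockIndex (fun j => p (blockIndex m hm ⟨i, j⟩)) (hq i) ⟨j, l⟩⟩ := by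
  let E₁ : (Σ i, Σ j, Fin (p (blockIndex m hm ⟨i, j⟩))) ≃ Fin N :=
    (Equiv.sigmaAssoc (fun i j => Fin (p (blockIndex m hm ⟨i, j⟩)))).symm.trans
      ((Equiv.sigmaCongrLeft (β := fun x => Fin (p x)) (blockIndex m hm)).trans (blockIndex p hp))
  let E₂ : (Σ i, Σ j, Fin (p (blockIndex m hm ⟨i, j⟩))) ≃ Fin N :=
    (Equiv.sigmaCongrRight fun i =>
      blockIndex (fun j => p (blockIndex m hm ⟨i, j⟩)) (hq i)).trans (blockIndex q hN)
  have h₁ : ∀ i j l, E₁ ⟨i, j, l⟩ = blockIndex p hp ⟨blockIndex m hm ⟨i, j⟩, l⟩ :=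
    fun i j l => rfl
  have h₂ : ∀ i j l, E₂ ⟨i, j, l⟩ = blockIndex q hN
      ⟨i, blockIndex (fun j => p (blockIndex m hm ⟨i, j⟩)) (hq i) ⟨j, l⟩⟩ := fun i j l => rfl
  let R : (Σ i, Σ j, Fin (p (blockIndex m hm ⟨i, j⟩))) →
      (Σ i, Σ j, Fin (p (blockIndex m hm ⟨i, j⟩))) → Prop := fun x y =>
    x.1 < y.1 ∨ (x.1 = y.1 ∧ ((x.2.1 : ℕ) < y.2.1 ∨
      ((x.2.1 : ℕ) = y.2.1 ∧ (x.2.2 : ℕ) < y.2.2)))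
  have htri : ∀ x y, x ≠ y → R x y ∨ R y x := by
    rintro ⟨i, j, l⟩ ⟨i', j', l'⟩ hne
    simp only [R]
    rcases lt_trichotomy i i' with h | rfl | h
    · exact Or.inl (Or.inl h)
    · rcases lt_trichotomy j j' with h | rfl | h
      · exact Or.inl (Or.inr ⟨rfl, Or.inl h⟩)
      · rcases lt_trichotomy l l' with h | rfl | h
        · exact Or.inl (Or.inr ⟨rfl, Or.inr ⟨rfl, h⟩⟩)
        · exact absurd rfl hne
        · exact Or.inr (Or.inr ⟨rfl, Or.inr ⟨rfl, h⟩⟩)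
      · exact Or.inr (Or.inr ⟨rfl, Or.inl h⟩)
    · exact Or.inr (Or.inl h)
  have m₁ : ∀ x y, R x y → E₁ x < E₁ y := by
    rintro ⟨i, j, l⟩ ⟨i', j', l'⟩ h
    rw [h₁, h₁]
    apply blockIndex_lt
    rcases h with h | ⟨h, h'⟩
    · exact Or.inl (blockIndex_lt _ _ _ _ _ _ (Or.inl h))
    · dsimp only at h h'
      subst h
      rcases h' with h' | ⟨h', h''⟩
      · exact Or.inl (blockIndex_lt _ _ _ _ _ _ (Or.inr ⟨rfl, h'⟩))
      · obtain rfl : j = j' := Fin.ext h'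
        exact Or.inr ⟨rfl, h''⟩
  have m₂ : ∀ x y, R x y → E₂ x < E₂ y := by
    rintro ⟨i, j, l⟩ ⟨i', j', l'⟩ h
    rw [h₂, h₂]
    apply blockIndex_lt
    rcases h with h | ⟨h, h'⟩
    · exact Or.inl h
    · dsimp only at h h'
      subst h
      refine Or.inr ⟨rfl, ?_⟩
      rw [← Fin.lt_def]
      apply blockIndex_lt
      rcases h' with h' | ⟨h', h''⟩
      · exact Or.inl h'
      · obtain rfl : j = j' := Fin.ext h'
        exact Or.inr ⟨rfl, h''⟩
  have hmono : StrictMono (fun x => E₂ (E₁.symm x)) := by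
    intro x y hxy
    rcases htri (E₁.symm x) (E₁.symm y) (fun h => hxy.ne (E₁.symm.injective h)) with h | h
    · exact m₂ _ _ h
    · have := m₁ _ _ h
      simp only [Equiv.apply_symm_apply] at this
      exact absurd this hxy.asymm
  have hsurj : Function.Surjective (fun x => E₂ (E₁.symm x)) :=
    E₂.surjective.comp E₁.symm.surjective
  have key : OrderIso.refl (Fin N) = hmono.orderIsoOfSurjective _ hsurj := Subsingleton.elim _ _
  have := congrArg (fun e : Fin N ≃o Fin N => e (E₁ ⟨i, j, l⟩)) key
  simp only [OrderIso.refl_apply, StrictMono.coe_orderIsoOfSurjective,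
    Equiv.symm_apply_apply] at this
  exact this

theorem blockIndex_congr {k n : ℕ} {m m' : Fin k → ℕ} (hmm : m = m') (h : ∑ i, m i = n)
    (h' : ∑ i, m' i = n) {i i' : Fin k} (hi : i = i') (j : Fin (m i)) (j' : Fin (m' i'))
    (hj : (j : ℕ) = j') : blockIndex m h ⟨i, j⟩ = blockIndex m' h' ⟨i', j'⟩ := by
  subst hmm hi
  rw [Fin.ext hj]

/-! ## Operads -/

/-- The data and the axioms of a (nonsymmetric) operad in sets on a sequence `C 0, C 1, …` with
`C 0` a point. The arity `n = m 0 + ⋯ + m (k-1)` of the value of `γ` is a separate argument,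
together with a proof of this equality, so that no transports are needed. -/
structure OperadStr (C : ℕ → Type u) where
  zero_point : Nonempty (Unique (C 0))
  one : C 1
  γ : ∀ {k n : ℕ} (m : Fin k → ℕ), ∑ i, m i = n → C k → (∀ i, C (m i)) → C n
  one_γ : ∀ {n : ℕ} (h : ∑ _i : Fin 1, n = n) (a : C n), γ (fun _ : Fin 1 => n) h one (fun _ => a) = a
  γ_one : ∀ {n : ℕ} (h : ∑ _i : Fin n, 1 = n) (a : C n), γ (fun _ : Fin n => 1) h a (fun _ => one) = a
  assoc : ∀ {k M N : ℕ} (m : Fin k → ℕ) (hm : ∑ i, m i = M) (p : Fin M → ℕ) (hp : ∑ x, p x = N)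
    (q : Fin k → ℕ) (hq : ∀ i, ∑ j, p (blockIndex m hm ⟨i, j⟩) = q i) (hN : ∑ i, q i = N)
    (a : C k) (b : ∀ i, C (m i)) (c : ∀ x, C (p x)),
    γ p hp (γ m hm a b) c =
      γ q hN a (fun i => γ (fun j => p (blockIndex m hm ⟨i, j⟩)) (hq i) (b i)
        (fun j => c (blockIndex m hm ⟨i, j⟩)))

/-- The permutation of `{0, …, n-1}` which applies `τ i` within the `i`-th block, and then moves
the `i`-th block to the place with number `σ i`. -/
def blockPerm {k n : ℕ} (m : Fin k → ℕ) (h : ∑ i, m i = n) (σ : Equiv.Perm (Fin k))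
    (τ : ∀ i, Equiv.Perm (Fin (m i))) : Equiv.Perm (Fin n) :=
  (blockIndex m h).symm.trans ((Equiv.sigmaCongrRight τ).trans ((Equiv.sigmaCongrLeft' σ).trans
    (blockIndex (fun i => m (σ.symm i)) ((Equiv.sum_comp σ.symm m).trans h))))

theorem blockPerm_apply {k n : ℕ} (m : Fin k → ℕ) (h : ∑ i, m i = n) (σ : Equiv.Perm (Fin k))
    (τ : ∀ i, Equiv.Perm (Fin (m i))) (h' : ∑ i, m (σ.symm i) = n) (i : Fin k)
    (j : Fin (m (σ.symm i))) :
    blockPerm m h σ τ (blockIndex m h ⟨σ.symm i, j⟩) =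
      blockIndex (fun i => m (σ.symm i)) h' ⟨i, τ (σ.symm i) j⟩ := by
  simp only [blockPerm, Equiv.trans_apply, Equiv.symm_apply_apply]
  congr 1
  rw [Equiv.sigmaCongrLeft', Equiv.symm_apply_eq]
  rfl

theorem blockPerm_symm_apply {k n : ℕ} (m : Fin k → ℕ) (h : ∑ i, m i = n) (σ : Equiv.Perm (Fin k))
    (τ : ∀ i, Equiv.Perm (Fin (m i))) (h' : ∑ i, m (σ.symm i) = n) (i : Fin k)
    (j : Fin (m (σ.symm i))) :
    (blockPerm m h σ τ).symm (blockIndex (fun i => m (σ.symm i)) h' ⟨i, j⟩) =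
      blockIndex m h ⟨σ.symm i, (τ (σ.symm i)).symm j⟩ := by
  rw [Equiv.symm_apply_eq, blockPerm_apply m h σ τ h', Equiv.apply_symm_apply]

theorem blockPerm_assoc {k M N : ℕ} (m : Fin k → ℕ) (hm : ∑ i, m i = M) (p : Fin M → ℕ)
    (hp : ∑ x, p x = N) (q : Fin k → ℕ) (hq : ∀ i, ∑ j, p (blockIndex m hm ⟨i, j⟩) = q i)
    (hN : ∑ i, q i = N) (σ : Equiv.Perm (Fin k)) (τ : ∀ i, Equiv.Perm (Fin (m i)))
    (υ : ∀ x, Equiv.Perm (Fin (p x))) :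
    blockPerm p hp (blockPerm m hm σ τ) υ =
      blockPerm q hN σ (fun i => blockPerm (fun j => p (blockIndex m hm ⟨i, j⟩)) (hq i) (τ i)
        (fun j => υ (blockIndex m hm ⟨i, j⟩))) := by
  have hm' : ∑ i, m (σ.symm i) = M := (Equiv.sum_comp σ.symm m).trans hm
  have hN' : ∑ i, q (σ.symm i) = N := (Equiv.sum_comp σ.symm q).trans hN
  have hp' : ∑ x, p ((blockPerm m hm σ τ).symm x) = N :=
    (Equiv.sum_comp (blockPerm m hm σ τ).symm p).trans hp
  have hρ := fun i j => blockPerm_symm_apply m hm σ τ hm' i j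
  have hq' : ∀ i, ∑ j, p ((blockPerm m hm σ τ).symm
      (blockIndex (fun i => m (σ.symm i)) hm' ⟨i, j⟩)) = q (σ.symm i) := by
    intro i
    simp only [hρ]
    rw [Equiv.sum_comp (τ (σ.symm i)).symm (fun j => p (blockIndex m hm ⟨σ.symm i, j⟩)), hq]
  ext x
  congr 1
  obtain ⟨⟨y, l⟩, rfl⟩ := (blockIndex p hp).surjective x
  obtain ⟨y, rfl⟩ := (blockPerm m hm σ τ).symm.surjective y
  rw [blockPerm_apply p hp _ υ hp']
  obtain ⟨⟨i, j⟩, rfl⟩ := (blockIndex (fun i => m (σ.symm i)) hm').surjective y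
  rw [blockIndex_assoc (fun i => m (σ.symm i)) hm' (fun x => p ((blockPerm m hm σ τ).symm x)) hp'
    (fun i => q (σ.symm i)) hq' hN' i j]
  suffices key : ∀ (z : Fin M) (hz : (blockPerm m hm σ τ).symm
      (blockIndex (fun i => m (σ.symm i)) hm' ⟨i, j⟩) = z) (l : Fin (p z)),
      blockIndex (fun i => q (σ.symm i)) hN' ⟨i, blockIndex _ (hq' i)
        ⟨j, Fin.cast (congrArg p hz.symm) (υ z l)⟩⟩ = blockPerm q hN σ
          (fun i => blockPerm (fun j => p (blockIndex m hm ⟨i, j⟩)) (hq i) (τ i)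
            (fun j => υ (blockIndex m hm ⟨i, j⟩))) (blockIndex p hp ⟨z, l⟩) from key _ rfl l
  intro z hz l
  obtain rfl := (hρ i j).symm.trans hz
  rw [blockIndex_assoc m hm p hp q hq hN, blockPerm_apply q hN σ _ hN']
  have hqq : ∑ j, p (blockIndex m hm ⟨σ.symm i, (τ (σ.symm i)).symm j⟩) = q (σ.symm i) :=
    (Equiv.sum_comp (τ (σ.symm i)).symm (fun j => p (blockIndex m hm ⟨σ.symm i, j⟩))).trans (hq _)
  rw [blockPerm_apply (fun j => p (blockIndex m hm ⟨σ.symm i, j⟩)) (hq _) (τ (σ.symm i))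
    (fun j => υ (blockIndex m hm ⟨σ.symm i, j⟩)) hqq j l]
  apply blockIndex_congr rfl _ _ rfl
  congr 1
  refine blockIndex_congr ?_ _ _ rfl _ _ rfl
  funext j
  exact congrArg p (hρ i j)

theorem blockIndex_one_val {n : ℕ} (h : ∑ _i : Fin 1, n = n) (i : Fin 1) (j : Fin n) :
    (blockIndex (fun _ : Fin 1 => n) h ⟨i, j⟩ : ℕ) = j := by
  rw [blockIndex_val]
  simp [Subsingleton.elim i 0]

theorem blockIndex_ones {n : ℕ} (h : ∑ _i : Fin n, 1 = n) (i : Fin n) (j : Fin 1) :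
    blockIndex (fun _ : Fin n => 1) h ⟨i, j⟩ = i := by
  ext
  rw [blockIndex_val]
  have hc : Finset.univ.filter (· < i) = Finset.Iio i := by
    ext
    simp
  simp [hc]

theorem blockPerm_one_left {n : ℕ} (h : ∑ _i : Fin 1, n = n) (a : Equiv.Perm (Fin n)) :
    blockPerm (fun _ : Fin 1 => n) h 1 (fun _ => a) = a := by
  have hid : ∀ i (x : Fin n), blockIndex (fun _ : Fin 1 => n) h ⟨i, x⟩ = x :=
    fun i x => Fin.ext (blockIndex_one_val h i x)
  refine Equiv.ext fun x => ?_
  have := blockPerm_apply (fun _ : Fin 1 => n) h 1 (fun _ => a) h 0 x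
  rwa [hid, hid] at this

theorem blockPerm_one_right {n : ℕ} (h : ∑ _i : Fin n, 1 = n) (a : Equiv.Perm (Fin n)) :
    blockPerm (fun _ : Fin n => 1) h a (fun _ => 1) = a := by
  refine Equiv.ext fun x => ?_
  obtain ⟨y, rfl⟩ := a.symm.surjective x
  have := blockPerm_apply (fun _ : Fin n => 1) h a (fun _ => 1) h y 0
  rwa [blockIndex_ones, blockIndex_ones, ← Equiv.apply_symm_apply a y,
    Equiv.symm_apply_apply] at this

/-- The operad underlying the operad of symmetric groups. The multiplication of `S n` is written
from the left to the right (`σ σ'` is `σ`, followed by `σ'`): it is the opposite of the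
multiplication of `Equiv.Perm (Fin n)`. -/
def symmOperad : OperadStr (fun n => (Equiv.Perm (Fin n))ᵐᵒᵖ) where
  zero_point := ⟨⟨⟨1⟩, fun _ => MulOpposite.unop_injective (Subsingleton.elim _ _)⟩⟩
  one := 1
  γ m h σ τ := MulOpposite.op (blockPerm m h σ.unop (fun i => (τ i).unop))
  one_γ h a := congrArg MulOpposite.op (blockPerm_one_left h a.unop)
  γ_one h a := congrArg MulOpposite.op (blockPerm_one_right h a.unop)
  assoc m hm p hp q hq hN a b c :=
    congrArg MulOpposite.op (blockPerm_assoc m hm p hp q hq hN a.unop (fun i => (b i).unop)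
      (fun x => (c x).unop))

/-- A group operad on a sequence of groups: an operad, with a morphism of operads `π` to the operad
of symmetric groups which consists of homomorphisms, such that the unit of the operad is the
identity of `G 1` and `γ` is a crossed homomorphism. -/
structure GroupOperad (G : ℕ → Type v) [∀ n, Group (G n)] extends OperadStr G where
  π : ∀ n, G n →* (Equiv.Perm (Fin n))ᵐᵒᵖ
  π_γ : ∀ {k n : ℕ} (m : Fin k → ℕ) (h : ∑ i, m i = n) (a : G k) (b : ∀ i, G (m i)),
    π n (γ m h a b) = symmOperad.γ m h (π k a) (fun i => π (m i) (b i))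
  one_eq : one = 1
  crossed : ∀ {k n : ℕ} (m : Fin k → ℕ) (h : ∑ i, m i = n) (a a' : G k) (b b' : ∀ i, G (m i))
    (h' : ∑ i, m ((π k a).unop.symm i) = n),
    γ m h (a * a') (fun i => b i * b' i) =
      γ m h a b * γ (fun i => m ((π k a).unop.symm i)) h' a' (fun i => b' ((π k a).unop.symm i))

namespace GroupOperad

variable {G : ℕ → Type v} [∀ n, Group (G n)]

/-- The permutation which underlies an element of a group operad. -/
def perm (P : GroupOperad G) {n : ℕ} (a : G n) : Equiv.Perm (Fin n) :=
  (P.π n a).unop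

theorem sum_perm (P : GroupOperad G) {k n : ℕ} {m : Fin k → ℕ} (h : ∑ i, m i = n) (a : G k) :
    ∑ i, m ((P.perm a).symm i) = n :=
  (Equiv.sum_comp (P.perm a).symm m).trans h

/-- A group operad is non-crossed if all `π` are trivial. -/
def NonCrossed (P : GroupOperad G) : Prop :=
  ∀ (n : ℕ) (a : G n), P.π n a = 1

end GroupOperad

/-- A morphism of group operads. -/
structure GroupOperadHom {G : ℕ → Type v} [∀ n, Group (G n)] (P : GroupOperad G)
    {G' : ℕ → Type w} [∀ n, Group (G' n)] (P' : GroupOperad G') where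
  toHom : ∀ n, G n →* G' n
  π_comp : ∀ (n : ℕ) (a : G n), P'.π n (toHom n a) = P.π n a
  map_γ : ∀ {k n : ℕ} (m : Fin k → ℕ) (h : ∑ i, m i = n) (a : G k) (b : ∀ i, G (m i)),
    toHom n (P.γ m h a b) = P'.γ m h (toHom k a) (fun i => toHom (m i) (b i))

/-- The equivariance property of a sequence of left actions of the groups of a group operad on the
sets of an operad; `P.perm σ` is the permutation underlying `σ`. -/
def IsOperadAction {G : ℕ → Type v} [∀ n, Group (G n)] (P : GroupOperad G) {C : ℕ → Type u}
    (O : OperadStr C) [act : ∀ n, MulAction (G n) (C n)] : Prop :=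
  ∀ {k n : ℕ} (m : Fin k → ℕ) (h : ∑ i, m i = n) (σ : G k) (τ : ∀ i, G (m i)) (a : C k)
    (b : ∀ i, C (m i)),
    O.γ m h (σ • a) (fun i => τ i • b i) =
      P.γ m h σ τ • O.γ (fun i => m ((P.perm σ).symm i)) (P.sum_perm h σ) a
        (fun i => b ((P.perm σ).symm i))

/-- A sub group operad: a sequence of subgroups which is closed under `γ`. -/
structure SubGroupOperad {G : ℕ → Type v} [∀ n, Group (G n)] (P : GroupOperad G) where
  carrier : ∀ n, Subgroup (G n)
  γ_mem : ∀ {k n : ℕ} (m : Fin k → ℕ) (h : ∑ i, m i = n) (a : G k) (b : ∀ i, G (m i)),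
    a ∈ carrier k → (∀ i, b i ∈ carrier (m i)) → P.γ m h a b ∈ carrier n

/-- A sub group operad is non-crossed if the restrictions of all `π` to it are trivial. -/
def SubGroupOperad.NonCrossed {G : ℕ → Type v} [∀ n, Group (G n)] {P : GroupOperad G}
    (H : SubGroupOperad P) : Prop :=
  ∀ (n : ℕ) (a : G n), a ∈ H.carrier n → P.π n a = 1

/-! ## The quotient of a group operad by a non-crossed normal sub group operad -/

section QuotientGroupOperad

variable {G : ℕ → Type v} [∀ n, Group (G n)] {P : GroupOperad G} (H : SubGroupOperad P)

/-- The composition of `G / H`, induced by the one of `G`. -/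
noncomputable def SubGroupOperad.quotientγ {k n : ℕ} (m : Fin k → ℕ) (h : ∑ i, m i = n)
    (a : G k ⧸ H.carrier k) (b : ∀ i, G (m i) ⧸ H.carrier (m i)) : G n ⧸ H.carrier n :=
  QuotientGroup.mk (P.γ m h a.out (fun i => (b i).out))

theorem SubGroupOperad.quotientγ_mk {k n : ℕ} (m : Fin k → ℕ) (h : ∑ i, m i = n)
    (a : G k) (b : ∀ i, G (m i)) :
    H.quotientγ m h (QuotientGroup.mk a) (fun i => QuotientGroup.mk (b i)) =
      QuotientGroup.mk (P.γ m h a b) := by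
  obtain ⟨x, hx⟩ := QuotientGroup.mk_out_eq_mul (H.carrier k) a
  choose y hy using fun i => QuotientGroup.mk_out_eq_mul (H.carrier (m i)) (b i)
  rw [SubGroupOperad.quotientγ, hx]
  simp only [hy]
  rw [P.crossed m h a x b (fun i => y i) (P.sum_perm h a)]
  exact QuotientGroup.mk_mul_of_mem _ (H.γ_mem _ _ _ _ x.2 (fun i => (y _).2))

theorem SubGroupOperad.exists_rep {k : ℕ} (m : Fin k → ℕ) (b : ∀ i, G (m i) ⧸ H.carrier (m i)) :
    ∃ b' : ∀ i, G (m i), b = fun i => QuotientGroup.mk (b' i) :=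
  ⟨fun i => (b i).out, funext fun i => (QuotientGroup.out_eq' (b i)).symm⟩

/-- The quotient group operad `G / H`. -/
noncomputable def SubGroupOperad.quotient [∀ n, (H.carrier n).Normal] (hH : H.NonCrossed) :
    GroupOperad (fun n => G n ⧸ H.carrier n) where
  zero_point := by
    obtain ⟨hu⟩ := P.zero_point
    exact ⟨⟨⟨1⟩, fun x => by
      obtain ⟨x, rfl⟩ := QuotientGroup.mk_surjective x
      rw [Subsingleton.elim x 1]; rfl⟩⟩
  one := 1
  γ := H.quotientγ
  one_γ h a := by
    obtain ⟨a, rfl⟩ := QuotientGroup.mk_surjective a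
    rw [← QuotientGroup.mk_one, H.quotientγ_mk, ← P.one_eq, P.one_γ]
  γ_one h a := by
    obtain ⟨a, rfl⟩ := QuotientGroup.mk_surjective a
    rw [← QuotientGroup.mk_one]
    exact (H.quotientγ_mk _ h a (fun _ => 1)).trans (by rw [← P.one_eq, P.γ_one])
  assoc m hm p hp q hq hN a b c := by
    obtain ⟨a, rfl⟩ := QuotientGroup.mk_surjective a
    obtain ⟨b, rfl⟩ := H.exists_rep _ b
    obtain ⟨c, rfl⟩ := H.exists_rep _ c
    simp only [H.quotientγ_mk]
    rw [P.assoc m hm p hp q hq hN]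
  π n := QuotientGroup.lift (H.carrier n) (P.π n) (hH n)
  π_γ m h a b := by
    obtain ⟨a, rfl⟩ := QuotientGroup.mk_surjective a
    obtain ⟨b, rfl⟩ := H.exists_rep _ b
    rw [H.quotientγ_mk]
    exact P.π_γ m h a b
  one_eq := rfl
  crossed m h a a' b b' h' := by
    obtain ⟨a, rfl⟩ := QuotientGroup.mk_surjective a
    obtain ⟨a', rfl⟩ := QuotientGroup.mk_surjective a'
    obtain ⟨b, rfl⟩ := H.exists_rep _ b
    obtain ⟨b', rfl⟩ := H.exists_rep _ b'
    have e₁ := H.quotientγ_mk m h (a * a') (fun i => b i * b' i)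
    have e₂ := H.quotientγ_mk m h a b
    have e₃ := H.quotientγ_mk _ (P.sum_perm h a) a' (fun i => b' ((P.perm a).symm i))
    have e₄ := congrArg (QuotientGroup.mk (s := H.carrier _))
      (P.crossed m h a a' b b' (P.sum_perm h a))
    refine e₁.trans (e₄.trans ?_)
    rw [QuotientGroup.mk_mul]
    exact congrArg₂ (· * ·) e₂.symm e₃.symm

end QuotientGroupOperad

/-! ## Topological operads and their quotients -/

/-- A topological operad on a sequence of spaces: an operad with continuous `γ`. -/
structure TopOperadStr (C : ℕ → Type u) [∀ n, TopologicalSpace (C n)] extends OperadStr C where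
  continuous_γ : ∀ {k n : ℕ} (m : Fin k → ℕ) (h : ∑ i, m i = n),
    Continuous fun x : C k × (∀ i, C (m i)) => γ m h x.1 x.2

/-- A morphism of nonsymmetric topological operads. -/
structure TopOperadHom {C : ℕ → Type u} [∀ n, TopologicalSpace (C n)] (O : TopOperadStr C)
    {C' : ℕ → Type w} [∀ n, TopologicalSpace (C' n)] (O' : TopOperadStr C') where
  toMap : ∀ n, C(C n, C' n)
  map_one : toMap 1 O.one = O'.one
  map_γ : ∀ {k n : ℕ} (m : Fin k → ℕ) (h : ∑ i, m i = n) (a : C k) (b : ∀ i, C (m i)),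
    toMap n (O.γ m h a b) = O'.γ m h (toMap k a) (fun i => toMap (m i) (b i))

/-- A covering action: every point has a neighbourhood which is disjoint from all its
translates by elements other than the identity. -/
def IsCoveringAction (G : Type v) [Group G] (X : Type u) [TopologicalSpace X] [MulAction G X] :
    Prop :=
  ∀ x : X, ∃ U ∈ nhds x, ∀ g : G, ((fun y => g • y) '' U ∩ U).Nonempty → g = 1

/-- The orbit space of a left action, with the quotient topology. -/
abbrev OrbitSpace (G : Type v) [Group G] (X : Type u) [MulAction G X] : Type u :=
  MulAction.orbitRel.Quotient G X

section OrbitSpace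

variable {G : Type v} [Group G] {X : Type u} [MulAction G X]

/-- The orbit of a point, as a point of the orbit space. -/
def OrbitSpace.mk (G : Type v) [Group G] {X : Type u} [MulAction G X] (x : X) : OrbitSpace G X :=
  Quotient.mk (MulAction.orbitRel G X) x

theorem OrbitSpace.mk_surjective : Function.Surjective (OrbitSpace.mk G (X := X)) :=
  Quotient.mk_surjective

theorem OrbitSpace.mk_eq_mk {x y : X} :
    OrbitSpace.mk G x = OrbitSpace.mk G y ↔ ∃ g : G, g • y = x :=
  Quotient.eq.trans MulAction.orbitRel_apply

theorem OrbitSpace.continuous_mk [TopologicalSpace X] : Continuous (OrbitSpace.mk G (X := X)) :=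
  continuous_quot_mk

theorem OrbitSpace.isOpenQuotientMap_mk [TopologicalSpace X] [ContinuousConstSMul G X] :
    IsOpenQuotientMap (OrbitSpace.mk G (X := X)) :=
  MulAction.isOpenQuotientMap_quotientMk

/-- The action of `G / N` on `N \ X` for a normal subgroup `N`: `g N` maps the orbit of `x` to
the orbit of `g x`. -/
instance OrbitSpace.quotientAction (N : Subgroup G) [hN : N.Normal] :
    MulAction (G ⧸ N) (OrbitSpace N X) where
  smul := Quotient.map₂ (fun g x => g • x) (by
    intro a b hab x y hxy
    obtain ⟨⟨n, hn⟩, rfl⟩ := hxy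
    have h1 : a⁻¹ * b ∈ N := QuotientGroup.leftRel_apply.1 hab
    refine ⟨⟨a * n * b⁻¹, ?_⟩, ?_⟩
    · have h2 := hN.conj_mem _ (N.mul_mem hn (N.inv_mem h1)) a
      have h3 : a * (n * (a⁻¹ * b)⁻¹) * a⁻¹ = a * n * b⁻¹ := by group
      rwa [h3] at h2
    · change (a * n * b⁻¹) • b • y = a • n • y
      simp [smul_smul])
  one_smul x := by
    obtain ⟨x, rfl⟩ := OrbitSpace.mk_surjective x
    exact congrArg (OrbitSpace.mk N) (one_smul G x)
  mul_smul a b x := by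
    obtain ⟨a, rfl⟩ := QuotientGroup.mk_surjective a
    obtain ⟨b, rfl⟩ := QuotientGroup.mk_surjective b
    obtain ⟨x, rfl⟩ := OrbitSpace.mk_surjective x
    exact congrArg (OrbitSpace.mk N) (mul_smul a b x)

theorem OrbitSpace.mk_smul_mk (N : Subgroup G) [N.Normal] (g : G) (x : X) :
    (QuotientGroup.mk g : G ⧸ N) • OrbitSpace.mk N x = OrbitSpace.mk N (g • x) :=
  rfl

instance OrbitSpace.continuousConstSMul (N : Subgroup G) [N.Normal] [TopologicalSpace X]
    [ContinuousConstSMul G X] : ContinuousConstSMul (G ⧸ N) (OrbitSpace N X) where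
  continuous_const_smul a := by
    obtain ⟨a, rfl⟩ := QuotientGroup.mk_surjective a
    exact Continuous.quotient_lift (OrbitSpace.continuous_mk.comp (continuous_const_smul a)) _

/-- The projection from `N \ X` to `G \ X` for a subgroup `N` of `G`. -/
def OrbitSpace.proj (N : Subgroup G) [TopologicalSpace X] : C(OrbitSpace N X, OrbitSpace G X) where
  toFun := Quotient.map id (by
    rintro x y ⟨n, rfl⟩
    exact ⟨n, rfl⟩)
  continuous_toFun := Continuous.quotient_lift OrbitSpace.continuous_mk _

theorem OrbitSpace.proj_smul (N : Subgroup G) [N.Normal] [TopologicalSpace X] (g : G ⧸ N)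
    (x : OrbitSpace N X) : OrbitSpace.proj N (g • x) = OrbitSpace.proj N x := by
  obtain ⟨g, rfl⟩ := QuotientGroup.mk_surjective g
  obtain ⟨x, rfl⟩ := OrbitSpace.mk_surjective x
  exact OrbitSpace.mk_eq_mk.2 ⟨g, rfl⟩

/-- The canonical map from the iterated orbit space `(G / N) \ (N \ X)` to `G \ X`. -/
def OrbitSpace.iterated (N : Subgroup G) [N.Normal] [TopologicalSpace X] :
    C(OrbitSpace (G ⧸ N) (OrbitSpace N X), OrbitSpace G X) where
  toFun := Quotient.lift (OrbitSpace.proj N) (by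
    rintro x y ⟨g, rfl⟩
    exact OrbitSpace.proj_smul N g y)
  continuous_toFun := Continuous.quotient_lift (OrbitSpace.proj N).continuous _

theorem OrbitSpace.exists_rep {ι : Type*} {K : ι → Type v} [∀ i, Group (K i)] {Y : ι → Type u}
    [∀ i, MulAction (K i) (Y i)] (b : ∀ i, OrbitSpace (K i) (Y i)) :
    ∃ b' : ∀ i, Y i, b = fun i => OrbitSpace.mk _ (b' i) :=
  ⟨fun i => (b i).out, funext fun i => (Quotient.out_eq (b i)).symm⟩

end OrbitSpace

section QuotientOperad

variable {G : ℕ → Type v} [∀ n, Group (G n)] {P : GroupOperad G} (H : SubGroupOperad P)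
  {C : ℕ → Type u} [∀ n, TopologicalSpace (C n)] (O : TopOperadStr C)
  [∀ n, MulAction (G n) (C n)]

/-- The composition of `C / H`, induced by the one of `C`. -/
noncomputable def TopOperadStr.orbitγ {k n : ℕ} (m : Fin k → ℕ) (h : ∑ i, m i = n)
    (a : OrbitSpace (H.carrier k) (C k)) (b : ∀ i, OrbitSpace (H.carrier (m i)) (C (m i))) :
    OrbitSpace (H.carrier n) (C n) :=
  OrbitSpace.mk _ (O.γ m h a.out (fun i => (b i).out))

variable {O}

theorem IsOperadAction.γ_smul (hact : IsOperadAction P O.toOperadStr) {k n : ℕ} (m : Fin k → ℕ)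
    (h : ∑ i, m i = n) (σ : G k) (hσ : P.π k σ = 1) (τ : ∀ i, G (m i)) (a : C k)
    (b : ∀ i, C (m i)) :
    O.γ m h (σ • a) (fun i => τ i • b i) = P.γ m h σ τ • O.γ m h a b := by
  rw [hact m h σ τ a b]
  have hp : P.perm σ = 1 := congrArg MulOpposite.unop hσ
  congr 1
  have key : ∀ (s : Equiv.Perm (Fin k)) (hs : ∑ i, m (s.symm i) = n), s = 1 →
      O.γ (fun i => m (s.symm i)) hs a (fun i => b (s.symm i)) = O.γ m h a b := by
    rintro s hs rfl
    rfl
  exact key _ _ hp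

theorem TopOperadStr.orbitγ_mk (hH : H.NonCrossed) (hact : IsOperadAction P O.toOperadStr)
    {k n : ℕ} (m : Fin k → ℕ) (h : ∑ i, m i = n) (a : C k) (b : ∀ i, C (m i)) :
    O.orbitγ H m h (OrbitSpace.mk _ a) (fun i => OrbitSpace.mk _ (b i)) =
      OrbitSpace.mk _ (O.γ m h a b) := by
  obtain ⟨x, hx⟩ := OrbitSpace.mk_eq_mk.1
    (Quotient.out_eq (OrbitSpace.mk (H.carrier k) a) : OrbitSpace.mk _ _ = _)
  choose y hy using fun i => OrbitSpace.mk_eq_mk.1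
    (Quotient.out_eq (OrbitSpace.mk (H.carrier (m i)) (b i)) : OrbitSpace.mk _ _ = _)
  rw [TopOperadStr.orbitγ, ← hx]
  simp only [← hy]
  refine OrbitSpace.mk_eq_mk.2 ⟨⟨P.γ m h x (fun i => y i), H.γ_mem _ _ _ _ x.2 fun i => (y i).2⟩, ?_⟩
  exact (hact.γ_smul m h x (hH _ _ x.2) (fun i => y i) a b).symm

variable [∀ n, ContinuousConstSMul (G n) (C n)]

/-- The quotient operad `C / H` of a topological `G`-operad by a non-crossed sub group operad. -/
noncomputable def SubGroupOperad.quotientOperad (hH : H.NonCrossed)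
    (hact : IsOperadAction P O.toOperadStr) :
    TopOperadStr (fun n => OrbitSpace (H.carrier n) (C n)) where
  zero_point := by
    obtain ⟨hu⟩ := O.zero_point
    exact ⟨⟨⟨OrbitSpace.mk _ hu.default⟩, fun x => by
      obtain ⟨x, rfl⟩ := OrbitSpace.mk_surjective x
      exact congrArg (OrbitSpace.mk _) (Subsingleton.elim x hu.default)⟩⟩
  one := OrbitSpace.mk _ O.one
  γ := O.orbitγ H
  one_γ h a := by
    obtain ⟨a, rfl⟩ := OrbitSpace.mk_surjective a
    rw [TopOperadStr.orbitγ_mk H hH hact, O.one_γ]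
  γ_one h a := by
    obtain ⟨a, rfl⟩ := OrbitSpace.mk_surjective a
    exact (TopOperadStr.orbitγ_mk H hH hact _ h a (fun _ => O.one)).trans (by rw [O.γ_one])
  assoc m hm p hp q hq hN a b c := by
    obtain ⟨a, rfl⟩ := OrbitSpace.mk_surjective a
    obtain ⟨b, rfl⟩ := OrbitSpace.exists_rep b
    obtain ⟨c, rfl⟩ := OrbitSpace.exists_rep c
    simp only [TopOperadStr.orbitγ_mk H hH hact]
    rw [O.assoc m hm p hp q hq hN]
  continuous_γ {k n} m h := by
    have hc : ∀ n, ContinuousConstSMul (H.carrier n) (C n) :=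
      fun n => ⟨fun g => continuous_const_smul (g : G n)⟩
    have hq : IsOpenQuotientMap (Prod.map (OrbitSpace.mk (H.carrier k) (X := C k))
        (Pi.map fun i => OrbitSpace.mk (H.carrier (m i)) (X := C (m i)))) :=
      OrbitSpace.isOpenQuotientMap_mk.prodMap
        (IsOpenQuotientMap.piMap fun i => OrbitSpace.isOpenQuotientMap_mk)
    rw [hq.isQuotientMap.continuous_iff]
    refine (OrbitSpace.continuous_mk.comp (O.continuous_γ m h)).congr fun x => ?_
    exact (TopOperadStr.orbitγ_mk H hH hact m h x.1 x.2).symm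

end QuotientOperad

/-! ## The operad of little intervals -/

/-- A point of the `k`-th space of the operad of little intervals (little 1-cubes): `k` closed
subintervals `[c.1.1 i, c.1.2 i]` of `[0, 1]` with disjoint interiors, topologized by their
endpoints. The `i`-th little interval is regarded as the increasing affine map from `[0, 1]`
onto `[c.1.1 i, c.1.2 i]`. -/
def LittleIntervals (k : ℕ) : Type :=
  {c : (Fin k → ℝ) × (Fin k → ℝ) // (∀ i, 0 ≤ c.1 i ∧ c.1 i < c.2 i ∧ c.2 i ≤ 1) ∧
    ∀ i j, i ≠ j → Disjoint (Set.Ioo (c.1 i) (c.2 i)) (Set.Ioo (c.1 j) (c.2 j))}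

namespace LittleIntervals

instance (k : ℕ) : TopologicalSpace (LittleIntervals k) :=
  inferInstanceAs (TopologicalSpace {_c : (Fin k → ℝ) × (Fin k → ℝ) // _})

/-- The left endpoints. -/
def lo {k : ℕ} (c : LittleIntervals k) (i : Fin k) : ℝ := c.1.1 i

/-- The right endpoints. -/
def hi {k : ℕ} (c : LittleIntervals k) (i : Fin k) : ℝ := c.1.2 i

theorem continuous_lo {k : ℕ} (i : Fin k) : Continuous fun c : LittleIntervals k => c.lo i :=
  (continuous_apply i).comp (continuous_fst.comp continuous_subtype_val)

theorem continuous_hi {k : ℕ} (i : Fin k) : Continuous fun c : LittleIntervals k => c.hi i :=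
  (continuous_apply i).comp (continuous_snd.comp continuous_subtype_val)

theorem zero_le_lo {k : ℕ} (c : LittleIntervals k) (i : Fin k) : 0 ≤ c.lo i := (c.2.1 i).1

theorem lo_lt_hi {k : ℕ} (c : LittleIntervals k) (i : Fin k) : c.lo i < c.hi i := (c.2.1 i).2.1

theorem hi_le_one {k : ℕ} (c : LittleIntervals k) (i : Fin k) : c.hi i ≤ 1 := (c.2.1 i).2.2

theorem ext_lo_hi {k : ℕ} {c d : LittleIntervals k} (h : ∀ i, c.lo i = d.lo i)
    (h' : ∀ i, c.hi i = d.hi i) : c = d :=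
  Subtype.ext (Prod.ext (funext h) (funext h'))

theorem hi_le_or {k : ℕ} (c : LittleIntervals k) {i j : Fin k} (hij : i ≠ j) :
    c.hi i ≤ c.lo j ∨ c.hi j ≤ c.lo i := by
  have h := Set.Ioo_disjoint_Ioo.1 (c.2.2 i j hij)
  have h1 := c.lo_lt_hi i
  have h2 := c.lo_lt_hi j
  simp only [lo, hi] at *
  rcases min_le_iff.1 h with h | h <;> rcases le_max_iff.1 h with h | h
  · linarith
  · exact Or.inl h
  · exact Or.inr h
  · linarith

/-- The intervals are numbered from the left to the right. -/
def Ordered {k : ℕ} (c : LittleIntervals k) : Prop :=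
  ∀ i j, i < j → c.hi i ≤ c.lo j

/-- The configuration with given endpoints, numbered from the left to the right. -/
def ofOrdered {k : ℕ} (a b : Fin k → ℝ) (h : ∀ i, 0 ≤ a i ∧ a i < b i ∧ b i ≤ 1)
    (hab : ∀ i j, i < j → b i ≤ a j) : LittleIntervals k :=
  ⟨(a, b), h, fun i j hij => Set.Ioo_disjoint_Ioo.2 (by
    rcases lt_or_gt_of_ne hij with hlt | hlt
    · exact (min_le_left _ _).trans ((hab i j hlt).trans (le_max_right _ _))
    · exact (min_le_right _ _).trans ((hab j i hlt).trans (le_max_left _ _)))⟩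

/-- The standard configuration `([0, 1/k], [1/k, 2/k], …, [(k-1)/k, 1])`. -/
noncomputable def std (k : ℕ) : LittleIntervals k :=
  ofOrdered (fun i => (i : ℝ) / k) (fun i => ((i : ℝ) + 1) / k)
    (fun i => by
      have hk : (0 : ℝ) < k := by exact_mod_cast i.pos
      have hi : (i : ℝ) + 1 ≤ k := by exact_mod_cast i.2
      refine ⟨by positivity, by gcongr; linarith, ?_⟩
      rw [div_le_one hk]
      exact hi)
    (fun i j hij => by
      have hk : (0 : ℝ) < k := by exact_mod_cast i.pos
      have hi : (i : ℝ) + 1 ≤ j := by exact_mod_cast hij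
      gcongr)

theorem std_ordered (k : ℕ) : (std k).Ordered := by
  intro i j hij
  have hi : (i : ℝ) + 1 ≤ j := by exact_mod_cast hij
  change ((i : ℝ) + 1) / k ≤ (j : ℝ) / k
  gcongr

/-- The configuration `(1 - t) c + t c'`. -/
noncomputable def combination {k : ℕ} (c c' : LittleIntervals k) (hc : c.Ordered)
    (hc' : c'.Ordered) (t : unitInterval) : LittleIntervals k :=
  ofOrdered (fun i => (1 - (t : ℝ)) * c.lo i + t * c'.lo i)
    (fun i => (1 - (t : ℝ)) * c.hi i + t * c'.hi i)
    (fun i => by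
      have h0 := t.2.1
      have h1 := t.2.2
      have a := c.zero_le_lo i
      have a' := c'.zero_le_lo i
      have b := c.lo_lt_hi i
      have b' := c'.lo_lt_hi i
      have d := c.hi_le_one i
      have d' := c'.hi_le_one i
      refine ⟨by nlinarith, ?_, by nlinarith⟩
      rcases eq_or_lt_of_le h0 with h | h
      · rw [← h]
        simpa using b
      · nlinarith)
    (fun i j hij => by
      have h0 := t.2.1
      have h1 := t.2.2
      have a := hc i j hij
      have a' := hc' i j hij
      nlinarith)

/-- The linear path from `c` to `c'`. -/
noncomputable def linear {k : ℕ} (c c' : LittleIntervals k) (hc : c.Ordered) (hc' : c'.Ordered) :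
    Path c c' where
  toFun t := combination c c' hc hc' t
  continuous_toFun := by
    refine Continuous.subtype_mk (Continuous.prodMk ?_ ?_) _ <;>
      exact continuous_pi fun i => by fun_prop
  source' := ext_lo_hi (fun i => by simp [combination, ofOrdered, lo])
    (fun i => by simp [combination, ofOrdered, hi])
  target' := ext_lo_hi (fun i => by simp [combination, ofOrdered, lo])
    (fun i => by simp [combination, ofOrdered, hi])

theorem mem_pathComponent_iff {k : ℕ} (c : LittleIntervals k) :
    c ∈ pathComponent (std k) ↔ c.Ordered := by
  constructor
  · rintro ⟨f⟩ i j hij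
    by_contra hlt
    have hne : ∀ t, (f t).lo i ≠ (f t).lo j := by
      intro t ht
      have h1 := (f t).lo_lt_hi i
      have h2 := (f t).lo_lt_hi j
      rcases (f t).hi_le_or hij.ne with h | h <;> linarith
    have hcont : Continuous fun t => (f t).lo j - (f t).lo i :=
      ((continuous_lo j).comp f.continuous).sub ((continuous_lo i).comp f.continuous)
    have h0 : 0 < (f 0).lo j - (f 0).lo i := by
      have h1 := (std k).lo_lt_hi i
      have h2 := std_ordered k i j hij
      rw [f.source]
      linarith
    have h1 : (f 1).lo j - (f 1).lo i < 0 := by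
      rw [f.target]
      have h2 := (c.hi_le_or hij.ne).resolve_left hlt
      have h3 := c.lo_lt_hi j
      linarith
    obtain ⟨t, ht⟩ := intermediate_value_univ 1 0 hcont ⟨h1.le, h0.le⟩
    exact hne t (by simp only at ht; linarith)
  · intro hc
    exact ⟨linear _ _ (std_ordered k) hc⟩

/-- The composition of little intervals. -/
noncomputable def comp {k n : ℕ} (m : Fin k → ℕ) (h : ∑ i, m i = n) (c : LittleIntervals k)
    (d : ∀ i, LittleIntervals (m i)) : LittleIntervals n :=
  ⟨(fun x => c.lo ((blockIndex m h).symm x).1 +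
      (c.hi ((blockIndex m h).symm x).1 - c.lo ((blockIndex m h).symm x).1) *
        (d ((blockIndex m h).symm x).1).lo ((blockIndex m h).symm x).2,
    fun x => c.lo ((blockIndex m h).symm x).1 +
      (c.hi ((blockIndex m h).symm x).1 - c.lo ((blockIndex m h).symm x).1) *
        (d ((blockIndex m h).symm x).1).hi ((blockIndex m h).symm x).2), by
  constructor
  · intro x
    dsimp only
    generalize (blockIndex m h).symm x = y
    obtain ⟨i, j⟩ := y
    have a := c.zero_le_lo i
    have b := c.lo_lt_hi i
    have e := c.hi_le_one i
    have a' := (d i).zero_le_lo j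
    have b' := (d i).lo_lt_hi j
    have e' := (d i).hi_le_one j
    dsimp only
    refine ⟨by nlinarith, by nlinarith, by nlinarith⟩
  · intro x y hxy
    have hxy' : (blockIndex m h).symm x ≠ (blockIndex m h).symm y :=
      fun h' => hxy ((blockIndex m h).symm.injective h')
    revert hxy'
    dsimp only
    generalize (blockIndex m h).symm x = x'
    generalize (blockIndex m h).symm y = y'
    obtain ⟨i, j⟩ := x'
    obtain ⟨i', j'⟩ := y'
    intro hne
    dsimp only
    have b := c.lo_lt_hi i
    by_cases hi : i = i'
    · subst hi
      have hj : j ≠ j' := fun hj => hne (by rw [hj])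
      rw [Set.Ioo_disjoint_Ioo]
      rcases (d i).hi_le_or hj with hd | hd
      · exact (min_le_left _ _).trans (le_trans (by gcongr) (le_max_right _ _))
      · exact (min_le_right _ _).trans (le_trans (by gcongr) (le_max_left _ _))
    · have b' := c.lo_lt_hi i'
      have s : ∀ (u : Fin k) (v : Fin (m u)),
          Set.Ioo (c.lo u + (c.hi u - c.lo u) * (d u).lo v)
            (c.lo u + (c.hi u - c.lo u) * (d u).hi v) ⊆ Set.Ioo (c.lo u) (c.hi u) := by
        intro u v
        have a := (d u).zero_le_lo v
        have e := (d u).hi_le_one v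
        have f := c.lo_lt_hi u
        exact Set.Ioo_subset_Ioo (by nlinarith) (by nlinarith)
      exact (c.2.2 i i' hi).mono (s i j) (s i' j')⟩

theorem comp_lo {k n : ℕ} (m : Fin k → ℕ) (h : ∑ i, m i = n) (c : LittleIntervals k)
    (d : ∀ i, LittleIntervals (m i)) (i : Fin k) (j : Fin (m i)) :
    (comp m h c d).lo (blockIndex m h ⟨i, j⟩) = c.lo i + (c.hi i - c.lo i) * (d i).lo j := by
  simp only [comp, lo]
  rw [Equiv.symm_apply_apply]

theorem comp_hi {k n : ℕ} (m : Fin k → ℕ) (h : ∑ i, m i = n) (c : LittleIntervals k)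
    (d : ∀ i, LittleIntervals (m i)) (i : Fin k) (j : Fin (m i)) :
    (comp m h c d).hi (blockIndex m h ⟨i, j⟩) = c.lo i + (c.hi i - c.lo i) * (d i).hi j := by
  simp only [comp, hi]
  rw [Equiv.symm_apply_apply]

theorem comp_ordered {k n : ℕ} (m : Fin k → ℕ) (h : ∑ i, m i = n) {c : LittleIntervals k}
    {d : ∀ i, LittleIntervals (m i)} (hc : c.Ordered) (hd : ∀ i, (d i).Ordered) :
    (comp m h c d).Ordered := by
  intro x y hxy
  obtain ⟨⟨i, j⟩, rfl⟩ := (blockIndex m h).surjective x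
  obtain ⟨⟨i', j'⟩, rfl⟩ := (blockIndex m h).surjective y
  rw [comp_lo, comp_hi]
  have b := c.lo_lt_hi i
  have b' := c.lo_lt_hi i'
  have e := (d i).hi_le_one j
  have a := (d i').zero_le_lo j'
  rcases lt_trichotomy i i' with hi | rfl | hi
  · have := hc i i' hi
    nlinarith
  · have hj : j < j' := by
      by_contra hj
      rcases eq_or_lt_of_le (not_lt.1 hj) with hj | hj
      · subst hj
        exact lt_irrefl _ hxy
      · exact hxy.asymm (blockIndex_lt _ _ _ _ _ _ (Or.inr ⟨rfl, hj⟩))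
    have := hd i j j' hj
    gcongr
  · exact absurd (blockIndex_lt m h _ _ j' j (Or.inl hi)) hxy.asymm

theorem continuous_comp {k n : ℕ} (m : Fin k → ℕ) (h : ∑ i, m i = n) :
    Continuous fun x : LittleIntervals k × (∀ i, LittleIntervals (m i)) => comp m h x.1 x.2 := by
  have hl : ∀ i : Fin k, Continuous fun x : LittleIntervals k × (∀ i, LittleIntervals (m i)) =>
      x.1.lo i := fun i => (continuous_lo i).comp continuous_fst
  have hh : ∀ i : Fin k, Continuous fun x : LittleIntervals k × (∀ i, LittleIntervals (m i)) =>
      x.1.hi i := fun i => (continuous_hi i).comp continuous_fst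
  have hl' : ∀ (i : Fin k) (j : Fin (m i)),
      Continuous fun x : LittleIntervals k × (∀ i, LittleIntervals (m i)) => (x.2 i).lo j :=
    fun i j => (continuous_lo j).comp ((continuous_apply i).comp continuous_snd)
  have hh' : ∀ (i : Fin k) (j : Fin (m i)),
      Continuous fun x : LittleIntervals k × (∀ i, LittleIntervals (m i)) => (x.2 i).hi j :=
    fun i j => (continuous_hi j).comp ((continuous_apply i).comp continuous_snd)
  refine Continuous.subtype_mk (Continuous.prodMk ?_ ?_) _
  · exact continuous_pi fun x => (hl _).add (((hh _).sub (hl _)).mul (hl' _ _))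
  · exact continuous_pi fun x => (hl _).add (((hh _).sub (hl _)).mul (hh' _ _))

end LittleIntervals

/-- The path component of the standard configuration in the space of `k` little intervals. -/
def IntervalComponent (k : ℕ) : Type :=
  {c : LittleIntervals k // c ∈ pathComponent (LittleIntervals.std k)}

namespace IntervalComponent

open LittleIntervals

instance (k : ℕ) : TopologicalSpace (IntervalComponent k) :=
  inferInstanceAs (TopologicalSpace {_c : LittleIntervals k // _})

theorem ordered {k : ℕ} (c : IntervalComponent k) : c.1.Ordered :=
  (mem_pathComponent_iff c.1).1 c.2

/-- The standard configuration. -/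
noncomputable def std (k : ℕ) : IntervalComponent k :=
  ⟨LittleIntervals.std k, mem_pathComponent_self _⟩

/-- The linear path `t ↦ (1 - t) c + t c'`. -/
noncomputable def linear {k : ℕ} (c c' : IntervalComponent k) : Path c c' where
  toFun t := ⟨combination c.1 c'.1 c.ordered c'.ordered t,
    (mem_pathComponent_iff _).2 (fun i j hij => by
      have h0 := t.2.1
      have h1 := t.2.2
      have a := c.ordered i j hij
      have a' := c'.ordered i j hij
      change (1 - (t : ℝ)) * c.1.hi i + t * c'.1.hi i ≤ (1 - (t : ℝ)) * c.1.lo j + t * c'.1.lo j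
      nlinarith)⟩
  continuous_toFun :=
    Continuous.subtype_mk (LittleIntervals.linear c.1 c'.1 c.ordered c'.ordered).continuous _
  source' := Subtype.ext (LittleIntervals.linear c.1 c'.1 c.ordered c'.ordered).source
  target' := Subtype.ext (LittleIntervals.linear c.1 c'.1 c.ordered c'.ordered).target

/-- The nonsymmetric operad formed by the path components of the standard configurations in the
operad of little intervals. -/
noncomputable def operad : TopOperadStr IntervalComponent where
  zero_point := ⟨⟨⟨std 0⟩, fun _ => Subtype.ext (ext_lo_hi (fun i => i.elim0) fun i => i.elim0)⟩⟩
  one := std 1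
  γ m h c d := ⟨comp m h c.1 (fun i => (d i).1),
    (mem_pathComponent_iff _).2 (comp_ordered m h c.ordered fun i => (d i).ordered)⟩
  one_γ {n} h a := by
    have hid : ∀ x : Fin n, x = blockIndex (fun _ : Fin 1 => n) h ⟨0, x⟩ :=
      fun x => Fin.ext (blockIndex_one_val h 0 x).symm
    have h0 : (std 1).1.lo 0 = 0 := by simp [std, LittleIntervals.std, ofOrdered, lo]
    have h1 : (std 1).1.hi 0 = 1 := by simp [std, LittleIntervals.std, ofOrdered, hi]
    refine Subtype.ext (ext_lo_hi (fun x => ?_) fun x => ?_)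
    · conv_lhs => rw [hid x]
      exact (comp_lo _ _ _ _ _ _).trans (by rw [h0, h1]; ring)
    · conv_lhs => rw [hid x]
      exact (comp_hi _ _ _ _ _ _).trans (by rw [h0, h1]; ring)
  γ_one {n} h a := by
    have h0 : (std 1).1.lo 0 = 0 := by simp [std, LittleIntervals.std, ofOrdered, lo]
    have h1 : (std 1).1.hi 0 = 1 := by simp [std, LittleIntervals.std, ofOrdered, hi]
    refine Subtype.ext (ext_lo_hi (fun x => ?_) fun x => ?_)
    · conv_lhs => rw [← blockIndex_ones h x 0]
      exact (comp_lo _ _ _ _ _ _).trans (by rw [h0]; ring)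
    · conv_lhs => rw [← blockIndex_ones h x 0]
      exact (comp_hi _ _ _ _ _ _).trans (by rw [h1]; ring)
  assoc m hm p hp q hq hN a b c := by
    refine Subtype.ext (ext_lo_hi (fun x => ?_) fun x => ?_)
    · obtain ⟨⟨y, l⟩, rfl⟩ := (blockIndex p hp).surjective x
      obtain ⟨⟨i, j⟩, rfl⟩ := (blockIndex m hm).surjective y
      refine (comp_lo _ _ _ _ _ _).trans ?_
      rw [comp_lo, comp_hi, blockIndex_assoc m hm p hp q hq hN]
      refine Eq.trans ?_ (comp_lo _ _ _ _ _ _).symm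
      rw [comp_lo]
      ring
    · obtain ⟨⟨y, l⟩, rfl⟩ := (blockIndex p hp).surjective x
      obtain ⟨⟨i, j⟩, rfl⟩ := (blockIndex m hm).surjective y
      refine (comp_hi _ _ _ _ _ _).trans ?_
      rw [comp_lo, comp_hi, blockIndex_assoc m hm p hp q hq hN]
      refine Eq.trans ?_ (comp_hi _ _ _ _ _ _).symm
      rw [comp_hi]
      ring
  continuous_γ {k n} m h := by
    have h₁ : Continuous fun x : IntervalComponent k × (∀ i, IntervalComponent (m i)) => x.1.1 :=
      continuous_subtype_val.comp continuous_fst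
    have h₂ : ∀ i, Continuous fun x : IntervalComponent k × (∀ i, IntervalComponent (m i)) =>
        (x.2 i).1 :=
      fun i => continuous_subtype_val.comp ((continuous_apply i).comp continuous_snd)
    exact Continuous.subtype_mk ((continuous_comp m h).comp (h₁.prodMk (continuous_pi h₂))) _

end IntervalComponent

section QuotientAction

variable {G : ℕ → Type v} [∀ n, Group (G n)] {P : GroupOperad G} (H : SubGroupOperad P)
  [∀ n, (H.carrier n).Normal] {C : ℕ → Type u} [∀ n, TopologicalSpace (C n)] {O : TopOperadStr C}
  [∀ n, MulAction (G n) (C n)] [∀ n, ContinuousConstSMul (G n) (C n)]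

/-- `C / H` is a topological `G / H`-operad. -/
theorem SubGroupOperad.isOperadAction_quotient (hH : H.NonCrossed)
    (hact : IsOperadAction P O.toOperadStr) :
    IsOperadAction (H.quotient hH) (H.quotientOperad hH hact).toOperadStr := by
  intro k n m h σ τ a b
  obtain ⟨σ, rfl⟩ := QuotientGroup.mk_surjective σ
  obtain ⟨τ, rfl⟩ := H.exists_rep _ τ
  obtain ⟨a, rfl⟩ := OrbitSpace.mk_surjective a
  obtain ⟨b, rfl⟩ := OrbitSpace.exists_rep b
  have e₁ := TopOperadStr.orbitγ_mk H hH hact m h (σ • a) (fun i => τ i • b i)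
  have e₂ := TopOperadStr.orbitγ_mk H hH hact _ (P.sum_perm h σ) a
    (fun i => b ((P.perm σ).symm i))
  have e₃ := H.quotientγ_mk m h σ τ
  refine e₁.trans ((congrArg (OrbitSpace.mk _) (hact m h σ τ a b)).trans ?_)
  exact (congrArg₂ (fun (x : G n ⧸ H.carrier n) (y : OrbitSpace (H.carrier n) (C n)) => x • y)
    e₃ e₂).symm

end QuotientAction

/-! ## Fundamental groups and higher homotopy groups -/

/-- The fundamental group, with the product of loops written in the order in which the loops are
passed through (this is the opposite of the convention of `FundamentalGroup`). -/
abbrev LoopGroup (X : Type u) [TopologicalSpace X] (x : X) : Type u :=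
  (FundamentalGroup X x)ᵐᵒᵖ

/-- The class of a loop. -/
def LoopGroup.mk {X : Type u} [TopologicalSpace X] {x : X} (f : Path x x) : LoopGroup X x :=
  MulOpposite.op (FundamentalGroup.fromPath (Path.Homotopic.Quotient.mk f))

theorem LoopGroup.mk_mul_mk {X : Type u} [TopologicalSpace X] {x : X} (f g : Path x x) :
    LoopGroup.mk f * LoopGroup.mk g = LoopGroup.mk (f.trans g) :=
  rfl

/-- The class of an `l`-dimensional loop, i.e. of a map from the cube `I^l` which sends the boundary
to the basepoint. -/
def cubeClass {X : Type u} [TopologicalSpace X] {x : X} {l : ℕ} (f : GenLoop (Fin l) X x) :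
    HomotopyGroup.Pi l X x :=
  Quotient.mk _ f

/-- The image of an `l`-dimensional loop under a continuous map. -/
def cubeMap {X : Type u} [TopologicalSpace X] {Y : Type v} [TopologicalSpace Y] (φ : C(X, Y))
    {x : X} {l : ℕ} (f : GenLoop (Fin l) X x) : GenLoop (Fin l) Y (φ x) :=
  ⟨φ.comp f.1, fun t ht => congrArg φ (f.2 t ht)⟩

/-- The distance of a point of the cube from its centre in the maximum norm, with values in
`[0, 1]`; the value is `1` exactly on the boundary. -/
noncomputable def cubeRadius {l : ℕ} (t : Fin l → unitInterval) : ℝ :=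
  ‖fun i => 2 * (t i : ℝ) - 1‖

theorem continuous_cubeRadius (l : ℕ) : Continuous (cubeRadius (l := l)) := by
  unfold cubeRadius
  fun_prop

/-- Change of the basepoint of an `l`-dimensional loop `f` along a path `a`: on the concentric
subcube of half the size it is `f`, rescaled, and on the rest of the cube it is `a` on each radial
segment, beginning at the boundary of the cube. -/
noncomputable def cubeAlong {X : Type u} [TopologicalSpace X] {x y : X} {l : ℕ} (a : Path x y)
    (f : GenLoop (Fin l) X y) : GenLoop (Fin l) X x :=
  ⟨⟨fun t => if cubeRadius t ≤ 1 / 2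
      then f (fun i => Set.projIcc 0 1 zero_le_one (2 * (t i : ℝ) - 1 / 2))
      else a.extend (2 - 2 * cubeRadius t), by
    refine Continuous.if_le ?_ ?_ (continuous_cubeRadius l) continuous_const ?_
    · exact f.1.continuous.comp (continuous_pi fun i => continuous_projIcc.comp (by fun_prop))
    · exact a.continuous_extend.comp
        (continuous_const.sub (continuous_const.mul (continuous_cubeRadius l)))
    · intro t ht
      have h1 : a.extend (2 - 2 * cubeRadius t) = y := by
        rw [ht]
        norm_num
      rw [h1]
      apply f.2
      have hne : Nonempty (Fin l) := by
        by_contra hemp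
        rw [not_nonempty_iff] at hemp
        have : cubeRadius t = 0 := by
          unfold cubeRadius
          rw [Subsingleton.elim (fun i => 2 * (t i : ℝ) - 1) 0, norm_zero]
        rw [this] at ht
        norm_num at ht
      obtain ⟨i, -, hi⟩ := Finset.exists_mem_eq_sup' Finset.univ_nonempty
        (fun i => ‖2 * (t i : ℝ) - 1‖)
      have hr : |2 * (t i : ℝ) - 1| = 1 / 2 := by
        rw [← ht, ← Real.norm_eq_abs, ← hi]
        apply le_antisymm
        · exact Finset.sup'_le _ _ fun j _ => norm_le_pi_norm (fun i => 2 * (t i : ℝ) - 1) j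
        · exact (pi_norm_le_iff_of_nonempty _).2 fun j =>
            Finset.le_sup' (fun i => ‖2 * (t i : ℝ) - 1‖) (Finset.mem_univ j)
      refine ⟨i, ?_⟩
      rcases (abs_eq (by norm_num)).1 hr with h | h
      · right
        exact Set.projIcc_of_right_le _ (by linarith)
      · left
        exact Set.projIcc_of_le_left _ (by linarith)⟩, by
    rintro t ⟨i, hi⟩
    have h1 : 1 ≤ cubeRadius t := by
      refine le_trans ?_ (norm_le_pi_norm (fun i => 2 * (t i : ℝ) - 1) i)
      rcases hi with hi | hi <;> simp only [hi] <;> norm_num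
    change (if _ then _ else _) = _
    rw [if_neg (by linarith)]
    exact a.extend_of_le_zero (by linarith)⟩

/-! ## The homotopy groups of topological operads with a good basepoint -/

namespace TopOperadStr

variable {D : ℕ → Type u} [∀ n, TopologicalSpace (D n)] (O : TopOperadStr D)

/-- The pointwise composition `γ (f; g 0, …, g (k-1))` of paths. -/
def pathγ {k n : ℕ} (m : Fin k → ℕ) (h : ∑ i, m i = n) {x y : D k} {x' y' : ∀ i, D (m i)}
    (f : Path x y) (g : ∀ i, Path (x' i) (y' i)) : Path (O.γ m h x x') (O.γ m h y y') where
  toFun t := O.γ m h (f t) (fun i => g i t)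
  continuous_toFun := (O.continuous_γ m h).comp
    (f.continuous.prodMk (continuous_pi fun i => (g i).continuous))
  source' := by simp
  target' := by simp

/-- The pointwise composition `γ (f; g 0, …, g (k-1))` of `l`-dimensional loops. -/
def cubeγ {k n : ℕ} (m : Fin k → ℕ) (h : ∑ i, m i = n) {l : ℕ} {x : D k} {x' : ∀ i, D (m i)}
    (f : GenLoop (Fin l) (D k) x) (g : ∀ i, GenLoop (Fin l) (D (m i)) (x' i)) :
    GenLoop (Fin l) (D n) (O.γ m h x x') :=
  ⟨⟨fun t => O.γ m h (f t) (fun i => g i t), (O.continuous_γ m h).comp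
    (f.1.continuous.prodMk (continuous_pi fun i => (g i).1.continuous))⟩, fun t ht => by
      change O.γ m h (f.1 t) (fun i => (g i).1 t) = _
      rw [f.2 t ht]
      congr 1
      exact funext fun i => (g i).2 t ht⟩

end TopOperadStr

/-- A good basepoint of a topological operad is given by a morphism of nonsymmetric topological
operads from the standard components of the operad of little intervals. -/
abbrev GoodBasepoint {D : ℕ → Type u} [∀ n, TopologicalSpace (D n)] (O : TopOperadStr D) :
    Type u :=
  TopOperadHom IntervalComponent.operad O

namespace GoodBasepoint

variable {D : ℕ → Type u} [∀ n, TopologicalSpace (D n)] {O : TopOperadStr D} (η : GoodBasepoint O)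

/-- The basepoint `e n` of `D n`. -/
noncomputable def pt (n : ℕ) : D n :=
  η.toMap n (IntervalComponent.std n)

/-- The linear path from `e n` to `γ (e k; e (m 0), …, e (m (k-1)))`. -/
noncomputable def linear {k n : ℕ} (m : Fin k → ℕ) (h : ∑ i, m i = n) :
    Path (η.pt n) (O.γ m h (η.pt k) (fun i => η.pt (m i))) :=
  ((IntervalComponent.linear (IntervalComponent.std n)
    (IntervalComponent.operad.γ m h (IntervalComponent.std k)
      (fun i => IntervalComponent.std (m i)))).map (η.toMap n).continuous).cast rfl
    (η.map_γ m h _ _).symm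

/-- The composition of a group operad on the fundamental groups `π₁ (D n, e n)` is the pointwise
composition of loops, moved back to the basepoint along the linear path. -/
def IsLoopOperad (A : GroupOperad (fun n => LoopGroup (D n) (η.pt n))) : Prop :=
  ∀ {k n : ℕ} (m : Fin k → ℕ) (h : ∑ i, m i = n) (f : Path (η.pt k) (η.pt k))
    (g : ∀ i, Path (η.pt (m i)) (η.pt (m i))),
    A.γ m h (LoopGroup.mk f) (fun i => LoopGroup.mk (g i)) =
      LoopGroup.mk (((η.linear m h).trans (O.pathγ m h f g)).trans (η.linear m h).symm)

section Quotient

variable {K : ℕ → Type v} [∀ n, Group (K n)] {P : GroupOperad K} [∀ n, MulAction (K n) (D n)]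
  [∀ n, ContinuousConstSMul (K n) (D n)] (hact : IsOperadAction P O.toOperadStr)
  {Q : ℕ → Type u} [∀ n, TopologicalSpace (Q n)] (p : ∀ n, C(D n, Q n))
  (hp : ∀ (n : ℕ) (σ : K n) (x : D n), p n (σ • x) = p n x)

/-- The class in `π₁ (Q n)` of the image of a path from `e n` to `σ e n` in `D n`, where
`p n : D n → Q n` is invariant under the action. -/
noncomputable def liftClass {n : ℕ} (σ : K n) (f : Path (η.pt n) (σ • η.pt n)) :
    LoopGroup (Q n) (p n (η.pt n)) :=
  LoopGroup.mk ((f.map (p n).continuous).cast rfl (hp n σ (η.pt n)).symm)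

/-- For a path `f` from `e k` to `σ e k` and paths `g i` from `e (m i)` to `τ i e (m i)`, the path
`e n → γ (e k; e (m 0), …) → γ (σ e k; τ 0 e (m 0), …)
  = γ (σ; τ 0, …) γ (e k; e (m (σ⁻¹ 0)), …) → γ (σ; τ 0, …) e n`,
where the path in the middle is the pointwise composition and the other ones are linear. -/
noncomputable def liftγ {k n : ℕ} (m : Fin k → ℕ) (h : ∑ i, m i = n) (σ : K k)
    (τ : ∀ i, K (m i)) (f : Path (η.pt k) (σ • η.pt k))
    (g : ∀ i, Path (η.pt (m i)) (τ i • η.pt (m i))) :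
    Path (η.pt n) (P.γ m h σ τ • η.pt n) :=
  ((η.linear m h).trans ((O.pathγ m h f g).cast rfl
    (hact m h σ τ (η.pt k) (fun i => η.pt (m i))).symm)).trans
      ((η.linear (fun i => m ((P.perm σ).symm i)) (P.sum_perm h σ)).symm.map
        (continuous_const_smul (P.γ m h σ τ)))

/-- The composition of a group operad on the fundamental groups `π₁ (Q n)` of the quotients is
given by the composition of the lifts of loops to paths in `D n`. -/
def IsQuotientLoopOperad (B : GroupOperad (fun n => LoopGroup (Q n) (p n (η.pt n)))) : Prop :=
  ∀ {k n : ℕ} (m : Fin k → ℕ) (h : ∑ i, m i = n) (σ : K k) (τ : ∀ i, K (m i))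
    (f : Path (η.pt k) (σ • η.pt k)) (g : ∀ i, Path (η.pt (m i)) (τ i • η.pt (m i))),
    B.γ m h (η.liftClass p hp σ f) (fun i => η.liftClass p hp (τ i) (g i)) =
      η.liftClass p hp (P.γ m h σ τ) (η.liftγ hact m h σ τ f g)

/-- The composition of an operad on the homotopy groups `π_l (Q n)` is given by the pointwise
composition of lifts to `D n`, moved back to the basepoint along the linear path, and its
unit is the class of the constant map. -/
def IsHigherOperad (l : ℕ)
    (Ol : OperadStr (fun n => HomotopyGroup.Pi l (Q n) (p n (η.pt n)))) : Prop :=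
  Ol.one = cubeClass GenLoop.const ∧
  ∀ {k n : ℕ} (m : Fin k → ℕ) (h : ∑ i, m i = n) (f : GenLoop (Fin l) (D k) (η.pt k))
    (g : ∀ i, GenLoop (Fin l) (D (m i)) (η.pt (m i))),
    Ol.γ m h (cubeClass (cubeMap (p k) f)) (fun i => cubeClass (cubeMap (p (m i)) (g i))) =
      cubeClass (cubeMap (p n) (cubeAlong (η.linear m h) (O.cubeγ m h f g)))

end Quotient

end GoodBasepoint

/-! Write `D = C / H`, `K = G / H` and `Q = C / G`. Up to the homeomorphism from the iterated orbit
space, `Q n` is the quotient of `D n` by a covering action of `K n`. Hence every loop in `Q n` lifts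
to a path from `e n` to some `σ • e n`, and by homotopy lifting its class amounts to a pair: an
element `σ`, and a homotopy class, relative to the end points, of such paths (`exists_liftClass`,
`liftClass_eq_iff`). The product of two pairs is `f` followed by the translate `σ • g`, and their
operadic composition is the composition in `K` together with the pointwise composition of paths,
corrected by linear paths at both ends (`liftγ`). So every axiom splits into the same axiom in `K`
and a homotopy between lifts.

The corrections are coherent because ordered configurations of intervals form a convex set: two
paths of configurations with the same end points are homotopic (`IntervalComponent.hhomotopic`).
Therefore the images of such paths under `η`, the standard paths, depend only on their end
configurations up to homotopy, and they are preserved by concatenation and by `γ`. The unit laws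
hold because their corrections are null-homotopic, and associativity holds because the corrections
on both sides agree (`linear_assoc`). In the crossed law the final correction of the first factor is
cancelled by the initial correction of the second one (`liftγ_mul`). Equivariance of `γ` serves to
pull translations out of composites.

The exact sequence records the component `σ` of a pair: it is `1` exactly if the lift is closed, and
path-connectedness makes every `σ` occur. The groups `π₁ (D n)` are the case of the trivial group
operad.

For `l > 1` a map of cubes lifts with its whole boundary at the basepoint, so that `π_l (Q n)` is
computed in `D n`. The identities reduce to those of paths: the class of a map of cubes is
determined by the path which the boundary follows in a free homotopy and by the map at the other end
(`CubeHomotopicAlong.unique`). For `l = 1` the composition of a non-crossed group operad is a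
homomorphism, hence compatible with conjugation. -/

/-! ## Homotopies of paths with propositionally equal end points -/

namespace Path

variable {X : Type u} [TopologicalSpace X] {Y : Type v} [TopologicalSpace Y]

/-- Homotopy relative to the end points of two paths whose end points need not agree
definitionally. -/
def HHomotopic {x y x' y' : X} (f : Path x y) (g : Path x' y') : Prop :=
  f.toContinuousMap.HomotopicRel g.toContinuousMap {0, 1}

namespace HHomotopic

variable {x y z w x' y' z' x'' y'' : X}

theorem of_eq {f : Path x y} {g : Path x' y'} (h : ∀ t, f t = g t) : HHomotopic f g := by
  have : f.toContinuousMap = g.toContinuousMap := ContinuousMap.ext h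
  unfold HHomotopic
  rw [this]
  exact ContinuousMap.HomotopicRel.refl _

theorem refl (f : Path x y) : HHomotopic f f := of_eq fun _ => rfl

theorem symm {f : Path x y} {g : Path x' y'} (h : HHomotopic f g) : HHomotopic g f :=
  ContinuousMap.HomotopicRel.symm h

theorem trans {f : Path x y} {g : Path x' y'} {k : Path x'' y''} (h : HHomotopic f g)
    (h' : HHomotopic g k) : HHomotopic f k :=
  ContinuousMap.HomotopicRel.trans h h'

/-- A homotopy relative to `{0, 1}` fixes the end points. Once the end points are identified,
statements about `HHomotopic` reduce to those about ordinary homotopy of paths. -/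
theorem source_eq {f : Path x y} {g : Path x' y'} (h : HHomotopic f g) : x = x' := by
  have := h.fst_eq_snd (x := 0) (by simp)
  exact f.source.symm.trans (this.trans g.source)

theorem target_eq {f : Path x y} {g : Path x' y'} (h : HHomotopic f g) : y = y' := by
  have := h.fst_eq_snd (x := 1) (by simp)
  exact f.target.symm.trans (this.trans g.target)

theorem cast_left (f : Path x y) (hx : x' = x) (hy : y' = y) : HHomotopic (f.cast hx hy) f :=
  of_eq fun _ => rfl

theorem map {f : Path x y} {g : Path x' y'} (h : HHomotopic f g) {φ : X → Y}
    (hφ : Continuous φ) : HHomotopic (f.map hφ) (g.map hφ) :=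
  h.comp_continuousMap ⟨φ, hφ⟩

theorem symm₂ {f : Path x y} {g : Path x' y'} (h : HHomotopic f g) :
    HHomotopic f.symm g.symm := by
  obtain rfl := h.source_eq
  obtain rfl := h.target_eq
  exact Path.Homotopic.symm₂ h

theorem hcomp {f : Path x y} {g : Path y z} {f' : Path x' y'} {g' : Path y' z'}
    (hf : HHomotopic f f') (hg : HHomotopic g g') : HHomotopic (f.trans g) (f'.trans g') := by
  obtain rfl := hf.source_eq
  obtain rfl := hf.target_eq
  obtain rfl := hg.target_eq
  exact Path.Homotopic.hcomp hf hg

theorem assoc (f : Path x y) (g : Path y z) (k : Path z w) :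
    HHomotopic ((f.trans g).trans k) (f.trans (g.trans k)) :=
  ⟨Path.Homotopy.transAssoc f g k⟩

theorem refl_trans (f : Path x y) : HHomotopic ((Path.refl x).trans f) f :=
  ⟨Path.Homotopy.reflTrans f⟩

theorem trans_refl (f : Path x y) : HHomotopic (f.trans (Path.refl y)) f :=
  ⟨Path.Homotopy.transRefl f⟩

theorem symm_trans_self (f : Path x y) : HHomotopic (f.symm.trans f) (Path.refl y) :=
  ContinuousMap.HomotopicRel.symm ⟨Path.Homotopy.reflSymmTrans f⟩

end HHomotopic

theorem map_trans_map {x y z : X} (f : Path x y) (g : Path y z) {φ : X → Y} (hφ : Continuous φ) :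
    HHomotopic ((f.trans g).map hφ) ((f.map hφ).trans (g.map hφ)) :=
  HHomotopic.of_eq fun t => by rw [Path.map_trans]

end Path

/-! ## Paths of little intervals -/

namespace IntervalComponent

open LittleIntervals

theorem continuous_combination {k : ℕ} {A : Type u} [TopologicalSpace A]
    {f g : A → IntervalComponent k} {s : A → unitInterval} (hf : Continuous f) (hg : Continuous g)
    (hs : Continuous s) : Continuous fun a => IntervalComponent.linear (f a) (g a) (s a) := by
  have hlo : ∀ {f : A → IntervalComponent k}, Continuous f → ∀ i, Continuous fun a => (f a).1.lo i :=
    fun hf i => (continuous_lo i).comp (continuous_subtype_val.comp hf)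
  have hhi : ∀ {f : A → IntervalComponent k}, Continuous f → ∀ i, Continuous fun a => (f a).1.hi i :=
    fun hf i => (continuous_hi i).comp (continuous_subtype_val.comp hf)
  have hs' : Continuous fun a => (s a : ℝ) := continuous_subtype_val.comp hs
  refine Continuous.subtype_mk (Continuous.subtype_mk (Continuous.prodMk ?_ ?_) _) _
  · exact continuous_pi fun i =>
      ((continuous_const.sub hs').mul (hlo hf i)).add (hs'.mul (hlo hg i))
  · exact continuous_pi fun i =>
      ((continuous_const.sub hs').mul (hhi hf i)).add (hs'.mul (hhi hg i))

theorem linear_self {k : ℕ} (c : IntervalComponent k) (t : unitInterval) :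
    IntervalComponent.linear c c t = c := by
  refine Subtype.ext (ext_lo_hi (fun i => ?_) fun i => ?_)
  · change (1 - (t : ℝ)) * c.1.lo i + t * c.1.lo i = _
    ring
  · change (1 - (t : ℝ)) * c.1.hi i + t * c.1.hi i = _
    ring

/-- Any two paths of ordered configurations with the same end points are homotopic. -/
theorem hhomotopic {k : ℕ} {c d c' d' : IntervalComponent k} (hc : c = c') (hd : d = d')
    (f : Path c d) (g : Path c' d') : Path.HHomotopic f g := by
  subst hc hd
  -- The straight-line homotopy; it exists because orderedness of configurations is a convex
  -- condition.
  refine ⟨⟨⟨⟨fun x => IntervalComponent.linear (f x.2) (g x.2) x.1, continuous_combination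
    (f.continuous.comp continuous_snd) (g.continuous.comp continuous_snd) continuous_fst⟩,
    fun t => (IntervalComponent.linear (f t) (g t)).source,
    fun t => (IntervalComponent.linear (f t) (g t)).target⟩, ?_⟩⟩
  intro s t ht
  change IntervalComponent.linear (f t) (g t) s = f t
  have : f t = g t := by
    rcases ht with rfl | rfl <;> simp
  rw [← this, linear_self]

end IntervalComponent

/-! ## Pointwise composition of paths -/

namespace OperadStr

variable {C : ℕ → Type u} (O : OperadStr C)

/-- The types of the arguments depend on the permutation, so it cannot be rewritten in place; it has
to be replaced everywhere at once. -/
theorem γ_perm_congr {k n : ℕ} (m : Fin k → ℕ) {s s' : Equiv.Perm (Fin k)} (hs : s = s')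
    (h : ∑ i, m (s.symm i) = n) (h' : ∑ i, m (s'.symm i) = n) (a : C k) (b : ∀ i, C (m i)) :
    O.γ (fun i => m (s.symm i)) h a (fun i => b (s.symm i)) =
      O.γ (fun i => m (s'.symm i)) h' a (fun i => b (s'.symm i)) := by
  subst hs
  rfl

end OperadStr

namespace TopOperadStr

variable {D : ℕ → Type u} [∀ n, TopologicalSpace (D n)] (O : TopOperadStr D)

/-- The pointwise composition `γ (f; g 0, …, g (k-1))` of continuous maps. -/
def mapγ {k n : ℕ} (m : Fin k → ℕ) (h : ∑ i, m i = n) {A : Type v} [TopologicalSpace A]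
    (f : C(A, D k)) (g : ∀ i, C(A, D (m i))) : C(A, D n) :=
  ⟨fun t => O.γ m h (f t) (fun i => g i t), (O.continuous_γ m h).comp
    (f.continuous.prodMk (continuous_pi fun i => (g i).continuous))⟩

theorem mapγ_assoc {k M N : ℕ} (m : Fin k → ℕ) (hm : ∑ i, m i = M) (p : Fin M → ℕ)
    (hp : ∑ x, p x = N) (q : Fin k → ℕ) (hq : ∀ i, ∑ j, p (blockIndex m hm ⟨i, j⟩) = q i)
    (hN : ∑ i, q i = N) {A : Type v} [TopologicalSpace A] (f : C(A, D k))
    (g : ∀ i, C(A, D (m i))) (c : ∀ l, C(A, D (p l))) :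
    O.mapγ p hp (O.mapγ m hm f g) c =
      O.mapγ q hN f (fun i => O.mapγ (fun j => p (blockIndex m hm ⟨i, j⟩)) (hq i) (g i)
        (fun j => c (blockIndex m hm ⟨i, j⟩))) :=
  ContinuousMap.ext fun t => O.assoc m hm p hp q hq hN (f t) (fun i => g i t) (fun l => c l t)

/-- Homotopies can be composed pointwise. The domain and the fixed set are arbitrary in order to
cover both paths relative to their end points and cubes relative to their boundary. -/
theorem mapγ_homotopicRel {k n : ℕ} (m : Fin k → ℕ) (h : ∑ i, m i = n) {A : Type v}
    [TopologicalSpace A] {S : Set A} {f f₁ : C(A, D k)} {g g₁ : ∀ i, C(A, D (m i))}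
    (hf : f.HomotopicRel f₁ S) (hg : ∀ i, (g i).HomotopicRel (g₁ i) S) :
    (O.mapγ m h f g).HomotopicRel (O.mapγ m h f₁ g₁) S := by
  obtain ⟨F⟩ := hf
  let G := fun i => Classical.choice (hg i)
  refine ⟨⟨⟨O.mapγ m h F.toContinuousMap (fun i => (G i).toContinuousMap), ?_, ?_⟩, ?_⟩⟩
  · intro t
    change O.γ m h (F (0, t)) (fun i => G i (0, t)) = O.γ m h (f t) (fun i => g i t)
    rw [F.apply_zero, funext fun i => (G i).apply_zero t]
  · intro t
    change O.γ m h (F (1, t)) (fun i => G i (1, t)) = O.γ m h (f₁ t) (fun i => g₁ i t)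
    rw [F.apply_one, funext fun i => (G i).apply_one t]
  · intro s t ht
    change O.γ m h (F (s, t)) (fun i => G i (s, t)) = O.γ m h (f t) (fun i => g i t)
    rw [F.eq_fst s ht, funext fun i => (G i).eq_fst s ht]

theorem pathγ_congr {k n : ℕ} (m : Fin k → ℕ) (h : ∑ i, m i = n) {x y x₁ y₁ : D k}
    {x' y' x₁' y₁' : ∀ i, D (m i)} {f : Path x y} {g : ∀ i, Path (x' i) (y' i)}
    {f₁ : Path x₁ y₁} {g₁ : ∀ i, Path (x₁' i) (y₁' i)} (hf : f.HHomotopic f₁)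
    (hg : ∀ i, (g i).HHomotopic (g₁ i)) :
    (O.pathγ m h f g).HHomotopic (O.pathγ m h f₁ g₁) :=
  O.mapγ_homotopicRel m h hf hg

/-- All concatenations switch at the same time `1/2`, so this interchange is an equality and needs
no homotopy. -/
theorem pathγ_trans {k n : ℕ} (m : Fin k → ℕ) (h : ∑ i, m i = n) {x y z : D k}
    {x' y' z' : ∀ i, D (m i)} (f : Path x y) (f₁ : Path y z) (g : ∀ i, Path (x' i) (y' i))
    (g₁ : ∀ i, Path (y' i) (z' i)) :
    O.pathγ m h (f.trans f₁) (fun i => (g i).trans (g₁ i)) =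
      (O.pathγ m h f g).trans (O.pathγ m h f₁ g₁) := by
  ext t
  change O.γ m h (f.trans f₁ t) (fun i => (g i).trans (g₁ i) t) = _
  simp only [Path.trans_apply]
  split_ifs <;> rfl

theorem pathγ_assoc {k M N : ℕ} (m : Fin k → ℕ) (hm : ∑ i, m i = M) (p : Fin M → ℕ)
    (hp : ∑ x, p x = N) (q : Fin k → ℕ) (hq : ∀ i, ∑ j, p (blockIndex m hm ⟨i, j⟩) = q i)
    (hN : ∑ i, q i = N) {x y : D k} {x' y' : ∀ i, D (m i)} {x'' y'' : ∀ l, D (p l)}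
    (f : Path x y) (g : ∀ i, Path (x' i) (y' i)) (k : ∀ l, Path (x'' l) (y'' l)) :
    (O.pathγ p hp (O.pathγ m hm f g) k).HHomotopic
      (O.pathγ q hN f (fun i => O.pathγ (fun j => p (blockIndex m hm ⟨i, j⟩)) (hq i) (g i)
        (fun j => k (blockIndex m hm ⟨i, j⟩)))) :=
  .of_eq fun t => O.assoc m hm p hp q hq hN (f t) (fun i => g i t) (fun l => k l t)

theorem pathγ_smul {K : ℕ → Type v} [∀ n, Group (K n)] {P : GroupOperad K}
    [∀ n, MulAction (K n) (D n)] [∀ n, ContinuousConstSMul (K n) (D n)]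
    (hact : IsOperadAction P O.toOperadStr) {k n : ℕ} (m : Fin k → ℕ) (h : ∑ i, m i = n)
    (σ : K k) (τ : ∀ i, K (m i)) {x y : D k} {x' y' : ∀ i, D (m i)}
    (f : Path x y) (g : ∀ i, Path (x' i) (y' i)) :
    (O.pathγ m h (f.map (continuous_const_smul σ))
      (fun i => (g i).map (continuous_const_smul (τ i)))).HHomotopic
      ((O.pathγ (fun i => m ((P.perm σ).symm i)) (P.sum_perm h σ) f
        (fun i => g ((P.perm σ).symm i))).map (continuous_const_smul (P.γ m h σ τ))) :=
  .of_eq fun t => hact m h σ τ (f t) (fun i => g i t)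

end TopOperadStr

/-! ## Images of paths of little intervals -/

namespace GoodBasepoint

variable {D : ℕ → Type u} [∀ n, TopologicalSpace (D n)] {O : TopOperadStr D} (η : GoodBasepoint O)

/-- A path is standard, from `c` to `d`, if it is homotopic to the image of the linear path from
`c` to `d`. -/
def Standard {n : ℕ} (c d : IntervalComponent n) {x y : D n} (f : Path x y) : Prop :=
  f.HHomotopic ((IntervalComponent.linear c d).map (η.toMap n).continuous)

namespace Standard

variable {η} {n : ℕ} {c d e c' d' : IntervalComponent n} {x y z x' y' : D n}

theorem of_path (w : Path c d) : η.Standard c d (w.map (η.toMap n).continuous) :=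
  (IntervalComponent.hhomotopic rfl rfl _ _).map _

theorem congr {f : Path x y} {g : Path x' y'} (hf : η.Standard c d f) (h : g.HHomotopic f) :
    η.Standard c d g :=
  h.trans hf

/-- The coherence principle: to compare standard paths it suffices to compare configurations, where
the operad axioms of little intervals apply. -/
theorem unique {f : Path x y} {g : Path x' y'} (hf : η.Standard c d f)
    (hg : η.Standard c' d' g) (hc : c = c') (hd : d = d') : f.HHomotopic g := by
  subst hc hd
  exact Path.HHomotopic.trans hf (Path.HHomotopic.symm hg)

theorem trans {f : Path x y} {g : Path y z} (hf : η.Standard c d f)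
    (hg : η.Standard d e g) : η.Standard c e (f.trans g) :=
  congr (of_path ((IntervalComponent.linear c d).trans (IntervalComponent.linear d e)))
    ((Path.HHomotopic.hcomp hf hg).trans (Path.map_trans_map _ _ _).symm)

theorem refl (c : IntervalComponent n) : η.Standard c c (Path.refl (η.toMap n c)) :=
  congr (of_path (Path.refl c)) (.of_eq fun _ => rfl)

theorem hhomotopic_refl {f : Path x y} (hf : η.Standard c d f) (h : c = d) :
    f.HHomotopic (Path.refl x) := by
  subst h
  have hx := Path.HHomotopic.source_eq hf
  subst hx
  exact hf.unique (refl c) rfl rfl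

theorem linear {k n : ℕ} (m : Fin k → ℕ) (h : ∑ i, m i = n) :
    η.Standard (IntervalComponent.std n) (IntervalComponent.operad.γ m h (IntervalComponent.std k)
      (fun i => IntervalComponent.std (m i))) (η.linear m h) :=
  .of_eq fun _ => rfl

/-- As `η` commutes with `γ`, the composite is homotopic to the image of a path of configurations.
That path need not be linear, but by convexity it is homotopic to the linear one. -/
theorem pathγ {k n : ℕ} (m : Fin k → ℕ) (h : ∑ i, m i = n) {c d : IntervalComponent k}
    {c' d' : ∀ i, IntervalComponent (m i)} {x y : D k} {x' y' : ∀ i, D (m i)} {f : Path x y}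
    {g : ∀ i, Path (x' i) (y' i)} (hf : η.Standard c d f)
    (hg : ∀ i, η.Standard (c' i) (d' i) (g i)) :
    η.Standard (IntervalComponent.operad.γ m h c c') (IntervalComponent.operad.γ m h d d')
      (O.pathγ m h f g) :=
  congr (of_path (IntervalComponent.operad.pathγ m h (IntervalComponent.linear c d)
    fun i => IntervalComponent.linear (c' i) (d' i)))
    ((O.pathγ_congr m h hf hg).trans (.of_eq fun _ => (η.map_γ m h _ _).symm))

end Standard

end GoodBasepoint

/-! ## Composition of paths with propositionally equal end points -/

namespace Path

variable {X : Type u} [TopologicalSpace X] {Y : Type v} [TopologicalSpace Y]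

/-- The composite of two paths, the first of which ends at the beginning of the second one. -/
noncomputable def htrans {x y y' z : X} (f : Path x y) (g : Path y' z) (h : y = y') : Path x z :=
  f.trans (g.cast h rfl)

variable {x y y' z z' w w' v v' x₁ y₁ y₁' z₁ : X}

namespace HHomotopic

theorem hhcomp {f : Path x y} {g : Path y' z} {f₁ : Path x₁ y₁} {g₁ : Path y₁' z₁}
    (hf : HHomotopic f f₁) (hg : HHomotopic g g₁) (h : y = y') (h₁ : y₁ = y₁') :
    HHomotopic (f.htrans g h) (f₁.htrans g₁ h₁) := by
  subst h h₁
  exact hcomp hf hg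

theorem hassoc (f : Path x y) (g : Path y' z) (k : Path z' w) (h : y = y') (h' : z = z') :
    HHomotopic ((f.htrans g h).htrans k h') (f.htrans (g.htrans k h') h) := by
  subst h h'
  exact assoc f g k

theorem refl_htrans (f : Path x y) (h : x₁ = x) : HHomotopic ((Path.refl x₁).htrans f h) f := by
  subst h
  exact refl_trans f

theorem htrans_refl (f : Path x y) (h : y = y₁) : HHomotopic (f.htrans (Path.refl y₁) h) f := by
  subst h
  exact trans_refl f

theorem symm_htrans_self (f : Path x y) : HHomotopic (f.symm.htrans f rfl) (Path.refl y) :=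
  symm_trans_self f

/-- Gives a path the same division into three pieces as a value of `liftγ`, so that a pointwise
composition of both can be split piece by piece. -/
theorem pad (f : Path x y) :
    HHomotopic f (((Path.refl x).htrans f rfl).htrans (Path.refl y) rfl) :=
  ((htrans_refl _ rfl).trans (refl_htrans _ rfl)).symm

/-- Collects the corrections `δ`, `S` before and `T`, `E` after the essential part `A`, for the
comparison of iterated composites. -/
theorem regroup (δ : Path x y) (S : Path y' z) (A : Path z' w) (T : Path w' v) (E : Path v' x₁)
    (h₁ : y = y') (h₂ : z = z') (h₃ : w = w') (h₄ : v = v') :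
    HHomotopic ((δ.htrans ((S.htrans A h₂).htrans T h₃) h₁).htrans E h₄)
      (((δ.htrans S h₁).htrans A h₂).htrans (T.htrans E h₄) h₃) :=
  ((hhcomp (((hassoc _ _ _ _ _).symm.trans (hhcomp (hassoc _ _ _ _ _).symm (refl _) h₃ h₃)))
    (refl _) h₄ h₄)).trans (hassoc _ _ _ _ _)

/-- Cancels the adjacent `c⁻¹` and `c` where two corrected paths meet. -/
theorem cancel {z'' : X} (a : Path x y) (b : Path y' z) (c : Path x₁ z') (d : Path z'' w)
    (e : Path w' v) (h₁ : y = y') (h₂ : z = z') (h₃ : z' = z'') (h₄ : w = w') :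
    HHomotopic (((a.htrans b h₁).htrans c.symm h₂).htrans ((c.htrans d h₃).htrans e h₄) rfl)
      ((a.htrans (b.htrans d (h₂.trans h₃)) h₁).htrans e h₄) :=
  (hhcomp (refl _) (hassoc _ _ _ _ _) rfl rfl).trans <|
  (hassoc _ _ _ _ _).symm.trans <|
  (hhcomp ((hassoc _ _ _ _ _).trans ((hhcomp (refl _) (symm_htrans_self c) h₂ h₂).trans
    (htrans_refl _ _))) (refl _) h₃ (h₂.trans h₃)).trans <|
  (hassoc _ _ _ _ _).symm.trans <| hhcomp (hassoc _ _ _ _ _) (refl _) h₄ h₄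

theorem map_smul_congr {K : Type w} [Group K] [MulAction K X] [ContinuousConstSMul K X]
    {σ τ : K} (hσ : σ = τ) {f : Path x y} {g : Path x₁ y₁} (h : HHomotopic f g) :
    HHomotopic (f.map (continuous_const_smul σ)) (g.map (continuous_const_smul τ)) := by
  subst hσ
  exact h.map _

end HHomotopic

theorem map_htrans (f : Path x y) (g : Path y' z) (h : y = y') {φ : X → Y} (hφ : Continuous φ)
    (h' : φ y = φ y') :
    HHomotopic ((f.htrans g h).map hφ) ((f.map hφ).htrans (g.map hφ) h') := by
  subst h
  exact map_trans_map f g hφ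

end Path

namespace TopOperadStr

variable {D : ℕ → Type u} [∀ n, TopologicalSpace (D n)] (O : TopOperadStr D)

theorem pathγ_htrans {k n : ℕ} (m : Fin k → ℕ) (h : ∑ i, m i = n) {x y z w : D k}
    {x' y' z' w' : ∀ i, D (m i)} (f : Path x y) (f₁ : Path z w) (g : ∀ i, Path (x' i) (y' i))
    (g₁ : ∀ i, Path (z' i) (w' i)) (hf : y = z) (hg : ∀ i, y' i = z' i)
    (hγ : O.γ m h y y' = O.γ m h z z') :
    (O.pathγ m h (f.htrans f₁ hf) (fun i => (g i).htrans (g₁ i) (hg i))).HHomotopic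
      ((O.pathγ m h f g).htrans (O.pathγ m h f₁ g₁) hγ) := by
  obtain rfl : y' = z' := funext hg
  subst hf
  exact .of_eq fun t => congrArg (fun p => p t) (O.pathγ_trans m h f f₁ g g₁)

end TopOperadStr

/-! ## Composition of paths which lift loops -/

namespace GroupOperad

variable {K : ℕ → Type v} [∀ n, Group (K n)] (P : GroupOperad K)

theorem perm_one {n : ℕ} : P.perm (1 : K n) = 1 := by
  rw [perm, map_one]
  rfl

/-- The order is reversed because `π` takes values in the opposite of `Equiv.Perm (Fin n)`. -/
theorem perm_mul {n : ℕ} (a b : K n) : P.perm (a * b) = P.perm b * P.perm a := by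
  rw [perm, map_mul]
  rfl

theorem perm_γ {k n : ℕ} (m : Fin k → ℕ) (h : ∑ i, m i = n) (a : K k) (b : ∀ i, K (m i)) :
    P.perm (P.γ m h a b) = blockPerm m h (P.perm a) (fun i => P.perm (b i)) :=
  congrArg MulOpposite.unop (P.π_γ m h a b)

/-- By the crossed law for identities this element is equal to its own square. -/
theorem γ_one_one {k n : ℕ} (m : Fin k → ℕ) (h : ∑ i, m i = n) :
    P.γ m h 1 (fun _ => 1) = 1 := by
  have h1 := P.crossed m h 1 1 (fun _ => 1) (fun _ => 1) (P.sum_perm h 1)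
  have h2 : P.γ (fun i => m ((P.perm 1).symm i)) (P.sum_perm h 1) 1 (fun i => (1 : K (m _))) =
      P.γ m h 1 (fun _ => 1) :=
    P.γ_perm_congr m P.perm_one (P.sum_perm h 1) h 1 (fun _ => 1)
  simp only [mul_one] at h1
  exact left_eq_mul.1 (h1.trans (congrArg (P.γ m h 1 (fun _ => 1) * ·) h2))

end GroupOperad

namespace GoodBasepoint

variable {D : ℕ → Type u} [∀ n, TopologicalSpace (D n)] {O : TopOperadStr D} (η : GoodBasepoint O)

open Path

theorem one_pt : O.one = η.pt 1 := η.map_one.symm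

theorem linear_index_congr {k n : ℕ} {m m' : Fin k → ℕ} (hm : m = m') (h : ∑ i, m i = n)
    (h' : ∑ i, m' i = n) : (η.linear m h).HHomotopic (η.linear m' h') := by
  subst hm
  exact .refl _

variable {K : ℕ → Type v} [∀ n, Group (K n)] {P : GroupOperad K} [∀ n, MulAction (K n) (D n)]
  [∀ n, ContinuousConstSMul (K n) (D n)] (hact : IsOperadAction P O.toOperadStr)

/-- The lift of the product of two loops which lift to `f` and `g`. -/
noncomputable def liftMul {n : ℕ} {σ τ : K n} (f : Path (η.pt n) (σ • η.pt n))
    (g : Path (η.pt n) (τ • η.pt n)) : Path (η.pt n) ((σ * τ) • η.pt n) :=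
  (f.trans (g.map (continuous_const_smul σ))).cast rfl (mul_smul σ τ _)

theorem liftMul_hhomotopic {n : ℕ} {σ τ : K n} (f : Path (η.pt n) (σ • η.pt n))
    (g : Path (η.pt n) (τ • η.pt n)) :
    (η.liftMul f g).HHomotopic (f.htrans (g.map (continuous_const_smul σ)) rfl) :=
  .of_eq fun _ => rfl

theorem liftγ_hhomotopic {k n : ℕ} (m : Fin k → ℕ) (h : ∑ i, m i = n) (σ : K k)
    (τ : ∀ i, K (m i)) (f : Path (η.pt k) (σ • η.pt k))
    (g : ∀ i, Path (η.pt (m i)) (τ i • η.pt (m i))) :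
    (η.liftγ hact m h σ τ f g).HHomotopic
      (((η.linear m h).htrans (O.pathγ m h f g) rfl).htrans
        ((η.linear (fun i => m ((P.perm σ).symm i)) (P.sum_perm h σ)).symm.map
          (continuous_const_smul (P.γ m h σ τ)))
        (hact m h σ τ (η.pt k) (fun i => η.pt (m i)))) :=
  .of_eq fun _ => rfl

theorem liftγ_congr {k n : ℕ} (m : Fin k → ℕ) (h : ∑ i, m i = n) {σ : K k}
    {τ : ∀ i, K (m i)} {f f' : Path (η.pt k) (σ • η.pt k)}
    {g g' : ∀ i, Path (η.pt (m i)) (τ i • η.pt (m i))} (hf : f.HHomotopic f')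
    (hg : ∀ i, (g i).HHomotopic (g' i)) :
    (η.liftγ hact m h σ τ f g).HHomotopic (η.liftγ hact m h σ τ f' g') :=
  (η.liftγ_hhomotopic hact m h σ τ f g).trans <|
    (HHomotopic.hhcomp (HHomotopic.hhcomp (.refl _) (O.pathγ_congr m h hf hg) rfl rfl) (.refl _)
      (hact m h σ τ (η.pt k) (fun i => η.pt (m i))) (hact m h σ τ (η.pt k) (fun i => η.pt (m i)))).trans
    (η.liftγ_hhomotopic hact m h σ τ f' g').symm

/-- The crossed law for lifts. Write `ρ = γ (σ; τ)` and let `δ₂` be the linear path for the permuted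
arities `m₂`. The first factor ends with `ρ • δ₂⁻¹` and the translate of the second one begins with
`ρ • δ₂`. After cancellation, the pointwise composition of the concatenated lifts remains between
the outer corrections. -/
theorem liftγ_mul {k n : ℕ} (m : Fin k → ℕ) (h : ∑ i, m i = n) {σ σ' : K k}
    {τ τ' : ∀ i, K (m i)} (f : Path (η.pt k) (σ • η.pt k)) (f' : Path (η.pt k) (σ' • η.pt k))
    (g : ∀ i, Path (η.pt (m i)) (τ i • η.pt (m i)))
    (g' : ∀ i, Path (η.pt (m i)) (τ' i • η.pt (m i))) :
    (η.liftγ hact m h (σ * σ') (fun i => τ i * τ' i) (η.liftMul f f')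
      (fun i => η.liftMul (g i) (g' i))).HHomotopic
      (η.liftMul (η.liftγ hact m h σ τ f g)
        (η.liftγ hact (fun i => m ((P.perm σ).symm i)) (P.sum_perm h σ) σ'
          (fun i => τ' ((P.perm σ).symm i)) f' (fun i => g' ((P.perm σ).symm i)))) := by
  set m₂ : Fin k → ℕ := fun i => m ((P.perm σ).symm i) with hm₂
  have h₂ : ∑ i, m₂ i = n := P.sum_perm h σ
  set ρ := P.γ m h σ τ with hρ
  set ρ' := P.γ m₂ h₂ σ' (fun i => τ' ((P.perm σ).symm i)) with hρ'
  have hcr : P.γ m h (σ * σ') (fun i => τ i * τ' i) = ρ * ρ' :=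
    P.crossed m h σ σ' τ τ' h₂
  have hm₃ : (fun i => m ((P.perm (σ * σ')).symm i)) = fun i => m₂ ((P.perm σ').symm i) := by
    funext i
    rw [P.perm_mul]
    rfl
  have hA := hact m h σ τ (η.pt k) (fun i => η.pt (m i))
  have hA' := hact m₂ h₂ σ' (fun i => τ' ((P.perm σ).symm i)) (η.pt k) (fun i => η.pt (m₂ i))
  -- The second halves of the lifts are translates by `σ` and `τ i`; by equivariance their composite
  -- is a translate by `ρ` with permuted arguments.
  have hmid : (O.pathγ m h (η.liftMul f f') (fun i => η.liftMul (g i) (g' i))).HHomotopic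
      ((O.pathγ m h f g).htrans ((O.pathγ m₂ h₂ f' (fun i => g' ((P.perm σ).symm i))).map
        (continuous_const_smul ρ)) hA) :=
    (O.pathγ_congr m h (η.liftMul_hhomotopic f f')
      (fun i => η.liftMul_hhomotopic (g i) (g' i))).trans <|
    (O.pathγ_htrans m h _ _ _ _ rfl (fun _ => rfl) rfl).trans <|
    HHomotopic.hhcomp (.refl _) (O.pathγ_smul hact m h σ τ f' g') rfl hA
  -- Permuting the arities by `σ` and then by `σ'` is permuting them by `σ * σ'`, so the final
  -- corrections agree.
  have hend : ((η.linear (fun i => m ((P.perm (σ * σ')).symm i)) (P.sum_perm h _)).symm.map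
      (continuous_const_smul (P.γ m h (σ * σ') (fun i => τ i * τ' i)))).HHomotopic
      (((η.linear (fun i => m₂ ((P.perm σ').symm i)) (P.sum_perm h₂ σ')).symm.map
        (continuous_const_smul ρ')).map (continuous_const_smul ρ)) :=
    (HHomotopic.map_smul_congr hcr (η.linear_index_congr hm₃ _ (P.sum_perm h₂ σ')).symm₂).trans
      (.of_eq fun t => mul_smul ρ ρ' _)
  have hR := hmid.target_eq.trans (congrArg (ρ • ·) hA')
  refine ((η.liftγ_hhomotopic hact m h _ _ _ _).trans
    (HHomotopic.hhcomp (HHomotopic.hhcomp (.refl _) hmid rfl rfl) hend _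
      (congrArg (ρ • ·) hA'))).trans ?_
  refine HHomotopic.trans ?_ (η.liftMul_hhomotopic _ _).symm
  refine HHomotopic.trans ?_ (HHomotopic.hhcomp (η.liftγ_hhomotopic hact m h σ τ f g)
    ((HHomotopic.map (η.liftγ_hhomotopic hact m₂ h₂ σ' _ f' _) _)) rfl rfl).symm
  refine HHomotopic.trans ?_ (HHomotopic.hhcomp (.refl _) ((HHomotopic.hhcomp
    (Path.map_htrans _ _ _ _ rfl) (.refl _) (congrArg (ρ • ·) hA')
    (congrArg (ρ • ·) hA')).symm.trans
    (Path.map_htrans _ _ hA' _ (congrArg (ρ • ·) hA')).symm) rfl rfl)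
  exact (HHomotopic.cancel (η.linear m h) (O.pathγ m h f g)
    ((η.linear m₂ h₂).map (continuous_const_smul ρ)) _ _ rfl hA rfl (congrArg (ρ • ·) hA')).symm

end GoodBasepoint

/-! ### Unit laws and associativity for the composition of lifts -/

theorem Path.htrans_symm_map {X : Type u} [TopologicalSpace X] {Y : Type v} [TopologicalSpace Y]
    {x y y' z : X} (f : Path x y) (g : Path y' z) (h : y = y') {φ : X → Y} (hφ : Continuous φ)
    (h' : φ y' = φ y) : Path.HHomotopic ((g.symm.map hφ).htrans (f.symm.map hφ) h')
      ((f.htrans g h).symm.map hφ) := by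
  subst h
  refine .of_eq fun t => ?_
  rw [Path.htrans, Path.htrans, Path.trans_symm, Path.map_trans]
  rfl

namespace GoodBasepoint

variable {D : ℕ → Type u} [∀ n, TopologicalSpace (D n)] {O : TopOperadStr D} (η : GoodBasepoint O)

open Path

/-- Here the correction is a standard path from a configuration to itself, hence null-homotopic. The
hypothesis is satisfied in the two unit laws. -/
theorem linear_hhomotopic_refl {k n : ℕ} (m : Fin k → ℕ) (h : ∑ i, m i = n)
    (hs : IntervalComponent.operad.γ m h (IntervalComponent.std k)
      (fun i => IntervalComponent.std (m i)) = IntervalComponent.std n) :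
    (η.linear m h).HHomotopic (Path.refl (η.pt n)) :=
  (Standard.linear m h).hhomotopic_refl hs.symm

theorem linear_one_left {n : ℕ} (h : ∑ _i : Fin 1, n = n) :
    (η.linear (fun _ : Fin 1 => n) h).HHomotopic (Path.refl (η.pt n)) :=
  η.linear_hhomotopic_refl _ h (IntervalComponent.operad.one_γ h _)

theorem linear_one_right {n : ℕ} (h : ∑ _i : Fin n, 1 = n) :
    (η.linear (fun _ : Fin n => 1) h).HHomotopic (Path.refl (η.pt n)) :=
  η.linear_hhomotopic_refl _ h (IntervalComponent.operad.γ_one h _)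

/-- The standard path from `e N` to `γ (γ (e k; e (m 0), …); e (p 0), …)` is the same for both ways
of composing. -/
theorem linear_assoc {k M N : ℕ} (m : Fin k → ℕ) (hm : ∑ i, m i = M) (p : Fin M → ℕ)
    (hp : ∑ x, p x = N) (q : Fin k → ℕ) (p' : ∀ i, Fin (m i) → ℕ)
    (hp' : ∀ i j, p (blockIndex m hm ⟨i, j⟩) = p' i j) (hq : ∀ i, ∑ j, p' i j = q i)
    (hN : ∑ i, q i = N) (h₁ : O.γ p hp (η.pt M) (fun l => η.pt (p l)) =
      O.γ p hp (η.pt M) (fun l => η.pt (p l)))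
    (h₂ : O.γ q hN (η.pt k) (fun i => η.pt (q i)) = O.γ q hN (η.pt k) (fun i => η.pt (q i))) :
    ((η.linear p hp).htrans (O.pathγ p hp (η.linear m hm) (fun l => Path.refl (η.pt (p l))))
      h₁).HHomotopic
      ((η.linear q hN).htrans (O.pathγ q hN (Path.refl (η.pt k)) (fun i => η.linear (p' i) (hq i)))
        h₂) := by
  -- The sizes `p'` are a separate argument because after a permutation of the blocks they are only
  -- propositionally the sizes read off from `p`.
  obtain rfl : (fun i j => p (blockIndex m hm ⟨i, j⟩)) = p' :=
    funext fun i => funext fun j => hp' i j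
  -- Both sides are standard and begin at the standard configuration; associativity in the operad of
  -- intervals identifies their final configurations.
  exact ((Standard.linear p hp).trans
    (.pathγ p hp (.linear m hm) (fun l => .refl (IntervalComponent.std (p l))))).unique
    ((Standard.linear q hN).trans
      (.pathγ q hN (.refl (IntervalComponent.std k)) (fun i => .linear _ (hq i)))) rfl
    (IntervalComponent.operad.assoc m hm p hp q hq hN _ _ _)

variable {K : ℕ → Type v} [∀ n, Group (K n)] {P : GroupOperad K} [∀ n, MulAction (K n) (D n)]
  [∀ n, ContinuousConstSMul (K n) (D n)] (hact : IsOperadAction P O.toOperadStr)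

theorem liftγ_of_linear {k n : ℕ} (m : Fin k → ℕ) (h : ∑ i, m i = n) (σ : K k)
    (τ : ∀ i, K (m i)) (f : Path (η.pt k) (σ • η.pt k))
    (g : ∀ i, Path (η.pt (m i)) (τ i • η.pt (m i)))
    (h₁ : (η.linear m h).HHomotopic (Path.refl (η.pt n)))
    (h₂ : (η.linear (fun i => m ((P.perm σ).symm i)) (P.sum_perm h σ)).HHomotopic
      (Path.refl (η.pt n))) :
    (η.liftγ hact m h σ τ f g).HHomotopic (O.pathγ m h f g) := by
  have e : O.γ m h (σ • η.pt k) (fun i => τ i • η.pt (m i)) = P.γ m h σ τ • η.pt n :=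
    (hact m h σ τ (η.pt k) (fun i => η.pt (m i))).trans (congrArg _ h₂.target_eq)
  exact (η.liftγ_hhomotopic hact m h σ τ f g).trans <|
    (HHomotopic.hhcomp (HHomotopic.hhcomp h₁ (.refl _) rfl h₁.target_eq.symm)
      ((HHomotopic.map h₂.symm₂ _).trans (.of_eq fun _ => rfl :
        Path.HHomotopic _ (Path.refl (P.γ m h σ τ • η.pt n)))) _ e).trans <|
    (HHomotopic.htrans_refl _ _).trans (HHomotopic.refl_htrans _ _)

theorem liftγ_one_left {n : ℕ} (h : ∑ _i : Fin 1, n = n) {σ : K 1} {τ : K n}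
    {f : Path (η.pt 1) (σ • η.pt 1)} (g : Path (η.pt n) (τ • η.pt n))
    (hf : f.HHomotopic (Path.refl (η.pt 1))) :
    (η.liftγ hact (fun _ : Fin 1 => n) h σ (fun _ => τ) f (fun _ => g)).HHomotopic g := by
  refine (η.liftγ_of_linear hact _ h _ _ _ _ (η.linear_one_left h) (η.linear_one_left _)).trans <|
    (O.pathγ_congr _ h hf (fun _ => .refl g)).trans (.of_eq fun t => ?_)
  exact (congrArg (fun e => O.γ (fun _ : Fin 1 => n) h e (fun _ => g t)) η.one_pt.symm).trans
    (O.one_γ h _)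

theorem liftγ_one_right {n : ℕ} (h : ∑ _i : Fin n, 1 = n) {σ : K n} {τ : Fin n → K 1}
    (f : Path (η.pt n) (σ • η.pt n)) {g : ∀ i, Path (η.pt 1) (τ i • η.pt 1)}
    (hg : ∀ i, (g i).HHomotopic (Path.refl (η.pt 1))) :
    (η.liftγ hact (fun _ : Fin n => 1) h σ τ f g).HHomotopic f := by
  refine (η.liftγ_of_linear hact _ h _ _ _ _ (η.linear_one_right h)
    (η.linear_one_right _)).trans <|
    (O.pathγ_congr _ h (.refl f) hg).trans (.of_eq fun t => ?_)
  exact (congrArg (fun e => O.γ (fun _ : Fin n => 1) h (f t) (fun _ => e)) η.one_pt.symm).trans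
    (O.γ_one h _)

/-- Each side is brought to the form: standard path, pointwise triple composition, translate of an
inverse standard path. The middle parts agree by associativity of `O`, the outer ones by
`linear_assoc`, applied to the given arities and to the permuted ones. -/
theorem liftγ_assoc {k M N : ℕ} (m : Fin k → ℕ) (hm : ∑ i, m i = M) (p : Fin M → ℕ)
    (hp : ∑ x, p x = N) (q : Fin k → ℕ) (hq : ∀ i, ∑ j, p (blockIndex m hm ⟨i, j⟩) = q i)
    (hN : ∑ i, q i = N) (σ : K k) (τ : ∀ i, K (m i)) (υ : ∀ l, K (p l))
    (f : Path (η.pt k) (σ • η.pt k)) (g : ∀ i, Path (η.pt (m i)) (τ i • η.pt (m i)))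
    (c : ∀ l, Path (η.pt (p l)) (υ l • η.pt (p l))) :
    (η.liftγ hact p hp (P.γ m hm σ τ) υ (η.liftγ hact m hm σ τ f g) c).HHomotopic
      (η.liftγ hact q hN σ (fun i => P.γ (fun j => p (blockIndex m hm ⟨i, j⟩)) (hq i) (τ i)
        (fun j => υ (blockIndex m hm ⟨i, j⟩))) f (fun i =>
          η.liftγ hact (fun j => p (blockIndex m hm ⟨i, j⟩)) (hq i) (τ i)
            (fun j => υ (blockIndex m hm ⟨i, j⟩)) (g i) (fun j => c (blockIndex m hm ⟨i, j⟩)))) := by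
  set ρ := P.γ m hm σ τ with hρ
  set ω := P.γ p hp ρ υ with hω
  set θ : ∀ i, K (q i) := fun i => P.γ (fun j => p (blockIndex m hm ⟨i, j⟩)) (hq i) (τ i)
    (fun j => υ (blockIndex m hm ⟨i, j⟩)) with hθ
  have hωω : ω = P.γ q hN σ θ := P.assoc m hm p hp q hq hN σ τ υ
  have a₁ := hact m hm σ τ (η.pt k) (fun i => η.pt (m i))
  have a₂ := hact p hp ρ υ (η.pt M) (fun l => η.pt (p l))
  have a₃ := hact q hN σ θ (η.pt k) (fun i => η.pt (q i))
  have a₄ := fun i => hact (fun j => p (blockIndex m hm ⟨i, j⟩)) (hq i) (τ i)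
    (fun j => υ (blockIndex m hm ⟨i, j⟩)) (η.pt (m i)) (fun j => η.pt (p (blockIndex m hm ⟨i, j⟩)))
  -- the left hand side
  set δ₂ := η.linear (fun i => m ((P.perm σ).symm i)) (P.sum_perm hm σ) with hδ₂
  have l₁ : (O.pathγ p hp (η.liftγ hact m hm σ τ f g) c).HHomotopic
      (((O.pathγ p hp (η.linear m hm) (fun l => Path.refl (η.pt (p l)))).htrans
        (O.pathγ p hp (O.pathγ m hm f g) c) rfl).htrans
        (O.pathγ p hp (δ₂.symm.map (continuous_const_smul ρ)) (fun l => Path.refl (υ l • η.pt (p l))))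
          (congrArg (fun x => O.γ p hp x _) a₁)) :=
    (O.pathγ_congr p hp (η.liftγ_hhomotopic hact m hm σ τ f g)
      (fun l => HHomotopic.pad (c l))).trans <|
    (O.pathγ_htrans p hp _ _ _ _ a₁ (fun _ => rfl) (congrArg (fun x => O.γ p hp x _) a₁)).trans <|
    HHomotopic.hhcomp (O.pathγ_htrans p hp _ _ _ _ rfl (fun _ => rfl) rfl) (.refl _) _ _
  -- The inner final correction is already a translate by `ρ`; composed with constant paths at `υ l
  -- • e (p l)`, it becomes a translate by `ω`.
  have l₂ : (O.pathγ p hp (δ₂.symm.map (continuous_const_smul ρ))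
      (fun l => Path.refl (υ l • η.pt (p l)))).HHomotopic
      ((O.pathγ (fun l => p ((P.perm ρ).symm l)) (P.sum_perm hp ρ) δ₂
        (fun l => Path.refl (η.pt (p ((P.perm ρ).symm l))))).symm.map (continuous_const_smul ω)) :=
    (O.pathγ_congr p hp (.refl _) (fun l => .of_eq fun _ => rfl)).trans <|
    (O.pathγ_smul hact p hp ρ υ δ₂.symm (fun l => Path.refl (η.pt (p l)))).trans
    (.of_eq fun _ => rfl)
  have b₁ : O.γ p hp (O.γ m hm (σ • η.pt k) (fun i => τ i • η.pt (m i)))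
      (fun l => υ l • η.pt (p l)) = ω • O.γ (fun l => p ((P.perm ρ).symm l)) (P.sum_perm hp ρ)
        (O.γ (fun i => m ((P.perm σ).symm i)) (P.sum_perm hm σ) (η.pt k)
          (fun i => η.pt (m ((P.perm σ).symm i)))) (fun l => η.pt (p ((P.perm ρ).symm l))) :=
    (congrArg (fun x => O.γ p hp x _) a₁).trans l₂.source_eq
  have L := (η.liftγ_hhomotopic hact p hp ρ υ (η.liftγ hact m hm σ τ f g) c).trans <|
    (HHomotopic.hhcomp (HHomotopic.hhcomp (.refl _)
      (l₁.trans (HHomotopic.hhcomp (.refl _) l₂ _ b₁)) rfl rfl) (.refl _) _ rfl).trans <|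
    (HHomotopic.regroup _ _ _ _ _ rfl rfl b₁ rfl)
  -- the right hand side
  set q₂ : Fin k → ℕ := fun i => q ((P.perm σ).symm i) with hq₂
  set δ₃ := fun i => η.linear (fun j => p (blockIndex m hm ⟨i, (P.perm (τ i)).symm j⟩))
    (P.sum_perm (hq i) (τ i)) with hδ₃
  set g₁ := fun i => O.pathγ (fun j => p (blockIndex m hm ⟨i, j⟩)) (hq i) (g i)
    (fun j => c (blockIndex m hm ⟨i, j⟩)) with hg₁
  have r₁ : (O.pathγ q hN f (fun i =>
          η.liftγ hact (fun j => p (blockIndex m hm ⟨i, j⟩)) (hq i) (τ i)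
            (fun j => υ (blockIndex m hm ⟨i, j⟩)) (g i)
              (fun j => c (blockIndex m hm ⟨i, j⟩)))).HHomotopic
      (((O.pathγ q hN (Path.refl (η.pt k)) (fun i => η.linear
        (fun j => p (blockIndex m hm ⟨i, j⟩)) (hq i))).htrans (O.pathγ q hN f g₁) rfl).htrans
        (O.pathγ q hN (Path.refl (σ • η.pt k)) (fun i => (δ₃ i).symm.map
          (continuous_const_smul (θ i)))) (congrArg (O.γ q hN _) (funext a₄))) :=
    (O.pathγ_congr q hN (HHomotopic.pad f) (fun i => η.liftγ_hhomotopic hact _ (hq i) (τ i)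
      (fun j => υ (blockIndex m hm ⟨i, j⟩)) (g i) (fun j => c (blockIndex m hm ⟨i, j⟩)))).trans <|
    (O.pathγ_htrans q hN _ _ _ _ rfl a₄ (congrArg (O.γ q hN _) (funext a₄))).trans <|
    HHomotopic.hhcomp (O.pathγ_htrans q hN _ _ _ _ rfl (fun _ => rfl) rfl) (.refl _) _ _
  -- The same on the other side: equivariance with respect to `σ` and the `θ i` turns the inner
  -- final corrections into one translate.
  have r₂ : (O.pathγ q hN (Path.refl (σ • η.pt k)) (fun i => (δ₃ i).symm.map
          (continuous_const_smul (θ i)))).HHomotopic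
      ((O.pathγ q₂ (P.sum_perm hN σ) (Path.refl (η.pt k))
        (fun i => δ₃ ((P.perm σ).symm i))).symm.map (continuous_const_smul (P.γ q hN σ θ))) :=
    (O.pathγ_congr q hN (.of_eq fun _ => rfl) (fun i => .refl _)).trans <|
    (O.pathγ_smul hact q hN σ θ (Path.refl (η.pt k)) (fun i => (δ₃ i).symm)).trans
    (.of_eq fun _ => rfl)
  have b₂ := (congrArg (O.γ q hN (σ • η.pt k)) (funext a₄)).trans r₂.source_eq
  have R := (η.liftγ_hhomotopic hact q hN σ θ f _).trans <|
    (HHomotopic.hhcomp (HHomotopic.hhcomp (.refl _)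
      (r₁.trans (HHomotopic.hhcomp (.refl _) r₂ _ b₂)) rfl rfl) (.refl _) _ rfl).trans <|
    (HHomotopic.regroup _ _ _ _ _ rfl rfl b₂ rfl)
  refine L.trans (HHomotopic.trans ?_ R.symm)
  -- comparison
  have c₁ := η.linear_assoc m hm p hp q _ (fun _ _ => rfl) hq hN rfl rfl
  have c₂ : (O.pathγ p hp (O.pathγ m hm f g) c).HHomotopic (O.pathγ q hN f g₁) :=
    O.pathγ_assoc m hm p hp q hq hN f g c
  have c₃ := η.linear_assoc (fun i => m ((P.perm σ).symm i)) (P.sum_perm hm σ)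
    (fun l => p ((P.perm ρ).symm l)) (P.sum_perm hp ρ) q₂
    (fun i j => p (blockIndex m hm ⟨(P.perm σ).symm i, (P.perm (τ ((P.perm σ).symm i))).symm j⟩))
    (fun i j => by
      -- The permutation under `ρ` is a block permutation; its inverse returns a block to its old
      -- place and undoes the permutation within it.
      rw [hρ, P.perm_γ, blockPerm_symm_apply m hm _ _ (P.sum_perm hm σ)])
    (fun i => P.sum_perm (hq ((P.perm σ).symm i)) (τ ((P.perm σ).symm i))) (P.sum_perm hN σ) rfl rfl
  refine HHomotopic.hhcomp (HHomotopic.hhcomp c₁ c₂ rfl rfl) ?_ b₁ b₂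
  exact (Path.htrans_symm_map _ _ rfl _ _).trans
    ((HHomotopic.map_smul_congr hωω c₃.symm₂).trans (Path.htrans_symm_map _ _ rfl _ _).symm)

end GoodBasepoint

/-! ## Group operads of loops in quotients by covering actions -/

namespace LoopGroup

variable {X : Type u} [TopologicalSpace X] {x : X}

theorem mk_surjective : Function.Surjective (LoopGroup.mk : Path x x → LoopGroup X x) := by
  rintro ⟨a⟩
  obtain ⟨f, rfl⟩ := Path.Homotopic.Quotient.mk_surjective a
  exact ⟨f, rfl⟩

theorem mk_eq_mk {f g : Path x x} : LoopGroup.mk f = LoopGroup.mk g ↔ f.HHomotopic g :=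
  MulOpposite.op_injective.eq_iff.trans Path.Homotopic.Quotient.eq

end LoopGroup

namespace GoodBasepoint

variable {D : ℕ → Type u} [∀ n, TopologicalSpace (D n)] {O : TopOperadStr D} (η : GoodBasepoint O)

open Path

variable {K : ℕ → Type v} [∀ n, Group (K n)] {P : GroupOperad K} [∀ n, MulAction (K n) (D n)]
  [∀ n, ContinuousConstSMul (K n) (D n)]
  {Q : ℕ → Type u} [∀ n, TopologicalSpace (Q n)] (p : ∀ n, C(D n, Q n))
  (hp : ∀ (n : ℕ) (σ : K n) (x : D n), p n (σ • x) = p n x)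

/-- Translating the second lift by `σ`, so that it starts where the first one ends, does not change
its image under the invariant map `p n`. -/
theorem liftClass_mul {n : ℕ} {σ τ : K n} (f : Path (η.pt n) (σ • η.pt n))
    (g : Path (η.pt n) (τ • η.pt n)) :
    η.liftClass p hp σ f * η.liftClass p hp τ g = η.liftClass p hp (σ * τ) (η.liftMul f g) := by
  rw [liftClass, liftClass, LoopGroup.mk_mul_mk]
  refine LoopGroup.mk_eq_mk.2 (.of_eq fun t => ?_)
  change _ = p n ((f.trans (g.map (continuous_const_smul σ))) t)
  simp only [Path.trans_apply]
  split_ifs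
  · rfl
  · exact (hp n σ _).symm

omit [∀ n, ContinuousConstSMul (K n) (D n)] in
theorem liftClass_one {n : ℕ} {f : Path (η.pt n) ((1 : K n) • η.pt n)}
    (hf : f.HHomotopic (Path.refl (η.pt n))) : η.liftClass p hp 1 f = 1 :=
  LoopGroup.mk_eq_mk.2 ((HHomotopic.cast_left _ _ _).trans (hf.map (p n).continuous))

/-- The constant path, as a path from `e n` to `1 e n`. -/
noncomputable def constLift (K : ℕ → Type v) [∀ n, Group (K n)] [∀ n, MulAction (K n) (D n)]
    (n : ℕ) : Path (η.pt n) ((1 : K n) • η.pt n) :=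
  (Path.refl (η.pt n)).cast rfl (one_smul _ _)

omit [∀ n, ContinuousConstSMul (K n) (D n)] in
theorem constLift_hhomotopic (n : ℕ) : (η.constLift K n).HHomotopic (Path.refl (η.pt n)) :=
  .of_eq fun _ => rfl

omit [∀ n, ContinuousConstSMul (K n) (D n)] in
theorem liftClass_constLift (n : ℕ) : η.liftClass p hp 1 (η.constLift K n) = 1 :=
  η.liftClass_one p hp (η.constLift_hhomotopic n)

variable (hq : ∀ n, IsQuotientCoveringMap (p n) (K n))

include hq

omit [∀ n, ContinuousConstSMul (K n) (D n)] in
-- A loop lifts to a path from `e n`, whose end lies in the same fibre and hence in the orbit of `e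
-- n`.
theorem exists_liftClass {n : ℕ} (x : LoopGroup (Q n) (p n (η.pt n))) :
    ∃ (σ : K n) (f : Path (η.pt n) (σ • η.pt n)), x = η.liftClass p hp σ f := by
  obtain ⟨a, rfl⟩ := LoopGroup.mk_surjective x
  obtain ⟨Γ, hΓ, h0⟩ := (hq n).isCoveringMap.exists_path_lifts a.toContinuousMap (η.pt n) a.source
  have h1 : p n (Γ 1) = p n (η.pt n) := (congrFun hΓ 1).trans a.target
  obtain ⟨σ, hσ⟩ := (hq n).apply_eq_iff_mem_orbit.1 h1
  refine ⟨σ, ⟨Γ, h0, hσ.symm⟩, LoopGroup.mk_eq_mk.2 (.of_eq fun t => (congrFun hΓ t).symm)⟩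

omit [∀ n, ContinuousConstSMul (K n) (D n)] in
-- Homotopies of loops lift relative to the end points, so the lifts end at the same point, and
-- freeness of the action recovers `σ`. All identities between loop classes are proved through this
-- criterion.
theorem liftClass_eq_iff {n : ℕ} {σ τ : K n} {f : Path (η.pt n) (σ • η.pt n)}
    {g : Path (η.pt n) (τ • η.pt n)} :
    η.liftClass p hp σ f = η.liftClass p hp τ g ↔ σ = τ ∧ f.HHomotopic g := by
  constructor
  · intro h
    have h' : f.HHomotopic g := ((hq n).isCoveringMap.homotopicRel_iff_comp
      ⟨0, by simp, f.source.trans g.source.symm⟩).2 (LoopGroup.mk_eq_mk.1 h)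
    have := (hq n).isCancelSMul
    exact ⟨IsCancelSMul.right_cancel _ _ _ h'.target_eq, h'⟩
  · rintro ⟨rfl, h⟩
    exact LoopGroup.mk_eq_mk.2 (((HHomotopic.cast_left _ _ _).trans (h.map _)).trans
      (HHomotopic.cast_left _ _ _).symm)

/-- The homomorphism which sends the class of the image of a path from `e n` to `σ e n` to `σ`. -/
noncomputable def degree (n : ℕ) : LoopGroup (Q n) (p n (η.pt n)) →* K n :=
  MonoidHom.mk' (fun x => (η.exists_liftClass p hp hq x).choose) fun x y => by
    obtain ⟨f, hf⟩ := (η.exists_liftClass p hp hq x).choose_spec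
    obtain ⟨g, hg⟩ := (η.exists_liftClass p hp hq y).choose_spec
    obtain ⟨k, hk⟩ := (η.exists_liftClass p hp hq (x * y)).choose_spec
    exact ((η.liftClass_eq_iff p hp hq).1 (hk.symm.trans
      ((congrArg₂ (· * ·) hf hg).trans (η.liftClass_mul p hp f g)))).1

/-- A lift of a representative of a class of loops. -/
noncomputable def someLift {n : ℕ} (x : LoopGroup (Q n) (p n (η.pt n))) :
    Path (η.pt n) (η.degree p hp hq n x • η.pt n) :=
  (η.exists_liftClass p hp hq x).choose_spec.choose

theorem liftClass_someLift {n : ℕ} (x : LoopGroup (Q n) (p n (η.pt n))) :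
    η.liftClass p hp (η.degree p hp hq n x) (η.someLift p hp hq x) = x :=
  (η.exists_liftClass p hp hq x).choose_spec.choose_spec.symm

theorem degree_liftClass {n : ℕ} (σ : K n) (f : Path (η.pt n) (σ • η.pt n)) :
    η.degree p hp hq n (η.liftClass p hp σ f) = σ :=
  ((η.liftClass_eq_iff p hp hq).1 (η.liftClass_someLift p hp hq _)).1

theorem exists_liftClass_family {k : ℕ} {m : Fin k → ℕ}
    (b : ∀ i, LoopGroup (Q (m i)) (p (m i) (η.pt (m i)))) :
    ∃ (τ : ∀ i, K (m i)) (g : ∀ i, Path (η.pt (m i)) (τ i • η.pt (m i))),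
      b = fun i => η.liftClass p hp (τ i) (g i) :=
  ⟨fun i => η.degree p hp hq _ (b i), fun i => η.someLift p hp hq (b i),
    funext fun i => (η.liftClass_someLift p hp hq (b i)).symm⟩

variable (hact : IsOperadAction P O.toOperadStr)

/-- The composition of classes of loops by means of lifts. -/
noncomputable def loopγ {k n : ℕ} (m : Fin k → ℕ) (h : ∑ i, m i = n)
    (a : LoopGroup (Q k) (p k (η.pt k))) (b : ∀ i, LoopGroup (Q (m i)) (p (m i) (η.pt (m i)))) :
    LoopGroup (Q n) (p n (η.pt n)) :=
  η.liftClass p hp _ (η.liftγ hact m h (η.degree p hp hq k a)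
    (fun i => η.degree p hp hq (m i) (b i)) (η.someLift p hp hq a)
    (fun i => η.someLift p hp hq (b i)))

omit hq in
theorem liftClass_liftγ_congr {k n : ℕ} (m : Fin k → ℕ) (h : ∑ i, m i = n)
    {σ σ' : K k} {τ τ' : ∀ i, K (m i)} {f : Path (η.pt k) (σ • η.pt k)}
    {f' : Path (η.pt k) (σ' • η.pt k)} {g : ∀ i, Path (η.pt (m i)) (τ i • η.pt (m i))}
    {g' : ∀ i, Path (η.pt (m i)) (τ' i • η.pt (m i))} (hf : σ = σ' ∧ f.HHomotopic f')
    (hg : ∀ i, τ i = τ' i ∧ (g i).HHomotopic (g' i)) :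
    η.liftClass p hp _ (η.liftγ hact m h σ τ f g) =
      η.liftClass p hp _ (η.liftγ hact m h σ' τ' f' g') := by
  obtain rfl : τ = τ' := funext fun i => (hg i).1
  obtain ⟨rfl, hf⟩ := hf
  exact LoopGroup.mk_eq_mk.2 (((HHomotopic.cast_left _ _ _).trans
    ((η.liftγ_congr hact m h hf fun i => (hg i).2).map _)).trans (HHomotopic.cast_left _ _ _).symm)

/-- Independence of the chosen lifts: any two lifts of a class have the same group element and are
homotopic. -/
theorem loopγ_liftClass {k n : ℕ} (m : Fin k → ℕ) (h : ∑ i, m i = n) (σ : K k)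
    (τ : ∀ i, K (m i)) (f : Path (η.pt k) (σ • η.pt k))
    (g : ∀ i, Path (η.pt (m i)) (τ i • η.pt (m i))) :
    η.loopγ p hp hq hact m h (η.liftClass p hp σ f) (fun i => η.liftClass p hp (τ i) (g i)) =
      η.liftClass p hp (P.γ m h σ τ) (η.liftγ hact m h σ τ f g) :=
  η.liftClass_liftγ_congr p hp hact m h
    ((η.liftClass_eq_iff p hp hq).1 (η.liftClass_someLift p hp hq _))
    (fun _ => (η.liftClass_eq_iff p hp hq).1 (η.liftClass_someLift p hp hq _))

theorem loopγ_perm_congr {k n : ℕ} (m : Fin k → ℕ) {s s' : Equiv.Perm (Fin k)} (hs : s = s')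
    (h : ∑ i, m (s.symm i) = n) (h' : ∑ i, m (s'.symm i) = n)
    (a : LoopGroup (Q k) (p k (η.pt k))) (b : ∀ i, LoopGroup (Q (m i)) (p (m i) (η.pt (m i)))) :
    η.loopγ p hp hq hact (fun i => m (s.symm i)) h a (fun i => b (s.symm i)) =
      η.loopγ p hp hq hact (fun i => m (s'.symm i)) h' a (fun i => b (s'.symm i)) := by
  subst hs
  rfl

/-- The group operad of the fundamental groups of the quotients of a topological operad by
covering actions of a group operad. -/
noncomputable def quotientLoopOperad : GroupOperad (fun n => LoopGroup (Q n) (p n (η.pt n))) where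
  zero_point := by
    obtain ⟨hK⟩ := P.zero_point
    obtain ⟨hD⟩ := O.zero_point
    refine ⟨⟨⟨1⟩, fun x => ?_⟩⟩
    obtain ⟨σ, f, rfl⟩ := η.exists_liftClass p hp hq x
    rw [← η.liftClass_constLift p hp]
    -- Both components of a pair are unique, because `K 0` and `D 0` are points.
    exact (η.liftClass_eq_iff p hp hq).2
      ⟨Subsingleton.elim _ _, .of_eq fun _ => Subsingleton.elim _ _⟩
  one := 1
  γ := η.loopγ p hp hq hact
  one_γ h a := by
    obtain ⟨τ, g, rfl⟩ := η.exists_liftClass p hp hq a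
    rw [← η.liftClass_constLift p hp]
    refine (η.loopγ_liftClass p hp hq hact _ h 1 (fun _ => τ) _ (fun _ => g)).trans
      ((η.liftClass_eq_iff p hp hq).2 ⟨?_, η.liftγ_one_left hact h g (η.constLift_hhomotopic 1)⟩)
    rw [← P.one_eq]
    exact P.one_γ h τ
  γ_one h a := by
    obtain ⟨σ, f, rfl⟩ := η.exists_liftClass p hp hq a
    rw [← η.liftClass_constLift p hp]
    refine (η.loopγ_liftClass p hp hq hact _ h σ (fun _ => 1) f
      (fun _ => η.constLift K 1)).trans ((η.liftClass_eq_iff p hp hq).2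
        ⟨?_, η.liftγ_one_right hact h f fun _ => η.constLift_hhomotopic 1⟩)
    rw [← P.one_eq]
    exact P.γ_one h σ
  assoc m hm r hr q hq' hN a b c := by
    obtain ⟨σ, f, rfl⟩ := η.exists_liftClass p hp hq a
    obtain ⟨τ, g, rfl⟩ := η.exists_liftClass_family p hp hq b
    obtain ⟨υ, k, rfl⟩ := η.exists_liftClass_family p hp hq c
    simp only [η.loopγ_liftClass p hp hq hact]
    exact (η.liftClass_eq_iff p hp hq).2 ⟨P.assoc m hm r hr q hq' hN σ τ υ,
      η.liftγ_assoc hact m hm r hr q hq' hN σ τ υ f g k⟩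
  π n := (P.π n).comp (η.degree p hp hq n)
  π_γ m h a b := by
    obtain ⟨σ, f, rfl⟩ := η.exists_liftClass p hp hq a
    obtain ⟨τ, g, rfl⟩ := η.exists_liftClass_family p hp hq b
    simp only [η.loopγ_liftClass p hp hq hact, MonoidHom.comp_apply, η.degree_liftClass p hp hq]
    exact P.π_γ m h σ τ
  one_eq := rfl
  crossed m h a a' b b' h' := by
    obtain ⟨σ, f, rfl⟩ := η.exists_liftClass p hp hq a
    obtain ⟨σ', f', rfl⟩ := η.exists_liftClass p hp hq a'
    obtain ⟨τ, g, rfl⟩ := η.exists_liftClass_family p hp hq b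
    obtain ⟨τ', g', rfl⟩ := η.exists_liftClass_family p hp hq b'
    -- A loop class permutes indices through its degree; the permuted arities have to be expressed
    -- by `σ` before the crossed law for lifts applies.
    have hs : ((P.π _).comp (η.degree p hp hq _) (η.liftClass p hp σ f)).unop = P.perm σ := by
      rw [MonoidHom.comp_apply, η.degree_liftClass p hp hq]
      rfl
    refine Eq.trans ?_ (congrArg (_ * ·) (η.loopγ_perm_congr p hp hq hact m hs h'
      (P.sum_perm h σ) _ (fun i => η.liftClass p hp (τ' i) (g' i))).symm)
    simp only [η.loopγ_liftClass p hp hq hact, η.liftClass_mul p hp]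
    exact (η.liftClass_eq_iff p hp hq).2 ⟨P.crossed m h σ σ' τ τ' (P.sum_perm h σ),
      η.liftγ_mul hact m h f f' g g'⟩

theorem isQuotientLoopOperad_quotientLoopOperad :
    η.IsQuotientLoopOperad hact p hp (η.quotientLoopOperad p hp hq hact) :=
  η.loopγ_liftClass p hp hq hact

/-- The morphism of group operads which sends the class of the image of a path from `e n` to
`σ e n` to `σ`. -/
noncomputable def degreeHom : GroupOperadHom (η.quotientLoopOperad p hp hq hact) P where
  toHom := η.degree p hp hq
  π_comp _ _ := rfl
  map_γ _ _ _ _ := η.degree_liftClass p hp hq _ _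

end GoodBasepoint

/-! ## The quotient maps as covering maps -/

namespace OrbitSpace

variable {G : Type v} [Group G] {X : Type u} [MulAction G X] [TopologicalSpace X]

theorem isQuotientCoveringMap_mk [ContinuousConstSMul G X] (h : IsCoveringAction G X) :
    IsQuotientCoveringMap (OrbitSpace.mk G (X := X)) G where
  toIsQuotientMap := isOpenQuotientMap_mk.isQuotientMap
  continuous_const_smul := continuous_const_smul
  apply_eq_iff_mem_orbit := mk_eq_mk
  disjoint := h

/-- Preceded by the two orbit projections, the map becomes the open projection of `X` to its orbit
space; as those two are continuous and onto, the map itself is open. -/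
theorem isHomeomorph_iterated [ContinuousConstSMul G X] (N : Subgroup G) [N.Normal] :
    IsHomeomorph (OrbitSpace.iterated N (X := X)) where
  continuous := (OrbitSpace.iterated N).continuous
  isOpenMap := by
    have h : IsOpenMap (OrbitSpace.iterated N (X := X) ∘ OrbitSpace.mk (G ⧸ N) ∘ OrbitSpace.mk N) :=
      (OrbitSpace.isOpenQuotientMap_mk (G := G) (X := X)).isOpenMap
    exact IsOpenMap.of_comp (continuous_mk.comp continuous_mk)
      (mk_surjective.comp mk_surjective) h
  bijective := by
    constructor
    · intro x y h
      obtain ⟨x, rfl⟩ := mk_surjective x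
      obtain ⟨x, rfl⟩ := mk_surjective x
      obtain ⟨y, rfl⟩ := mk_surjective y
      obtain ⟨y, rfl⟩ := mk_surjective y
      obtain ⟨g, rfl⟩ := mk_eq_mk.1 (h : OrbitSpace.mk G x = OrbitSpace.mk G y)
      exact mk_eq_mk.2 ⟨QuotientGroup.mk g, rfl⟩
    · intro x
      obtain ⟨x, rfl⟩ := mk_surjective x
      exact ⟨OrbitSpace.mk _ (OrbitSpace.mk N x), rfl⟩

/-- The projection is the quotient map of the covering action of `G ⧸ N`, followed by the
homeomorphism `iterated`. -/
theorem isQuotientCoveringMap_proj [ContinuousConstSMul G X] (N : Subgroup G) [N.Normal]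
    (h : IsCoveringAction (G ⧸ N) (OrbitSpace N X)) :
    IsQuotientCoveringMap (OrbitSpace.proj N (X := X)) (G ⧸ N) :=
  (isQuotientCoveringMap_mk h).homeomorph_comp ((isHomeomorph_iterated N).homeomorph _)

end OrbitSpace

/-! ## The trivial group operad -/

theorem blockPerm_one {k n : ℕ} (m : Fin k → ℕ) (h : ∑ i, m i = n) :
    blockPerm m h 1 (fun _ => 1) = 1 := by
  refine Equiv.ext fun x => ?_
  obtain ⟨⟨i, j⟩, rfl⟩ := (blockIndex m h).surjective x
  exact blockPerm_apply m h 1 (fun _ => 1) h i j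

/-- The action of a group on itself by conjugation. -/
abbrev conjAction (G : Type u) [Group G] : MulAction G G where
  smul a b := a * b * a⁻¹
  one_smul b := by
    change 1 * b * 1⁻¹ = b
    group
  mul_smul a b c := by
    change a * b * c * (a * b)⁻¹ = a * (b * c * b⁻¹) * a⁻¹
    group

theorem conjAction_smul {G : Type u} [Group G] (a b : G) :
    (conjAction G).smul a b = a * b * a⁻¹ :=
  rfl

namespace GroupOperad

variable {G : ℕ → Type v} [∀ n, Group (G n)] (P : GroupOperad G)

theorem NonCrossed.perm_eq_one {P : GroupOperad G} (hP : P.NonCrossed) {n : ℕ} (a : G n) :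
    P.perm a = 1 :=
  congrArg MulOpposite.unop (hP n a)

/-- Without permutations of the indices the crossed law says that `γ` is a homomorphism. -/
theorem NonCrossed.γ_mul {P : GroupOperad G} (hP : P.NonCrossed) {k n : ℕ} (m : Fin k → ℕ)
    (h : ∑ i, m i = n) (a a' : G k) (b b' : ∀ i, G (m i)) :
    P.γ m h (a * a') (fun i => b i * b' i) = P.γ m h a b * P.γ m h a' b' :=
  (P.crossed m h a a' b b' (P.sum_perm h a)).trans (congrArg (P.γ m h a b * ·)
    (P.γ_perm_congr m (hP.perm_eq_one a) (P.sum_perm h a) h a' b'))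

theorem NonCrossed.γ_inv {P : GroupOperad G} (hP : P.NonCrossed) {k n : ℕ} (m : Fin k → ℕ)
    (h : ∑ i, m i = n) (a : G k) (b : ∀ i, G (m i)) :
    P.γ m h a⁻¹ (fun i => (b i)⁻¹) = (P.γ m h a b)⁻¹ := by
  rw [eq_inv_iff_mul_eq_one, ← hP.γ_mul]
  simp only [inv_mul_cancel]
  exact P.γ_one_one m h

/-- A non-crossed group operad acts on itself by conjugation. -/
theorem NonCrossed.isOperadAction_conj {P : GroupOperad G} (hP : P.NonCrossed)
    (act : ∀ n, MulAction (G n) (G n)) (ha : ∀ n (a b : G n), (act n).smul a b = a * b * a⁻¹) :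
    IsOperadAction P P.toOperadStr (act := act) := by
  intro k n m h σ τ a b
  change P.γ m h ((act k).smul σ a) (fun i => (act (m i)).smul (τ i) (b i)) =
    (act n).smul (P.γ m h σ τ) (P.γ (fun i => m ((P.perm σ).symm i)) (P.sum_perm h σ) a
      (fun i => b ((P.perm σ).symm i)))
  have e := P.γ_perm_congr m (hP.perm_eq_one σ) (P.sum_perm h σ) h a b
  rw [e]
  simp only [ha]
  rw [hP.γ_mul m h (σ * a) σ⁻¹ (fun i => τ i * b i) (fun i => (τ i)⁻¹), hP.γ_mul, hP.γ_inv]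
  rfl

end GroupOperad

/-- The group operad which consists of trivial groups. -/
def trivialGroupOperad : GroupOperad (fun _ => Unit) where
  zero_point := ⟨inferInstance⟩
  one := 1
  γ _ _ _ _ := 1
  one_γ _ _ := rfl
  γ_one _ _ := rfl
  assoc _ _ _ _ _ _ _ _ _ _ := rfl
  π _ := 1
  π_γ m h _ _ := (congrArg MulOpposite.op (blockPerm_one m h)).symm
  one_eq := rfl
  crossed _ _ _ _ _ _ _ := rfl

/-- The action of the trivial group. -/
abbrev unitAction (X : Type u) : MulAction Unit X where
  smul _ x := x
  one_smul _ := rfl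
  mul_smul _ _ _ := rfl

/-! ## The operad structure on the fundamental groups of a topological operad -/

/-- The homomorphism of fundamental groups induced by a continuous map. -/
noncomputable def LoopGroup.map {X : Type u} [TopologicalSpace X] {Y : Type v} [TopologicalSpace Y]
    (φ : C(X, Y)) (x : X) : LoopGroup X x →* LoopGroup Y (φ x) :=
  MonoidHom.op (FundamentalGroup.map φ x)

theorem LoopGroup.map_mk {X : Type u} [TopologicalSpace X] {Y : Type v} [TopologicalSpace Y]
    (φ : C(X, Y)) {x : X} (f : Path x x) :
    LoopGroup.map φ x (LoopGroup.mk f) = LoopGroup.mk (f.map φ.continuous) :=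
  rfl

theorem LoopGroup.exists_mk_family {D : ℕ → Type u} [∀ n, TopologicalSpace (D n)] {x : ∀ n, D n}
    {k : ℕ} {m : Fin k → ℕ} (b : ∀ i, LoopGroup (D (m i)) (x (m i))) :
    ∃ g : ∀ i, Path (x (m i)) (x (m i)), b = fun i => LoopGroup.mk (g i) := by
  choose g hg using fun i => LoopGroup.mk_surjective (b i)
  exact ⟨g, funext fun i => (hg i).symm⟩

namespace GoodBasepoint

open Path

variable {D : ℕ → Type u} [∀ n, TopologicalSpace (D n)] {O : TopOperadStr D} (η : GoodBasepoint O)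

/-- The case of the trivial group operad, where the identity of `D n` is the quotient covering. All
lifts are closed and all `π` are trivial. -/
theorem exists_isLoopOperad : ∃ A : GroupOperad (fun n => LoopGroup (D n) (η.pt n)),
    η.IsLoopOperad A ∧ A.NonCrossed := by
  let _ : ∀ n, MulAction Unit (D n) := fun n => unitAction (D n)
  have hc : ∀ n, ContinuousConstSMul Unit (D n) := fun n => ⟨fun _ => continuous_id⟩
  have hq : ∀ n, IsQuotientCoveringMap (ContinuousMap.id (D n)) Unit := fun n =>
    { toIsQuotientMap := .id
      continuous_const_smul := continuous_const_smul
      apply_eq_iff_mem_orbit := ⟨fun h => ⟨1, h.symm⟩, fun ⟨_, h⟩ => h.symm⟩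
      disjoint := fun x => ⟨Set.univ, Filter.univ_mem, fun _ _ => rfl⟩ }
  have hact : IsOperadAction trivialGroupOperad O.toOperadStr := fun m h σ τ a b => rfl
  refine ⟨η.quotientLoopOperad (fun n => ContinuousMap.id (D n)) (fun _ _ _ => rfl) hq hact,
    fun m h f g => ?_, fun _ _ => rfl⟩
  exact (η.isQuotientLoopOperad_quotientLoopOperad (fun n => ContinuousMap.id (D n))
    (fun _ _ _ => rfl) hq hact m h 1 (fun _ => 1) f g).trans
    (LoopGroup.mk_eq_mk.2 (.of_eq fun _ => rfl))

/-! ### The exact sequence, and change of the quotient spaces -/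

variable {K : ℕ → Type v} [∀ n, Group (K n)] {P : GroupOperad K} [∀ n, MulAction (K n) (D n)]
  [∀ n, ContinuousConstSMul (K n) (D n)]
  {Q : ℕ → Type u} [∀ n, TopologicalSpace (Q n)] (p : ∀ n, C(D n, Q n))
  (hp : ∀ (n : ℕ) (σ : K n) (x : D n), p n (σ • x) = p n x)
  (hq : ∀ n, IsQuotientCoveringMap (p n) (K n)) (hact : IsOperadAction P O.toOperadStr)

omit [∀ n, ContinuousConstSMul (K n) (D n)] in
theorem mk_map_eq_liftClass {n : ℕ} (f : Path (η.pt n) (η.pt n)) :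
    LoopGroup.mk (f.map (p n).continuous) =
      η.liftClass p hp (1 : K n) (f.cast rfl (one_smul _ _)) :=
  LoopGroup.mk_eq_mk.2 (.of_eq fun _ => rfl)

/-- For closed lifts no translation or permutation remains and both corrections are the same linear
path; this makes the projection compatible with `γ`. -/
theorem liftγ_one {k n : ℕ} (m : Fin k → ℕ) (h : ∑ i, m i = n) (f : Path (η.pt k) (η.pt k))
    (g : ∀ i, Path (η.pt (m i)) (η.pt (m i))) :
    (η.liftγ hact m h 1 (fun _ => 1) (f.cast rfl (one_smul _ _))
      (fun i => (g i).cast rfl (one_smul _ _))).HHomotopic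
      (((η.linear m h).trans (O.pathγ m h f g)).trans (η.linear m h).symm) := by
  have hm : (fun i => m ((P.perm 1).symm i)) = m := by
    rw [P.perm_one]
    rfl
  have e₁ : (O.pathγ m h (f.cast rfl (one_smul (K k) _))
      (fun i => (g i).cast rfl (one_smul (K (m i)) _))).HHomotopic (O.pathγ m h f g) :=
    O.pathγ_congr m h (.cast_left _ _ _) (fun i => .cast_left _ _ _)
  have e₂ : ((η.linear (fun i => m ((P.perm 1).symm i)) (P.sum_perm h 1)).symm.map
      (continuous_const_smul (P.γ m h 1 (fun _ => 1)))).HHomotopic (η.linear m h).symm :=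
    (HHomotopic.map_smul_congr (P.γ_one_one m h)
      (η.linear_index_congr hm (P.sum_perm h 1) h).symm₂).trans (.of_eq fun t => one_smul (K n) _)
  have e₃ : (((η.linear m h).htrans (O.pathγ m h f g) rfl).htrans (η.linear m h).symm
      rfl).HHomotopic (((η.linear m h).trans (O.pathγ m h f g)).trans (η.linear m h).symm) :=
    .refl _
  exact (η.liftγ_hhomotopic hact m h _ _ _ _).trans
    ((HHomotopic.hhcomp (HHomotopic.hhcomp (.refl _) e₁ rfl rfl) e₂ _ rfl).trans e₃)

/-- The morphism of group operads induced by the projections to the quotients. -/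
noncomputable def projHom {A : GroupOperad (fun n => LoopGroup (D n) (η.pt n))}
    (hA : η.IsLoopOperad A) (hA' : A.NonCrossed) :
    GroupOperadHom A (η.quotientLoopOperad p hp hq hact) where
  toHom n := LoopGroup.map (p n) (η.pt n)
  π_comp n a := by
    obtain ⟨f, rfl⟩ := LoopGroup.mk_surjective a
    rw [hA', LoopGroup.map_mk, η.mk_map_eq_liftClass p hp]
    change P.π n (η.degree p hp hq n _) = 1
    rw [η.degree_liftClass p hp hq, map_one]
  map_γ m h a b := by
    obtain ⟨f, rfl⟩ := LoopGroup.mk_surjective a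
    obtain ⟨g, rfl⟩ := LoopGroup.exists_mk_family b
    rw [hA m h f g]
    simp only [LoopGroup.map_mk]
    refine Eq.trans ?_ (Eq.trans (η.isQuotientLoopOperad_quotientLoopOperad p hp hq hact m h 1
      (fun _ => 1) (f.cast rfl (one_smul _ _)) (fun i => (g i).cast rfl (one_smul _ _))).symm ?_)
    · exact LoopGroup.mk_eq_mk.2 (((η.liftγ_one hact m h f g).symm.map _).trans
        (HHomotopic.cast_left _ _ _).symm)
    · simp only [← η.mk_map_eq_liftClass p hp]

omit [∀ n, ContinuousConstSMul (K n) (D n)] in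
include hp hq in
theorem map_injective {n : ℕ} : Function.Injective (LoopGroup.map (p n) (η.pt n)) := by
  intro a b h
  obtain ⟨f, rfl⟩ := LoopGroup.mk_surjective a
  obtain ⟨g, rfl⟩ := LoopGroup.mk_surjective b
  rw [LoopGroup.map_mk, LoopGroup.map_mk, η.mk_map_eq_liftClass p hp,
    η.mk_map_eq_liftClass p hp] at h
  exact LoopGroup.mk_eq_mk.2 ((η.liftClass_eq_iff p hp hq).1 h).2

/-- A class comes from a loop in `D n` exactly if its lift ends at `1 • e n = e n`. -/
theorem range_map_eq_ker_degree (n : ℕ) :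
    (LoopGroup.map (p n) (η.pt n)).range = (η.degree p hp hq n).ker := by
  ext x
  constructor
  · rintro ⟨a, rfl⟩
    obtain ⟨f, rfl⟩ := LoopGroup.mk_surjective a
    rw [LoopGroup.map_mk, η.mk_map_eq_liftClass p hp]
    exact η.degree_liftClass p hp hq _ _
  · intro hx
    obtain ⟨σ, f, rfl⟩ := η.exists_liftClass p hp hq x
    obtain rfl : σ = 1 := (η.degree_liftClass p hp hq σ f).symm.trans hx
    exact ⟨LoopGroup.mk (f.cast rfl (one_smul _ _).symm), LoopGroup.mk_eq_mk.2 (.of_eq fun _ => rfl)⟩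

/-- Any path from `e n` to `σ • e n` represents a class of degree `σ`. -/
theorem degree_surjective (n : ℕ) [PathConnectedSpace (D n)] :
    Function.Surjective (η.degree p hp hq n) := fun σ =>
  ⟨_, η.degree_liftClass p hp hq σ (PathConnectedSpace.somePath _ _)⟩

/-- The morphism of group operads induced by maps between two systems of quotients. -/
noncomputable def quotientMapHom {Q' : ℕ → Type u} [∀ n, TopologicalSpace (Q' n)]
    (φ : ∀ n, C(Q n, Q' n))
    (hp' : ∀ (n : ℕ) (σ : K n) (x : D n), (φ n).comp (p n) (σ • x) = (φ n).comp (p n) x)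
    (hq' : ∀ n, IsQuotientCoveringMap ((φ n).comp (p n)) (K n)) :
    GroupOperadHom (η.quotientLoopOperad p hp hq hact)
      (η.quotientLoopOperad (fun n => (φ n).comp (p n)) hp' hq' hact) where
  toHom n := LoopGroup.map (φ n) (p n (η.pt n))
  π_comp n a := by
    obtain ⟨σ, f, rfl⟩ := η.exists_liftClass p hp hq a
    change P.π n (η.degree (fun n => (φ n).comp (p n)) hp' hq' n
      (η.liftClass (fun n => (φ n).comp (p n)) hp' σ f)) = P.π n (η.degree p hp hq n _)
    rw [η.degree_liftClass, η.degree_liftClass]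
  map_γ m h a b := by
    obtain ⟨σ, f, rfl⟩ := η.exists_liftClass p hp hq a
    obtain ⟨τ, g, rfl⟩ := η.exists_liftClass_family p hp hq b
    rw [η.isQuotientLoopOperad_quotientLoopOperad p hp hq hact m h σ τ f g]
    exact (η.isQuotientLoopOperad_quotientLoopOperad _ hp' hq' hact m h σ τ f g).symm

omit [∀ n, ContinuousConstSMul (K n) (D n)] in
include hp hq in
-- Both fundamental groups are described by the same lifts in `D n`, and the map preserves the lift.
theorem quotientMapHom_bijective {Q' : ℕ → Type u} [∀ n, TopologicalSpace (Q' n)]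
    (φ : ∀ n, C(Q n, Q' n))
    (hp' : ∀ (n : ℕ) (σ : K n) (x : D n), (φ n).comp (p n) (σ • x) = (φ n).comp (p n) x)
    (hq' : ∀ n, IsQuotientCoveringMap ((φ n).comp (p n)) (K n)) (n : ℕ) :
    Function.Bijective (LoopGroup.map (φ n) (p n (η.pt n))) := by
  constructor
  · intro a b h
    obtain ⟨σ, f, rfl⟩ := η.exists_liftClass p hp hq a
    obtain ⟨τ, g, rfl⟩ := η.exists_liftClass p hp hq b
    exact (η.liftClass_eq_iff p hp hq).2 ((η.liftClass_eq_iff _ hp' hq').1 h)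
  · intro x
    obtain ⟨σ, f, rfl⟩ := η.exists_liftClass _ hp' hq' x
    exact ⟨η.liftClass p hp σ f, rfl⟩

end GoodBasepoint

/-! ## Change of the basepoint of maps of cubes -/

section Cube

variable {l : ℕ}

theorem cubeRadius_eq_one {t : Fin l → unitInterval} (ht : t ∈ Cube.boundary (Fin l)) :
    cubeRadius t = 1 := by
  obtain ⟨i, hi⟩ := ht
  apply le_antisymm
  · refine (pi_norm_le_iff_of_nonneg zero_le_one).2 fun j => ?_
    rw [Real.norm_eq_abs, abs_le]
    have h0 := (t j).2.1
    have h1 := (t j).2.2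
    constructor <;> linarith
  · refine le_trans ?_ (norm_le_pi_norm (fun i => 2 * (t i : ℝ) - 1) i)
    rcases hi with hi | hi <;> simp only [hi] <;> norm_num

theorem cubeRadius_le_one (t : Fin l → unitInterval) : cubeRadius t ≤ 1 := by
  refine (pi_norm_le_iff_of_nonneg zero_le_one).2 fun j => ?_
  rw [Real.norm_eq_abs, abs_le]
  have h0 := (t j).2.1
  have h1 := (t j).2.2
  constructor <;> linarith

/-- Dilation of the cube from its centre by the factor `c`, followed by the projection to the
cube. -/
noncomputable def cubeScale (c : ℝ) (t : Fin l → unitInterval) : Fin l → unitInterval :=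
  fun i => Set.projIcc 0 1 zero_le_one (c * ((t i : ℝ) - 1 / 2) + 1 / 2)

theorem cubeScale_one (t : Fin l → unitInterval) : cubeScale 1 t = t := by
  funext i
  have : (1 : ℝ) * ((t i : ℝ) - 1 / 2) + 1 / 2 = t i := by ring
  rw [cubeScale, this]
  exact Set.projIcc_val _ _

/-- A coordinate which realizes the maximum norm is dilated exactly to `0` or `1`. For `l = 0` the
radius is `0`, which the hypothesis excludes. -/
theorem cubeScale_mem_boundary {c : ℝ} {t : Fin l → unitInterval} (h : c * cubeRadius t = 1) :
    cubeScale c t ∈ Cube.boundary (Fin l) := by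
  have hne : Nonempty (Fin l) := by
    by_contra hemp
    rw [not_nonempty_iff] at hemp
    have : cubeRadius t = 0 := by
      unfold cubeRadius
      rw [Subsingleton.elim (fun i => 2 * (t i : ℝ) - 1) 0, norm_zero]
    rw [this, mul_zero] at h
    exact zero_ne_one h
  obtain ⟨i, hi⟩ := Finite.exists_max fun i => ‖2 * (t i : ℝ) - 1‖
  have hr : cubeRadius t = |2 * (t i : ℝ) - 1| :=
    le_antisymm ((pi_norm_le_iff_of_nonempty _).2 hi)
      (norm_le_pi_norm (fun i => 2 * (t i : ℝ) - 1) i)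
  rw [hr] at h
  refine ⟨i, ?_⟩
  rcases abs_choice (2 * (t i : ℝ) - 1) with h' | h' <;> rw [h'] at h
  · right
    exact Set.projIcc_of_right_le _ (by linarith)
  · left
    exact Set.projIcc_of_le_left _ (by linarith)

theorem continuous_cubeScale {A : Type u} [TopologicalSpace A] {c : A → ℝ} (hc : Continuous c)
    {f : A → Fin l → unitInterval} (hf : Continuous f) :
    Continuous fun z => cubeScale (c z) (f z) :=
  continuous_pi fun i => continuous_projIcc.comp
    ((hc.mul ((continuous_subtype_val.comp ((continuous_apply i).comp hf)).sub
      continuous_const)).add continuous_const)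

/-- A family of maps of cubes, each of which is `G`, rescaled, on a concentric subcube, and given by
`H` on the radial segments outside this subcube. -/
noncomputable def cubeRing {A : Type u} {X : Type v} (c : A → ℝ)
    (G : A × (Fin l → unitInterval) → X) (H : A × ℝ → X) (z : A × (Fin l → unitInterval)) : X :=
  if c z.1 * cubeRadius z.2 ≤ 1 then G (z.1, cubeScale (c z.1) z.2)
  else H (z.1, 2 - c z.1 * cubeRadius z.2)

/-- On the interface the dilated point lies on the boundary of the cube and the radial parameter is
`2 - 1 = 1`, so `hGH` makes the two formulas agree. -/
theorem continuous_cubeRing {A : Type u} [TopologicalSpace A] {X : Type v} [TopologicalSpace X]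
    {c : A → ℝ} (hc : Continuous c) {G : A × (Fin l → unitInterval) → X} (hG : Continuous G)
    {H : A × ℝ → X} (hH : Continuous H)
    (hGH : ∀ z, ∀ t ∈ Cube.boundary (Fin l), G (z, t) = H (z, 1)) :
    Continuous (cubeRing c G H) := by
  have hr : Continuous fun z : A × (Fin l → unitInterval) => c z.1 * cubeRadius z.2 :=
    (hc.comp continuous_fst).mul ((continuous_cubeRadius l).comp continuous_snd)
  refine Continuous.if_le (hG.comp (continuous_fst.prodMk
    (continuous_cubeScale (hc.comp continuous_fst) continuous_snd)))
    (hH.comp (continuous_fst.prodMk (continuous_const.sub hr))) hr continuous_const fun z hz => ?_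
  rw [hGH _ _ (cubeScale_mem_boundary hz), hz]
  norm_num

variable {X : Type u} [TopologicalSpace X] {Y : Type v} [TopologicalSpace Y]

theorem cubeAlong_apply {x y : X} (a : Path x y) (f : GenLoop (Fin l) X y)
    (t : Fin l → unitInterval) : cubeAlong a f t = if 2 * cubeRadius t ≤ 1
      then f (cubeScale 2 t) else a.extend (2 - 2 * cubeRadius t) := by
  change (if _ then _ else _) = _
  have h₁ : cubeRadius t ≤ 1 / 2 ↔ 2 * cubeRadius t ≤ 1 := by
    constructor <;> intro h <;> linarith
  have h₂ : (fun i => Set.projIcc 0 1 zero_le_one (2 * (t i : ℝ) - 1 / 2)) = cubeScale 2 t := by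
    funext i
    rw [cubeScale]
    congr 1
    ring
  simp only [h₁, h₂]

/-- A homotopy of maps of cubes during which the boundary moves along the path `a`. -/
def CubeHomotopicAlong {x y : X} (a : Path x y) (f g : C(Fin l → unitInterval, X)) : Prop :=
  ∃ F : C(unitInterval × (Fin l → unitInterval), X), (∀ t, F (0, t) = f t) ∧ (∀ t, F (1, t) = g t) ∧
    ∀ s, ∀ t ∈ Cube.boundary (Fin l), F (s, t) = a s

namespace CubeHomotopicAlong

theorem refl {x : X} (f : GenLoop (Fin l) X x) :
    CubeHomotopicAlong (Path.refl x) f.1 f.1 :=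
  ⟨f.1.comp ⟨Prod.snd, continuous_snd⟩, fun _ => rfl, fun _ => rfl, fun _ t ht => f.2 t ht⟩

theorem trans {x y y' z : X} {a : Path x y} {b : Path y' z} {f g k : C(Fin l → unitInterval, X)}
    (h₁ : CubeHomotopicAlong a f g) (h₂ : CubeHomotopicAlong b g k) (h : y = y') :
    CubeHomotopicAlong (a.htrans b h) f k := by
  subst h
  obtain ⟨F, F0, F1, Fb⟩ := h₁
  obtain ⟨F', F0', F1', Fb'⟩ := h₂
  let H : ContinuousMap.Homotopy f g := ⟨F, F0, F1⟩
  let H' : ContinuousMap.Homotopy g k := ⟨F', F0', F1'⟩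
  refine ⟨(H.trans H').toContinuousMap, (H.trans H').apply_zero, (H.trans H').apply_one,
    fun s t ht => ?_⟩
  change H.trans H' (s, t) = (a.trans b) s
  rw [ContinuousMap.Homotopy.trans_apply, Path.trans_apply]
  dsimp only
  split_ifs
  · exact Fb _ t ht
  · exact Fb' _ t ht

theorem symm {x y : X} {a : Path x y} {f g : C(Fin l → unitInterval, X)}
    (h : CubeHomotopicAlong a f g) : CubeHomotopicAlong a.symm g f := by
  obtain ⟨F, F0, F1, Fb⟩ := h
  let H : ContinuousMap.Homotopy f g := ⟨F, F0, F1⟩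
  exact ⟨H.symm.toContinuousMap, H.symm.apply_zero, H.symm.apply_one, fun s t ht => Fb _ t ht⟩

theorem map {x y : X} {a : Path x y} {f g : C(Fin l → unitInterval, X)}
    (h : CubeHomotopicAlong a f g) (φ : C(X, Y)) :
    CubeHomotopicAlong (a.map φ.continuous) (φ.comp f) (φ.comp g) := by
  obtain ⟨F, F0, F1, Fb⟩ := h
  exact ⟨φ.comp F, fun t => congrArg φ (F0 t), fun t => congrArg φ (F1 t),
    fun s t ht => congrArg φ (Fb s t ht)⟩

theorem congr_path {x y x' y' : X} {a : Path x y} {b : Path x' y'}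
    {f g : C(Fin l → unitInterval, X)} (h : CubeHomotopicAlong a f g) (hab : ∀ t, a t = b t) :
    CubeHomotopicAlong b f g := by
  obtain ⟨F, F0, F1, Fb⟩ := h
  exact ⟨F, F0, F1, fun s t ht => (Fb s t ht).trans (hab s)⟩

theorem cubeAlong {x y : X} (a : Path x y) (g : GenLoop (Fin l) X y) :
    CubeHomotopicAlong a (cubeAlong a g).1 g.1 := by
  -- At time `s` the inner cube has side `1 / (2 - s)`, and the ring runs through `a` from time `s`
  -- at the boundary to time `1`. Thus the ring disappears at `s = 1` while the boundary follows
  -- `a`.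
  refine ⟨⟨cubeRing (fun s : unitInterval => 2 - (s : ℝ)) (fun z => g z.2) (fun z => a.extend z.2),
    continuous_cubeRing (by fun_prop) (g.1.continuous.comp continuous_snd)
    (a.continuous_extend.comp continuous_snd) fun z t ht => ?_⟩, fun t => ?_, fun t => ?_,
    fun s t ht => ?_⟩
  · exact (g.2 t ht).trans a.extend_one.symm
  · refine Eq.trans ?_ (cubeAlong_apply a g t).symm
    simp [cubeRing]
  · have h : (2 - ((1 : unitInterval) : ℝ)) = 1 := by norm_num
    simp only [ContinuousMap.coe_mk, cubeRing, h]
    rw [if_pos ((one_mul _).trans_le (cubeRadius_le_one t)), cubeScale_one]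
    rfl
  · simp only [ContinuousMap.coe_mk, cubeRing, cubeRadius_eq_one ht, mul_one]
    split_ifs with hs
    · have h1 : (s : ℝ) = 1 := le_antisymm s.2.2 (by linarith)
      have h2 : s = 1 := Subtype.ext h1
      have h3 : (2 - (s : ℝ)) = 1 := by rw [h1]; norm_num
      rw [h3, cubeScale_one, GenLoop.boundary g t ht, h2, a.target]
    · rw [sub_sub_cancel]
      exact a.extend_apply s.2

/-- A free homotopy becomes one relative to the boundary in two stages: `hL` shrinks `f` to the
half-size cube, with a constant ring; then `hK` performs `F` in the inner cube while the ring
stretches along the part of `a` already traversed. -/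
theorem homotopic_cubeAlong {x y : X} {a : Path x y} {f : GenLoop (Fin l) X x}
    {g : GenLoop (Fin l) X y} (h : CubeHomotopicAlong a f.1 g.1) :
    GenLoop.Homotopic f (_root_.cubeAlong a g) := by
  obtain ⟨F, F0, F1, Fb⟩ := h
  -- At time `s` the ring follows `a` from `a 0`, on the outer boundary, to `a s`, which is the
  -- value of `F` on the boundary of the inner cube.
  have hKc : Continuous (cubeRing (fun _ : unitInterval => (2 : ℝ)) F
      (fun z => a.extend ((z.1 : ℝ) * z.2))) :=
    continuous_cubeRing continuous_const F.continuous (a.continuous_extend.comp (by fun_prop))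
      fun z t ht => by rw [mul_one, Fb z t ht]; exact (a.extend_apply z.2).symm
  have hLc : Continuous (cubeRing (fun s : unitInterval => 1 + (s : ℝ)) (fun z => f z.2)
      (fun _ => x)) :=
    continuous_cubeRing (by fun_prop) (f.1.continuous.comp continuous_snd) continuous_const
      fun z t ht => f.2 t ht
  have hone : (1 + ((0 : unitInterval) : ℝ)) = 1 := by norm_num
  have htwo : (1 + ((1 : unitInterval) : ℝ)) = 2 := by norm_num
  let f' : C(Fin l → unitInterval, X) := ⟨fun t => cubeRing (fun s : unitInterval => 1 + (s : ℝ))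
    (fun z => f z.2) (fun _ => x) (1, t), hLc.comp (continuous_const.prodMk continuous_id)⟩
  have hL : f.1.HomotopicRel f' (Cube.boundary (Fin l)) := by
    refine ⟨⟨⟨⟨_, hLc⟩, fun t => ?_, fun t => rfl⟩, fun s t ht => ?_⟩⟩
    · simp only [cubeRing, hone]
      rw [if_pos ((one_mul _).trans_le (cubeRadius_le_one t)), cubeScale_one]
      rfl
    · refine Eq.trans ?_ (f.2 t ht).symm
      simp only [ContinuousMap.coe_mk, cubeRing, cubeRadius_eq_one ht, mul_one]
      split_ifs with hs
      · have h1 : (1 + (s : ℝ)) = 1 := le_antisymm hs (by linarith [s.2.1])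
        rw [h1, cubeScale_one]
        exact f.2 t ht
      · rfl
  have hK : f'.HomotopicRel (_root_.cubeAlong a g).1 (Cube.boundary (Fin l)) := by
    refine ⟨⟨⟨⟨_, hKc⟩, fun t => ?_, fun t => ?_⟩, fun s t ht => ?_⟩⟩
    · simp only [cubeRing, f', ContinuousMap.coe_mk, htwo, F0]
      split_ifs
      · rfl
      · simp
    · refine Eq.trans ?_ (cubeAlong_apply a g t).symm
      simp only [cubeRing, F1]
      split_ifs
      · rfl
      · simp
    · simp only [cubeRing, f', ContinuousMap.coe_mk, htwo, cubeRadius_eq_one ht]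
      norm_num
  exact hL.trans hK

end CubeHomotopicAlong

theorem cubeAlong_congr {x y : X} {a b : Path x y} (hab : a.Homotopic b)
    {f g : GenLoop (Fin l) X y} (hfg : f.1.HomotopicRel g.1 (Cube.boundary (Fin l))) :
    GenLoop.Homotopic (cubeAlong a f) (cubeAlong b g) := by
  obtain ⟨H⟩ := hab
  obtain ⟨F⟩ := hfg
  refine ⟨⟨⟨⟨cubeRing (fun _ : unitInterval => (2 : ℝ)) F
    (fun z => H (z.1, Set.projIcc 0 1 zero_le_one z.2)), continuous_cubeRing continuous_const
    F.continuous (H.continuous.comp (continuous_fst.prodMk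
      (continuous_projIcc.comp continuous_snd))) fun z t ht => ?_⟩, fun t => ?_, fun t => ?_⟩,
      fun s t ht => ?_⟩⟩
  · rw [F.eq_fst z ht, Set.projIcc_right]
    exact (f.2 t ht).trans (H.target z).symm
  · refine Eq.trans ?_ (cubeAlong_apply a f t).symm
    simp only [cubeRing]
    rw [F.apply_zero, H.apply_zero]
    rfl
  · refine Eq.trans ?_ (cubeAlong_apply b g t).symm
    simp only [cubeRing]
    rw [F.apply_one, H.apply_one]
    rfl
  · refine Eq.trans ?_ ((cubeAlong a f).2 t ht).symm
    simp only [ContinuousMap.coe_mk, cubeRing, cubeRadius_eq_one ht]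
    norm_num

/-- Both initial maps are homotopic to their end maps transported back along the paths, and this
transport respects homotopies of both. Later identities between cubes thereby reduce to homotopies
of paths, without formulas. -/
theorem CubeHomotopicAlong.unique {x y x' y' : X} {a : Path x y} {b : Path x' y'}
    {f g f' g' : C(Fin l → unitInterval, X)} (h : CubeHomotopicAlong a f g)
    (h' : CubeHomotopicAlong b f' g') (hab : a.HHomotopic b)
    (hg : g.HomotopicRel g' (Cube.boundary (Fin l))) :
    f.HomotopicRel f' (Cube.boundary (Fin l)) := by
  obtain rfl := hab.source_eq
  obtain rfl := hab.target_eq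
  -- The prescribed motion of the boundary makes the initial and final maps based loops at the end
  -- points of the path.
  have hb : ∀ {a : Path x y} {f g : C(Fin l → unitInterval, X)}, CubeHomotopicAlong a f g →
      (∀ t ∈ Cube.boundary (Fin l), f t = x) ∧ ∀ t ∈ Cube.boundary (Fin l), g t = y := by
    rintro a f g ⟨F, F0, F1, Fb⟩
    exact ⟨fun t ht => (F0 t).symm.trans ((Fb 0 t ht).trans a.source),
      fun t ht => (F1 t).symm.trans ((Fb 1 t ht).trans a.target)⟩
  have e₁ := CubeHomotopicAlong.homotopic_cubeAlong (f := ⟨f, (hb h).1⟩) (g := ⟨g, (hb h).2⟩) h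
  have e₂ := CubeHomotopicAlong.homotopic_cubeAlong (f := ⟨f', (hb h').1⟩) (g := ⟨g', (hb h').2⟩) h'
  exact (e₁.trans (cubeAlong_congr hab hg)).trans e₂.symm

theorem cubeClass_eq_cubeClass {x : X} {f g : GenLoop (Fin l) X x} :
    cubeClass f = cubeClass g ↔ f.1.HomotopicRel g.1 (Cube.boundary (Fin l)) :=
  Quotient.eq

theorem cubeClass_surjective {x : X} :
    Function.Surjective (cubeClass : GenLoop (Fin l) X x → HomotopyGroup.Pi l X x) :=
  Quotient.mk_surjective

/-- The action of the fundamental group on a higher homotopy group. -/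
noncomputable abbrev cubeAction (l : ℕ) (x : X) :
    MulAction (LoopGroup X x) (HomotopyGroup.Pi l X x) where
  smul a := Quotient.map₂ (sa := Path.Homotopic.setoid x x) (fun a f => cubeAlong a f)
    (fun _ _ hab _ _ hfg => cubeAlong_congr hab hfg) a.unop
  one_smul f := by
    obtain ⟨f, rfl⟩ := cubeClass_surjective f
    exact cubeClass_eq_cubeClass.2 ((CubeHomotopicAlong.cubeAlong (Path.refl x) f).unique
      (CubeHomotopicAlong.refl f) (.refl _) (.refl _))
  mul_smul a b f := by
    obtain ⟨a, rfl⟩ := LoopGroup.mk_surjective a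
    obtain ⟨b, rfl⟩ := LoopGroup.mk_surjective b
    obtain ⟨f, rfl⟩ := cubeClass_surjective f
    exact cubeClass_eq_cubeClass.2 ((CubeHomotopicAlong.cubeAlong (a.trans b) f).unique
      ((CubeHomotopicAlong.cubeAlong a _).trans (CubeHomotopicAlong.cubeAlong b f) rfl) (.refl _)
      (.refl _))

theorem cubeAction_smul {x : X} (a : Path x x) (f : GenLoop (Fin l) X x) :
    (cubeAction l x).smul (LoopGroup.mk a) (cubeClass f) = cubeClass (cubeAlong a f) :=
  rfl

end Cube

/-! ## Lifts of maps of cubes to covering spaces -/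

section CubeLift

variable {X : Type u} [TopologicalSpace X] {Y : Type v} [TopologicalSpace Y] {l : ℕ}

theorem cubeClass_cubeMap_congr (p : C(X, Y)) {x : X} {f g : GenLoop (Fin l) X x}
    (h : f.1.HomotopicRel g.1 (Cube.boundary (Fin l))) :
    cubeClass (cubeMap p f) = cubeClass (cubeMap p g) :=
  cubeClass_eq_cubeClass.2 (h.comp_continuousMap p)

/-- Homotopy lifting relative to the boundary. For `l > 0` the boundary is nonempty and provides a
point where the two lifts agree. -/
theorem cubeClass_cubeMap_eq_iff {p : C(X, Y)} (hp : IsCoveringMap p) (hl : 0 < l) {x : X}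
    {f g : GenLoop (Fin l) X x} : cubeClass (cubeMap p f) = cubeClass (cubeMap p g) ↔
      f.1.HomotopicRel g.1 (Cube.boundary (Fin l)) := by
  have h0 : (0 : Fin l → unitInterval) ∈ Cube.boundary (Fin l) := ⟨⟨0, hl⟩, Or.inl rfl⟩
  exact cubeClass_eq_cubeClass.trans
    (hp.homotopicRel_iff_comp ⟨0, h0, (f.2 0 h0).trans (g.2 0 h0).symm⟩).symm

theorem isPreconnected_face (i : Fin l) (c : unitInterval) :
    IsPreconnected {t : Fin l → unitInterval | t i = c} := by
  have : {t : Fin l → unitInterval | t i = c} =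
      Set.univ.pi (fun j => if j = i then {c} else Set.univ) := by
    ext t
    simp only [Set.mem_ofPred_eq, Set.mem_univ_pi]
    constructor
    · rintro rfl j
      split_ifs with h
      · rw [h]
        rfl
      · trivial
    · intro h
      simpa using h i
  rw [this]
  refine isPreconnected_univ_pi fun j => ?_
  split_ifs
  · exact isPreconnected_singleton
  · exact isPreconnected_univ

/-- A lift exists by contracting the cube to a corner. It is constant on each face, since a face is
connected and its image in the base is a point; for `l > 1` the faces are linked to each other, so
these constants agree. -/
theorem exists_cubeMap_eq {p : C(X, Y)} (hp : IsCoveringMap p) (hl : 1 < l) {x : X}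
    (f : GenLoop (Fin l) Y (p x)) : ∃ g : GenLoop (Fin l) X x, cubeMap p g = f := by
  have h0 : (0 : Fin l → unitInterval) ∈ Cube.boundary (Fin l) :=
    ⟨⟨0, by omega⟩, Or.inl rfl⟩
  -- The contraction to the corner `0`: the homotopy starts at the constant map, which lifts to `x`,
  -- and ends at `f`.
  let H : C(unitInterval × (Fin l → unitInterval), Y) :=
    ⟨fun z => f (fun i => z.1 * z.2 i), f.1.continuous.comp (by fun_prop)⟩
  have H0 : ∀ t, H (0, t) = p (ContinuousMap.const (Fin l → unitInterval) x t) := fun t => by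
    refine Eq.trans (congrArg f ?_) (f.2 0 h0)
    funext i
    exact zero_mul _
  let F := hp.liftHomotopy H (ContinuousMap.const _ x) H0
  have hF : ∀ s t, p (F (s, t)) = H (s, t) := fun s t => congrFun (hp.liftHomotopy_lifts H _ H0) _
  let g : C(Fin l → unitInterval, X) := F.comp ⟨fun t => (1, t), by fun_prop⟩
  have hg : ∀ t, p (g t) = f t := fun t => (hF 1 t).trans (congrArg f (funext fun i => one_mul _))
  -- The corner is fixed by the contraction, so its track lifts a constant path.
  have hg0 : g 0 = x := by
    have h := hp.const_of_comp (g := fun s => F (s, 0)) (by fun_prop) (fun s s' => by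
      rw [hF, hF]
      refine congrArg f (funext fun i => ?_)
      exact (mul_zero _).trans (mul_zero _).symm) 1 0
    exact h.trans (hp.liftHomotopy_zero H _ H0 0)
  have hface : ∀ (i : Fin l) (c : unitInterval), c = 0 ∨ c = 1 → ∀ t t' : Fin l → unitInterval,
      t i = c → t' i = c → g t = g t' := by
    intro i c hc t t' ht ht'
    refine hp.constOn_of_comp (isPreconnected_face i c) g.continuous.continuousOn ?_ ht ht'
    intro a ha b hb
    have hf : ∀ a : Fin l → unitInterval, a i = c → p (g a) = p x := fun a ha =>
      (hg a).trans (f.2 a ⟨i, by rwa [ha]⟩)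
    exact (hf a ha).trans (hf b hb).symm
  refine ⟨⟨g, fun t ht => ?_⟩, GenLoop.ext _ _ hg⟩
  obtain ⟨i, hi⟩ := ht
  have : Nontrivial (Fin l) := Fin.nontrivial_iff_two_le.2 hl
  -- With a second coordinate `j`, one moves within the face of `t` to a point with `j`-th
  -- coordinate `0`, and from there within the face `t j = 0` to the corner.
  obtain ⟨j, hj⟩ := exists_ne i
  rw [← hg0, hface i (t i) hi t (Function.update t j 0) rfl (Function.update_of_ne hj.symm _ _)]
  exact hface j 0 (Or.inl rfl) _ _ (Function.update_self _ _ _) rfl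

end CubeLift

theorem CubeHomotopicAlong.mapγ {D : ℕ → Type u} [∀ n, TopologicalSpace (D n)]
    (O : TopOperadStr D) {k n l : ℕ} (m : Fin k → ℕ) (h : ∑ i, m i = n) {x y : D k}
    {x' y' : ∀ i, D (m i)} {a : Path x y} {b : ∀ i, Path (x' i) (y' i)}
    {f f₁ : C(Fin l → unitInterval, D k)} {g g₁ : ∀ i, C(Fin l → unitInterval, D (m i))}
    (hf : CubeHomotopicAlong a f f₁) (hg : ∀ i, CubeHomotopicAlong (b i) (g i) (g₁ i)) :
    CubeHomotopicAlong (O.pathγ m h a b) (O.mapγ m h f g) (O.mapγ m h f₁ g₁) := by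
  obtain ⟨F, F0, F1, Fb⟩ := hf
  choose G G0 G1 Gb using hg
  refine ⟨O.mapγ m h F G, fun t => ?_, fun t => ?_, fun s t ht => ?_⟩
  · change O.γ m h (F (0, t)) (fun i => G i (0, t)) = O.γ m h (f t) (fun i => g i t)
    rw [F0, funext fun i => G0 i t]
  · change O.γ m h (F (1, t)) (fun i => G i (1, t)) = O.γ m h (f₁ t) (fun i => g₁ i t)
    rw [F1, funext fun i => G1 i t]
  · change O.γ m h (F (s, t)) (fun i => G i (s, t)) = O.γ m h (a s) (fun i => b i s)
    rw [Fb s t ht, funext fun i => Gb i s t ht]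

/-! ## The operad of higher homotopy groups -/

namespace GoodBasepoint

open Path

variable {D : ℕ → Type u} [∀ n, TopologicalSpace (D n)] {O : TopOperadStr D} (η : GoodBasepoint O)
  {Q : ℕ → Type u} [∀ n, TopologicalSpace (Q n)] (p : ∀ n, C(D n, Q n))

/-- The composition of `l`-dimensional loops at the basepoints. -/
noncomputable def basedCubeγ {k n l : ℕ} (m : Fin k → ℕ) (h : ∑ i, m i = n)
    (f : GenLoop (Fin l) (D k) (η.pt k)) (g : ∀ i, GenLoop (Fin l) (D (m i)) (η.pt (m i))) :
    GenLoop (Fin l) (D n) (η.pt n) :=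
  cubeAlong (η.linear m h) (O.cubeγ m h f g)

theorem basedCubeγ_along {k n l : ℕ} (m : Fin k → ℕ) (h : ∑ i, m i = n)
    (f : GenLoop (Fin l) (D k) (η.pt k)) (g : ∀ i, GenLoop (Fin l) (D (m i)) (η.pt (m i))) :
    CubeHomotopicAlong (η.linear m h) (η.basedCubeγ m h f g).1
      (O.mapγ m h f.1 (fun i => (g i).1)) :=
  CubeHomotopicAlong.cubeAlong (η.linear m h) (O.cubeγ m h f g)

variable (hc : ∀ n, IsCoveringMap (p n)) {l : ℕ} (hl : 1 < l)

include hc hl in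
theorem exists_cubeClass {n : ℕ} (x : HomotopyGroup.Pi l (Q n) (p n (η.pt n))) :
    ∃ f : GenLoop (Fin l) (D n) (η.pt n), cubeClass (cubeMap (p n) f) = x := by
  obtain ⟨f, rfl⟩ := cubeClass_surjective x
  obtain ⟨g, rfl⟩ := exists_cubeMap_eq (hc n) hl f
  exact ⟨g, rfl⟩

include hc hl in
theorem exists_cubeClass_family {k : ℕ} {m : Fin k → ℕ}
    (b : ∀ i, HomotopyGroup.Pi l (Q (m i)) (p (m i) (η.pt (m i)))) :
    ∃ g : ∀ i, GenLoop (Fin l) (D (m i)) (η.pt (m i)),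
      b = fun i => cubeClass (cubeMap (p (m i)) (g i)) := by
  choose g hg using fun i => η.exists_cubeClass p hc hl (b i)
  exact ⟨g, funext fun i => (hg i).symm⟩

/-- The composition on higher homotopy groups of quotients. -/
noncomputable def higherγ {k n : ℕ} (m : Fin k → ℕ) (h : ∑ i, m i = n)
    (a : HomotopyGroup.Pi l (Q k) (p k (η.pt k)))
    (b : ∀ i, HomotopyGroup.Pi l (Q (m i)) (p (m i) (η.pt (m i)))) :
    HomotopyGroup.Pi l (Q n) (p n (η.pt n)) :=
  cubeClass (cubeMap (p n) (η.basedCubeγ m h (η.exists_cubeClass p hc hl a).choose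
    (fun i => (η.exists_cubeClass p hc hl (b i)).choose)))

/-- Lifts of the same class are homotopic relative to the boundary, so the chosen ones can be
replaced by any others. -/
theorem higherγ_cubeClass {k n : ℕ} (m : Fin k → ℕ) (h : ∑ i, m i = n)
    (f : GenLoop (Fin l) (D k) (η.pt k)) (g : ∀ i, GenLoop (Fin l) (D (m i)) (η.pt (m i))) :
    η.higherγ p hc hl m h (cubeClass (cubeMap (p k) f)) (fun i => cubeClass (cubeMap (p (m i)) (g i)))
      = cubeClass (cubeMap (p n) (η.basedCubeγ m h f g)) := by
  have hl' : 0 < l := by omega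
  refine cubeClass_cubeMap_congr _ (cubeAlong_congr (.refl _) (O.mapγ_homotopicRel m h
    ((cubeClass_cubeMap_eq_iff (hc k) hl').1 (η.exists_cubeClass p hc hl _).choose_spec)
    fun i => (cubeClass_cubeMap_eq_iff (hc (m i)) hl').1
      (η.exists_cubeClass p hc hl _).choose_spec))

/-- The operad of the higher homotopy groups of quotients of a topological operad. -/
noncomputable def higherOperad : OperadStr (fun n => HomotopyGroup.Pi l (Q n) (p n (η.pt n))) where
  zero_point := by
    obtain ⟨hD⟩ := O.zero_point
    refine ⟨⟨⟨cubeClass GenLoop.const⟩, fun x => ?_⟩⟩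
    obtain ⟨f, rfl⟩ := η.exists_cubeClass p hc hl x
    exact congrArg cubeClass (GenLoop.ext _ _ fun t => congrArg (p 0) (Subsingleton.elim _ _))
  one := cubeClass GenLoop.const
  γ := η.higherγ p hc hl
  one_γ {n} h a := by
    obtain ⟨g, rfl⟩ := η.exists_cubeClass p hc hl a
    refine (η.higherγ_cubeClass p hc hl _ h GenLoop.const (fun _ => g)).trans
      (cubeClass_cubeMap_congr _ ((η.basedCubeγ_along _ h _ _).unique (.refl g)
        (η.linear_one_left h) ?_))
    have e : O.mapγ (fun _ : Fin 1 => n) h (GenLoop.const (x := η.pt 1)).1 (fun _ => g.1) = g.1 :=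
      ContinuousMap.ext fun t => (congrArg (fun e => O.γ (fun _ : Fin 1 => n) h e (fun _ => g t))
        η.one_pt.symm).trans (O.one_γ h _)
    rw [e]
    exact .refl _
  γ_one {n} h a := by
    obtain ⟨f, rfl⟩ := η.exists_cubeClass p hc hl a
    refine (η.higherγ_cubeClass p hc hl _ h f (fun _ => GenLoop.const)).trans
      (cubeClass_cubeMap_congr _ ((η.basedCubeγ_along _ h _ _).unique (.refl f)
        (η.linear_one_right h) ?_))
    have e : O.mapγ (fun _ : Fin n => 1) h f.1 (fun _ => (GenLoop.const (x := η.pt 1)).1) = f.1 :=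
      ContinuousMap.ext fun t => (congrArg (fun e => O.γ (fun _ : Fin n => 1) h (f t) (fun _ => e))
        η.one_pt.symm).trans (O.γ_one h _)
    rw [e]
    exact .refl _
  assoc m hm r hr q hq hN a b c := by
    obtain ⟨f, rfl⟩ := η.exists_cubeClass p hc hl a
    obtain ⟨g, rfl⟩ := η.exists_cubeClass_family p hc hl b
    obtain ⟨k, rfl⟩ := η.exists_cubeClass_family p hc hl c
    simp only [η.higherγ_cubeClass p hc hl]
    -- Both composites are freely homotopic to the pointwise triple composition; the boundaries move
    -- along the two paths which `linear_assoc` compares.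
    refine cubeClass_cubeMap_congr _ (((η.basedCubeγ_along r hr _ _).trans
      (.mapγ O r hr (η.basedCubeγ_along m hm f g) (fun x => .refl (k x))) rfl).unique
      ((η.basedCubeγ_along q hN _ _).trans (.mapγ O q hN (.refl f)
        (fun i => η.basedCubeγ_along _ (hq i) (g i) (fun j => k (blockIndex m hm ⟨i, j⟩)))) rfl)
      (η.linear_assoc m hm r hr q _ (fun _ _ => rfl) hq hN rfl rfl) ?_)
    rw [O.mapγ_assoc m hm r hr q hq hN]
    exact .refl _

theorem isHigherOperad_higherOperad :
    η.IsHigherOperad p l (η.higherOperad p hc hl) :=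
  ⟨rfl, η.higherγ_cubeClass p hc hl⟩

/-! ### The action of the fundamental groups on the higher homotopy operad -/

variable {K : ℕ → Type v} [∀ n, Group (K n)] {P : GroupOperad K} [∀ n, MulAction (K n) (D n)]
  [∀ n, ContinuousConstSMul (K n) (D n)]
  (hp : ∀ (n : ℕ) (σ : K n) (x : D n), p n (σ • x) = p n x)

/-- The translate of a map by a group element. -/
def smulMap {n : ℕ} {A : Type w} [TopologicalSpace A] (σ : K n) (f : C(A, D n)) : C(A, D n) :=
  ⟨fun t => σ • f t, f.continuous.const_smul σ⟩

/-- Computes the action upstairs: `f` and its translate `σ • f` have the same image in the quotient,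
so a free homotopy along the lift `a` projects to one along the loop. -/
theorem liftClass_smul_cubeClass {n : ℕ} {σ : K n} {a : Path (η.pt n) (σ • η.pt n)}
    {f g : GenLoop (Fin l) (D n) (η.pt n)} (h : CubeHomotopicAlong a g.1 (smulMap σ f.1)) :
    (cubeAction l (p n (η.pt n))).smul (η.liftClass p hp σ a) (cubeClass (cubeMap (p n) f)) =
      cubeClass (cubeMap (p n) g) := by
  refine (cubeAction_smul _ _).trans (cubeClass_eq_cubeClass.2
    ((CubeHomotopicAlong.cubeAlong _ _).unique (h.map (p n)) (.of_eq fun _ => rfl) ?_))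
  rw [show (p n).comp (smulMap σ f.1) = (cubeMap (p n) f).1 from
    ContinuousMap.ext fun t => hp n σ (f t)]
  exact .refl _

omit [∀ (n : ℕ), TopologicalSpace (Q n)] in
theorem exists_smul_lift {n : ℕ} {σ : K n} (a : Path (η.pt n) (σ • η.pt n))
    (f : GenLoop (Fin l) (D n) (η.pt n)) :
    ∃ g : GenLoop (Fin l) (D n) (η.pt n), CubeHomotopicAlong a g.1 (smulMap σ f.1) :=
  ⟨_, CubeHomotopicAlong.cubeAlong a (cubeMap ⟨fun x => σ • x, continuous_const_smul σ⟩ f)⟩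

variable (hq : ∀ n, IsQuotientCoveringMap (p n) (K n)) (hact : IsOperadAction P O.toOperadStr)

theorem isOperadAction_higherOperad : IsOperadAction (η.quotientLoopOperad p hp hq hact)
    (η.higherOperad p hc hl) (act := fun n => cubeAction l (p n (η.pt n))) := by
  intro k n m h α β x y
  obtain ⟨σ, a, rfl⟩ := η.exists_liftClass p hp hq α
  obtain ⟨τ, b, rfl⟩ := η.exists_liftClass_family p hp hq β
  obtain ⟨f, rfl⟩ := η.exists_cubeClass p hc hl x
  obtain ⟨g, rfl⟩ := η.exists_cubeClass_family p hc hl y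
  have hs : (η.quotientLoopOperad p hp hq hact).perm (η.liftClass p hp σ a) = P.perm σ :=
    congrArg P.perm (η.degree_liftClass p hp hq σ a)
  obtain ⟨f', hf'⟩ := η.exists_smul_lift a f
  choose g' hg' using fun i => η.exists_smul_lift (b i) (g i)
  change η.higherγ p hc hl m h ((cubeAction l (p k (η.pt k))).smul (η.liftClass p hp σ a) _)
    (fun i => (cubeAction l (p (m i) (η.pt (m i)))).smul (η.liftClass p hp (τ i) (b i))
      (cubeClass (cubeMap (p (m i)) (g i)))) = (cubeAction l (p n (η.pt n))).smul
        (η.loopγ p hp hq hact m h (η.liftClass p hp σ a) (fun i => η.liftClass p hp (τ i) (b i))) _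
  refine (congrArg₂ (η.higherγ p hc hl m h) (η.liftClass_smul_cubeClass p hp hf')
    (funext fun i => η.liftClass_smul_cubeClass p hp (hg' i))).trans ?_
  rw [η.higherγ_cubeClass p hc hl, η.loopγ_liftClass p hp hq hact]
  refine Eq.trans ?_ (congrArg ((cubeAction l (p n (η.pt n))).smul _)
    (((η.higherOperad p hc hl).γ_perm_congr m hs _ (P.sum_perm h σ) _
      (fun i => cubeClass (cubeMap (p (m i)) (g i)))).trans
      (η.higherγ_cubeClass p hc hl _ (P.sum_perm h σ) f (fun i => g ((P.perm σ).symm i))))).symm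
  -- It remains to move the composite of the transported loops to the translate by `γ (σ; τ)` of the
  -- based composite, along the path `liftγ`.
  refine (η.liftClass_smul_cubeClass p hp ?_).symm
  have e₁ := (η.basedCubeγ_along m h f' g').trans (.mapγ O m h hf' hg') rfl
  have e₂ := (η.basedCubeγ_along _ (P.sum_perm h σ) f (fun i => g ((P.perm σ).symm i))).symm.map
    ⟨fun x => P.γ m h σ τ • x, continuous_const_smul _⟩
  have e : O.mapγ m h (smulMap σ f.1) (fun i => smulMap (τ i) (g i).1) =
      smulMap (P.γ m h σ τ) (O.mapγ _ (P.sum_perm h σ) f.1 (fun i => (g ((P.perm σ).symm i)).1)) :=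
    ContinuousMap.ext fun t => hact m h σ τ (f t) (fun i => g i t)
  rw [e] at e₁
  -- The boundary follows the linear path, then the composite of the lifts `a` and `b i`, then a
  -- translated inverse linear path: these are the three pieces of `liftγ`.
  exact (e₁.trans e₂ (hact m h σ τ (η.pt k) (fun i => η.pt (m i)))).congr_path fun _ => rfl

end GoodBasepoint

/-! ### The main theorem -/

theorem mainTheorem9 {G : ℕ → Type v} [∀ n, Group (G n)] (P : GroupOperad G)
    (H : SubGroupOperad P) [∀ n, (H.carrier n).Normal] (hH : H.NonCrossed)
    {C : ℕ → Type u} [∀ n, TopologicalSpace (C n)] (O : TopOperadStr C)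
    [∀ n, MulAction (G n) (C n)] [∀ n, ContinuousConstSMul (G n) (C n)]
    (hact : IsOperadAction P O.toOperadStr)
    (hpath : ∀ n, PathConnectedSpace (OrbitSpace (H.carrier n) (C n)))
    (hcov : ∀ n, IsCoveringAction (G n ⧸ H.carrier n) (OrbitSpace (H.carrier n) (C n)))
    (η : GoodBasepoint (H.quotientOperad hH hact)) :
    ∃ (A : GroupOperad fun n => LoopGroup (OrbitSpace (H.carrier n) (C n)) (η.pt n))
      (B : GroupOperad fun n =>
        LoopGroup (OrbitSpace (G n) (C n)) (OrbitSpace.proj (H.carrier n) (η.pt n))),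
      -- `π₁ (C / H)` is a non-crossed group operad
      (η.IsLoopOperad A ∧ A.NonCrossed) ∧
      -- `π₁ (C / G)` is a group operad
      η.IsQuotientLoopOperad (H.isOperadAction_quotient hH hact)
        (fun n => OrbitSpace.proj (H.carrier n)) (fun n => OrbitSpace.proj_smul (H.carrier n)) B ∧
      -- `π₁ (C / G) = π₁ ((C / H) / (G / H))`
      (∃ (B' : GroupOperad fun n =>
          LoopGroup (OrbitSpace (G n ⧸ H.carrier n) (OrbitSpace (H.carrier n) (C n)))
            (OrbitSpace.mk (G n ⧸ H.carrier n) (η.pt n)))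
          (Φ : GroupOperadHom B' B),
        η.IsQuotientLoopOperad (H.isOperadAction_quotient hH hact)
          (fun n => ⟨OrbitSpace.mk (G n ⧸ H.carrier n), OrbitSpace.continuous_mk⟩)
          (fun n σ x => OrbitSpace.mk_eq_mk.2 ⟨σ, rfl⟩) B' ∧
        ∀ n, IsHomeomorph (OrbitSpace.iterated (H.carrier n) (X := C n)) ∧
          (∀ f : Path (OrbitSpace.mk (G n ⧸ H.carrier n) (η.pt n))
              (OrbitSpace.mk (G n ⧸ H.carrier n) (η.pt n)),
            Φ.toHom n (LoopGroup.mk f) =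
              LoopGroup.mk (f.map (OrbitSpace.iterated (H.carrier n)).continuous)) ∧
          Function.Bijective (Φ.toHom n)) ∧
      -- the short exact sequence `1 → π₁ (C / H) → π₁ (C / G) → G / H → 1`
      (∃ (ι : GroupOperadHom A B) (bd : GroupOperadHom B (H.quotient hH)),
        (∀ n (f : Path (η.pt n) (η.pt n)),
          ι.toHom n (LoopGroup.mk f) =
            LoopGroup.mk (f.map (OrbitSpace.proj (H.carrier n)).continuous)) ∧
        (∀ n (σ : G n ⧸ H.carrier n) (f : Path (η.pt n) (σ • η.pt n)),
          bd.toHom n (η.liftClass (fun n => OrbitSpace.proj (H.carrier n))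
            (fun n => OrbitSpace.proj_smul (H.carrier n)) σ f) = σ) ∧
        ∀ n, Function.Injective (ι.toHom n) ∧ (ι.toHom n).range = (bd.toHom n).ker ∧
          Function.Surjective (bd.toHom n)) ∧
      -- `π_l (C / G)` is a `π₁ (C / G)`-operad for `l > 1`
      (∀ l : ℕ, 1 < l →
        ∃ (Ol : OperadStr fun n => HomotopyGroup.Pi l (OrbitSpace (G n) (C n))
            (OrbitSpace.proj (H.carrier n) (η.pt n)))
          (act : ∀ n, MulAction
            (LoopGroup (OrbitSpace (G n) (C n)) (OrbitSpace.proj (H.carrier n) (η.pt n)))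
            (HomotopyGroup.Pi l (OrbitSpace (G n) (C n))
              (OrbitSpace.proj (H.carrier n) (η.pt n)))),
          η.IsHigherOperad (fun n => OrbitSpace.proj (H.carrier n)) l Ol ∧
          (∀ n (a : Path (OrbitSpace.proj (G := G n) (H.carrier n) (η.pt n))
              (OrbitSpace.proj (H.carrier n) (η.pt n)))
            (f : GenLoop (Fin l) (OrbitSpace (G n) (C n))
              (OrbitSpace.proj (H.carrier n) (η.pt n))),
            (act n).smul (LoopGroup.mk a) (cubeClass f) = cubeClass (cubeAlong a f)) ∧
          IsOperadAction B Ol (act := act)) ∧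
      -- for `l = 1` the same holds if `G` is non-crossed
      (P.NonCrossed →
        ∃ act : ∀ n, MulAction
            (LoopGroup (OrbitSpace (G n) (C n)) (OrbitSpace.proj (H.carrier n) (η.pt n)))
            (LoopGroup (OrbitSpace (G n) (C n)) (OrbitSpace.proj (H.carrier n) (η.pt n))),
          (∀ n (a b : LoopGroup (OrbitSpace (G n) (C n))
            (OrbitSpace.proj (H.carrier n) (η.pt n))), (act n).smul a b = a * b * a⁻¹) ∧
          IsOperadAction B B.toOperadStr (act := act)) := by
  have hact' : IsOperadAction (H.quotient hH) (H.quotientOperad hH hact).toOperadStr :=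
    H.isOperadAction_quotient hH hact
  have hq : ∀ n, IsQuotientCoveringMap
      (OrbitSpace.proj (H.carrier n) : C(OrbitSpace (H.carrier n) (C n), OrbitSpace (G n) (C n)))
      (G n ⧸ H.carrier n) :=
    fun n => OrbitSpace.isQuotientCoveringMap_proj (H.carrier n) (hcov n)
  have hp := fun n => OrbitSpace.proj_smul (H.carrier n) (X := C n)
  have hc := fun n => (hq n).isCoveringMap
  obtain ⟨A, hA, hA'⟩ := η.exists_isLoopOperad
  let p' : ∀ n, C(OrbitSpace (H.carrier n) (C n),
      OrbitSpace (G n ⧸ H.carrier n) (OrbitSpace (H.carrier n) (C n))) :=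
    fun n => ⟨OrbitSpace.mk (G n ⧸ H.carrier n), OrbitSpace.continuous_mk⟩
  have hp' : ∀ n (σ : G n ⧸ H.carrier n) (x : OrbitSpace (H.carrier n) (C n)),
      p' n (σ • x) = p' n x := fun n σ x => OrbitSpace.mk_eq_mk.2 ⟨σ, rfl⟩
  have hq' : ∀ n, IsQuotientCoveringMap (p' n) (G n ⧸ H.carrier n) :=
    fun n => OrbitSpace.isQuotientCoveringMap_mk (hcov n)
  let B := η.quotientLoopOperad (fun n => OrbitSpace.proj (H.carrier n)) hp hq hact'
  refine ⟨A, B, ⟨hA, hA'⟩, η.isQuotientLoopOperad_quotientLoopOperad _ hp hq hact', ?_, ?_, ?_, ?_⟩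
  -- The same construction is applied to the iterated quotient; following `p' n` by `iterated` gives
  -- the projection that defines `B`.
  · refine ⟨η.quotientLoopOperad p' hp' hq' hact', η.quotientMapHom p' hp' hq' hact'
      (fun n => OrbitSpace.iterated (H.carrier n)) hp hq,
      η.isQuotientLoopOperad_quotientLoopOperad _ hp' hq' hact', fun n =>
      ⟨OrbitSpace.isHomeomorph_iterated _, fun f => rfl, ?_⟩⟩
    exact η.quotientMapHom_bijective p' hp' hq' (fun n => OrbitSpace.iterated (H.carrier n)) hp hq n
  · exact ⟨η.projHom _ hp hq hact' hA hA', η.degreeHom _ hp hq hact', fun n f => rfl,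
      fun n σ f => η.degree_liftClass _ hp hq σ f, fun n => ⟨η.map_injective _ hp hq,
      η.range_map_eq_ker_degree _ hp hq n, η.degree_surjective _ hp hq n⟩⟩
  · intro l hl
    exact ⟨η.higherOperad _ hc hl, fun n => cubeAction l _, η.isHigherOperad_higherOperad _ hc hl,
      fun n a f => cubeAction_smul a f, η.isOperadAction_higherOperad _ hc hl hp hq hact'⟩
  · intro hP
    -- The permutation of a loop class is that of its degree in `G n ⧸ H.carrier n`, hence of a
    -- representative in `G n`, where `π` is trivial.
    have hB : B.NonCrossed := fun n a => by
      change QuotientGroup.lift (H.carrier n) (P.π n) (hH n) (η.degree _ hp hq n a) = 1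
      obtain ⟨g, hg⟩ := QuotientGroup.mk_surjective (η.degree _ hp hq n a)
      rw [← hg]
      exact hP n g
    let act : ∀ n, MulAction
        (LoopGroup (OrbitSpace (G n) (C n)) (OrbitSpace.proj (H.carrier n) (η.pt n)))
        (LoopGroup (OrbitSpace (G n) (C n)) (OrbitSpace.proj (H.carrier n) (η.pt n))) :=
      fun n => conjAction _
    have ha : ∀ n (a b : LoopGroup (OrbitSpace (G n) (C n))
        (OrbitSpace.proj (H.carrier n) (η.pt n))), (act n).smul a b = a * b * a⁻¹ :=
      fun n a b => conjAction_smul a b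
    exact ⟨act, ha, hB.isOperadAction_conj act ha⟩
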